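/- Let $\triangleleft$ be the Sharkovskii ordering of the positive integers, $$1\triangleleft 2\triangleleft 2^2\triangleleft\cdots\triangleleft 2^2\cdot5\triangleleft 2^2\cdot 3\triangleleft\cdots\triangleleft 2\cdot5\triangleleft2\cdot3\triangleleft\cdots\triangleleft 9\triangleleft7\triangleleft5\triangleleft3 .$$ Let $I\subseteq\mathbb R$ be a non-degenerate interval and $f:I\to I$ continuous. An $m$-orbit $\beta_1<\dots<\beta_m$ of $f$ (the orbit of a periodic point of least period $m$) is *minimal* if every other period $p$ of a periodic point of $f$ satisfies $p\triangleleft m$. Its *digraph* has the vertices $J_1,\dots,J_{m-1}$, $J_i=[\beta_i,\beta_{i+1}]$, and an edge $J_i\to J_s$ whenever $J_s$ is contained in the closed interval with endpoints $f(\beta_i),f(\beta_{i+1})$. The *inverse* digraph is obtained by replacing each $J_i$ by $J_{m-i}$; two digraphs have the same *type up to inverses* if they are equal (as digraphs on the labelled vertices $J_1,\dots,J_{m-1}$) or inverse to each other. An orbit of odd length $2k+1$ is *simple* if it is a Štefan orbit: with $c$ its middle point and $c_{\pm j}$ its $j$-th point to the right, respectively left, of $c$, $f$ acts by $c\mapsto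 c_{+1}\mapsto c_{-1}\mapsto c_{+2}\mapsto c_{-2}\mapsto\dots\mapsto c_{+k}\mapsto c_{-k}\mapsto c$ or by the mirror image of this. For $n\ge1$ and $q$ odd, an orbit of length $2^nq$ is *simple* if $f$ interchanges its left and right halves and each half is a simple $2^{n-1}q$-orbit of $f^2$. A simple $2^nq$-orbit is *strongly simple* if $f$ is monotone (increasing or decreasing) on all but one of its $2^n$ blocks of $q$ consecutive points. **Theorem.** Let $k>1$, $n\ge0$ and $m=2^n(2k+1)$. 1. The digraphs of minimal $m$-orbits form exactly $2^{2^{n+1}-2}$ types up to inverses, and these types are the same for every non-degenerate interval $I$. 2. Every minimal $m$-orbit is strongly simple. 3. If $n\ge1$, the left and right halves of a minimal $m$-orbit of $f$ are interchanged by $f$, and each of them is a minimal and strongly simple $2^{n-1}(2k+1)$-orbit of $f^2$. 4. If $n\ge1$, the digraphs of minimal $m$-orbits are constructed from the digraphs of these two halves as follows: for any digraphs $G,G'$ of minimal $2^{n-1}(2k+1)$-orbits of continuous maps of $I$ into itself, there are exactly two digraphs of minimal $m$-orbits of continuous maps $f:I\to I$ whose left and right halves have, as orbits of $f^2$, the digraphs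 $G$ and $G'$. -/

import Mathlib

/-- The Sharkovskii ordering `m ◁ n` of the positive integers:
`1 ◁ 2 ◁ 2² ◁ 2³ ◁ ⋯ ◁ 2²·5 ◁ 2²·3 ◁ ⋯ ◁ 2·5 ◁ 2·3 ◁ ⋯ ◁ 9 ◁ 7 ◁ 5 ◁ 3`. -/
def SharkovskiiLT (m n : ℕ) : Prop :=
  (∃ a b : ℕ, m = 2 ^ a ∧ n = 2 ^ b ∧ a < b) ∨
  (∃ a b s : ℕ, m = 2 ^ a ∧ n = 2 ^ b * s ∧ Odd s ∧ 1 < s) ∨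
  (∃ a b r s : ℕ, m = 2 ^ a * r ∧ n = 2 ^ b * s ∧ Odd r ∧ 1 < r ∧ Odd s ∧ 1 < s ∧
    (b < a ∨ (a = b ∧ s < r)))

section Orbits

variable {X : Type*} [LinearOrder X] {m : ℕ}

/-- `β 0 < β 1 < ⋯ < β (m - 1)` is the increasing enumeration of an `m`-orbit of `f`, that is, of
the set `{c, f c, …, f^(m-1) c}` of a periodic point `c` of least period `m ≥ 1`. -/
def IsPeriodicOrbit (f : X → X) (β : Fin m → X) : Prop :=
  0 < m ∧ StrictMono β ∧
    ∃ c : X, Function.minimalPeriod f c = m ∧ Set.range β = {x | ∃ j < m, f^[j] c = x}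

/-- An `m`-orbit of `f` is minimal if every other period `p` of a periodic point of `f` satisfies
`p ◁ m`; that is, `m` is the extremal period of `f` in the Sharkovskii ordering. -/
def IsMinimalOrbit (f : X → X) (β : Fin m → X) : Prop :=
  IsPeriodicOrbit f β ∧
    ∀ (p : ℕ) (x : X), 0 < p → Function.minimalPeriod f x = p → p = m ∨ SharkovskiiLT p m

/-- The digraph of an orbit. Its vertices are the `m - 1` intervals `J i = [β i, β (i+1)]` (here
numbered from `0`), and `J i → J s` when `J s` is contained in the closed interval with endpoints
`f (β i)` and `f (β (i+1))`. -/
def orbitDigraph (f : X → X) (β : Fin m → X) : Digraph (Fin (m - 1)) where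
  Adj i s :=
    Set.Icc (β ⟨s, by omega⟩) (β ⟨s + 1, by omega⟩) ⊆
      Set.uIcc (f (β ⟨i, by omega⟩)) (f (β ⟨i + 1, by omega⟩))

/-- The inverse digraph: the order of the vertices is reversed. -/
def inverseDigraph {v : ℕ} (G : Digraph (Fin v)) : Digraph (Fin v) where
  Adj i s := G.Adj i.rev s.rev

/-- The type of a digraph up to inverses: the class of a digraph that is identified with its
inverse (inversion is an involution, so the class has at most these two members). -/
def digraphType {v : ℕ} (G : Digraph (Fin v)) : Set (Digraph (Fin v)) :=
  {G, inverseDigraph G}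

/-- The left half (first `m / 2` points) of an orbit. -/
def leftHalf (β : Fin m → X) : Fin (m / 2) → X :=
  fun i => β ⟨i, by omega⟩

/-- The right half of an orbit: `m / 2` consecutive points from number `m / 2` on (these are the
last `m / 2` points when `m` is even). -/
def rightHalf (β : Fin m → X) : Fin (m / 2) → X :=
  fun i => β ⟨i + m / 2, by omega⟩

/-- Štefan orbits. For `m = 2k+1` and `c` the middle point of the orbit, `f` acts on the points
either by `c ↦ c₊₁ ↦ c₋₁ ↦ c₊₂ ↦ c₋₂ ↦ ⋯ ↦ c₊ₖ ↦ c₋ₖ ↦ c`, where `c₊ⱼ` and `c₋ⱼ` are the `j`-th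
points to the right and to the left of `c`, or by the mirror image of this. -/
def IsStefanOrbit (f : X → X) (β : Fin m → X) : Prop :=
  ∃ (k : ℕ) (hm : m = 2 * k + 1),
    (f (β ⟨0, by omega⟩) = β ⟨k, by omega⟩ ∧
      (∀ (j : ℕ) (_ : j < k), f (β ⟨k - j, by omega⟩) = β ⟨k + (j + 1), by omega⟩) ∧
      (∀ (j : ℕ) (_ : j < k), f (β ⟨k + (j + 1), by omega⟩) = β ⟨k - (j + 1), by omega⟩)) ∨
    (f (β ⟨2 * k, by omega⟩) = β ⟨k, by omega⟩ ∧
      (∀ (j : ℕ) (_ : j < k), f (β ⟨k + j, by omega⟩) = β ⟨k - (j + 1), by omega⟩) ∧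
      (∀ (j : ℕ) (_ : j < k), f (β ⟨k - (j + 1), by omega⟩) = β ⟨k + (j + 1), by omega⟩))

/-- `f` interchanges the left and the right half of an orbit of even length. -/
def SwapsHalves (f : X → X) (β : Fin m → X) : Prop :=
  Even m ∧ (∀ i, f (leftHalf β i) ∈ Set.range (rightHalf β)) ∧
    ∀ i, f (rightHalf β i) ∈ Set.range (leftHalf β)

/-- Simple orbits of length `m = 2^n q`, `q` odd. For `n = 0` these are the Štefan orbits; for
`n ≥ 1`, `f` interchanges the two halves, and each half is a simple orbit of `f²`. -/
def IsSimpleOrbit : (n : ℕ) → {m : ℕ} → (X → X) → (Fin m → X) → Prop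
  | 0, _, f, β => IsStefanOrbit f β
  | n + 1, _, f, β =>
      SwapsHalves f β ∧ IsSimpleOrbit n f^[2] (leftHalf β) ∧ IsSimpleOrbit n f^[2] (rightHalf β)

/-- The `j`-th block of `q` consecutive points of an orbit. -/
def orbitBlock (β : Fin m → X) (q j : ℕ) : Set X :=
  {x | ∃ i : Fin m, i.val / q = j ∧ β i = x}

/-- Strongly simple orbits of length `m = 2^n q`, `q` odd: simple orbits such that `f` is monotone
(increasing or decreasing) on all but one of the `2^n` blocks of `q` consecutive points. -/
def IsStronglySimple (n : ℕ) (f : X → X) (β : Fin m → X) : Prop :=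
  IsSimpleOrbit n f β ∧
    ∃ j₀ < 2 ^ n, ∀ j < 2 ^ n, j ≠ j₀ →
      MonotoneOn f (orbitBlock β (m / 2 ^ n) j) ∨ AntitoneOn f (orbitBlock β (m / 2 ^ n) j)

end Orbits

/-- The digraphs of the minimal `m`-orbits of the continuous maps of `I` into itself. -/
def minimalDigraphs (I : Set ℝ) (m : ℕ) : Set (Digraph (Fin (m - 1))) :=
  {D | ∃ (f : I → I) (β : Fin m → I), Continuous f ∧ IsMinimalOrbit f β ∧ D = orbitDigraph f β}

/-- The digraphs of those minimal `m`-orbits of continuous maps `f` of `I` into itself whose left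
and right halves have, with respect to `f²`, the digraphs `G` and `G'`. -/
def minimalDigraphsFrom (I : Set ℝ) (m : ℕ) (G G' : Digraph (Fin (m / 2 - 1))) :
    Set (Digraph (Fin (m - 1))) :=
  {D | ∃ (f : I → I) (β : Fin m → I), Continuous f ∧ IsMinimalOrbit f β ∧ D = orbitDigraph f β ∧
    orbitDigraph f^[2] (leftHalf β) = G ∧ orbitDigraph f^[2] (rightHalf β) = G'}

/-! An orbit matters only through the cyclic permutation `σ` by which the map acts on its points,
numbered from left to right: the digraph depends on `σ` alone (`orbitDigraph_eq`) and, for at least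
three points, a permutation can be recovered from it (`orbitDigraph_id_injective`). The core of the
proof is that the permutations of minimal orbits are exactly those with `IsCenteredSimple`; the rest
is counting.

Necessity. Minimality forbids certain odd periods of iterates of `f`, and loops of intervals
covering each other produce such periods. For odd `m`, the images of a central interval swallow the
orbit one point at a time, and a point failing to change sides too early would close a short odd
loop; this forces the Štefan spiral (`stefan_of_minimal_odd`). For even `m` there is no odd period
above `1`, so every point changes sides, the halves are interchanged, and each half is minimal for
`f²`. By induction the orbit is simple: its `2^n` blocks are Štefan orbits of `f^[2^n]`. An iterate
`f^[u]` with `u ≤ 2^n` commutes with `f^[2^n]` and hence carries a block to another one with some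
shift along the Štefan cycle. Any shift other than `0` and `1` creates a smaller odd period
(`exists_odd_period_of_shift`). Once around all blocks the shift is `1`, so exactly one middle point
is not mapped to a middle point (`IsMinimalOrbit.isCenteredSimple`). All other blocks are translated
or reflected, which is strong simplicity.

Sufficiency. The connect-the-dots map of a centered simple permutation is minimal
(`IsCenteredSimple.isMinimalOrbit_dotMap`). A periodic point that stays in the gaps between the
pieces of some level follows a monotone iterate, so its period divides a power of two. Any other
periodic point visits all blocks, and the return map to the special block is the connect-the-dots
map of one Štefan orbit, which has no odd period strictly between `1` and `2k+1`
(`stefanMap_fixed`).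

Counting. For `n ≥ 1`, `σ` consists of a map `A` from the left half to the right one and a map `B`
back, with `B ∘ A` and `A ∘ B` the given squares. The special middle point lies in one half, so `A`
or `B` preserves middle points. Conjugations of two cycles differ by rotations, and preserving
middle points fixes the rotation, so each alternative leaves one `σ` (`ncard_centeredSimpleFrom`).
Hence the number of permutations satisfies `N₀ = 2` and `N₍ₙ₊₁₎ = 2 Nₙ²`. Inversion is a mirror
image without fixed points on these permutations, so the number of types is half of that. -/

/-! ### Arithmetic of the Sharkovskii ordering -/

theorem two_pow_mul_odd_inj {a b r s : ℕ} (hr : Odd r) (hs : Odd s) (h : 2 ^ a * r = 2 ^ b * s) :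
    a = b ∧ r = s := by
  induction a generalizing b with
  | zero =>
    cases b with
    | zero => simpa using h
    | succ b =>
      exfalso
      rw [pow_zero, one_mul, pow_succ'] at h
      rw [h, mul_assoc] at hr
      exact (Nat.not_odd_iff_even.2 (even_two_mul _)) hr
  | succ a ih =>
    cases b with
    | zero =>
      exfalso
      rw [pow_zero, one_mul, pow_succ'] at h
      rw [← h, mul_assoc] at hs
      exact (Nat.not_odd_iff_even.2 (even_two_mul _)) hs
    | succ b =>
      have := ih (b := b) (by rw [pow_succ', pow_succ', mul_assoc, mul_assoc] at h; omega)
      exact ⟨by omega, this.2⟩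

/-- Powers of two precede every number with a nontrivial odd part, so only periods with odd part
above `1` are restricted. In this form minimality is easy to pass to `f²`, where exponents of two
drop by one. -/
theorem eq_or_sharkovskiiLT_iff {p n q : ℕ} (hp : 0 < p) (hq : Odd q) (hq1 : 1 < q) :
    (p = 2 ^ n * q ∨ SharkovskiiLT p (2 ^ n * q)) ↔
      ∀ a s, p = 2 ^ a * s → Odd s → 1 < s → n < a ∨ (a = n ∧ q ≤ s) := by
  constructor
  · rintro (h | ⟨a', b', h1, h2, -⟩ | ⟨a', b', s', h1, h2, h3, h4⟩ |
      ⟨a', b', r', s', h1, h2, h3, h4, h5, h6, h7⟩) a s h0 hs hs1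
    · obtain ⟨h1, h2⟩ := two_pow_mul_odd_inj hq hs (h.symm.trans h0)
      exact Or.inr ⟨h1.symm, h2.le⟩
    · have := two_pow_mul_odd_inj hs odd_one (h0.symm.trans (h1.trans (mul_one _).symm))
      omega
    · have := two_pow_mul_odd_inj hs odd_one (h0.symm.trans (h1.trans (mul_one _).symm))
      omega
    · have e1 := two_pow_mul_odd_inj hs h3 (h0.symm.trans h1)
      have e2 := two_pow_mul_odd_inj hq h5 h2
      omega
  · intro h
    obtain ⟨a, s, hs, rfl⟩ := Nat.exists_eq_two_pow_mul_odd hp.ne'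
    rcases eq_or_ne s 1 with rfl | hs1
    · exact Or.inr (Or.inr (Or.inl ⟨a, n, q, by simp, rfl, hq, hq1⟩))
    · have hs2 : 1 < s := by have := hs.pos; omega
      rcases h a s rfl hs hs2 with h1 | ⟨rfl, h1⟩
      · exact Or.inr (Or.inr (Or.inr ⟨a, n, s, q, rfl, rfl, hs, hs2, hq, hq1, Or.inl h1⟩))
      · rcases h1.eq_or_lt with rfl | h1
        · exact Or.inl rfl
        · exact Or.inr (Or.inr (Or.inr ⟨a, a, s, q, rfl, rfl, hs, hs2, hq, hq1,
            Or.inr ⟨rfl, h1⟩⟩))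

/-! ### Coverings of intervals and the periodic points they force -/

section Covering

variable {X : Type*} [ConditionallyCompleteLinearOrder X] [DenselyOrdered X] [TopologicalSpace X]
  [OrderTopology X]

theorem uIcc_image_subset_image {f : X → X} (hf : Continuous f) (a b : X) :
    Set.uIcc (f a) (f b) ⊆ f '' Set.uIcc a b :=
  intermediate_value_uIcc hf.continuousOn

theorem ordConnected_image_uIcc {f : X → X} (hf : Continuous f) (a b : X) :
    (f '' Set.uIcc a b).OrdConnected :=
  (isPreconnected_uIcc.image f hf.continuousOn).ordConnected

/-- Take for `u` the last point of `[a, b]` with the value `g a`, and for `v` the first point from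
`u` on with the value `g b`. By the intermediate value theorem, a value outside the hull would force
a later `u` or an earlier `v`. -/
theorem exists_Icc_image_eq {g : X → X} (hg : Continuous g) {a b : X} (hab : a ≤ b) :
    ∃ u v, u ≤ v ∧ Set.Icc u v ⊆ Set.Icc a b ∧ g '' Set.Icc u v = Set.uIcc (g a) (g b) := by
  have hS : IsCompact (Set.Icc a b ∩ g ⁻¹' {g a}) :=
    isCompact_Icc.inter_right (isClosed_singleton.preimage hg)
  obtain ⟨u, ⟨⟨hu1, hu2⟩, hu3⟩, hu⟩ := hS.exists_isGreatest ⟨a, ⟨le_rfl, hab⟩, rfl⟩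
  have hS' : IsCompact (Set.Icc u b ∩ g ⁻¹' {g b}) :=
    isCompact_Icc.inter_right (isClosed_singleton.preimage hg)
  obtain ⟨v, ⟨⟨hv1, hv2⟩, hv3⟩, hv⟩ := hS'.exists_isLeast ⟨b, ⟨hu2, le_rfl⟩, rfl⟩
  simp only [Set.mem_preimage, Set.mem_singleton_iff] at hu3 hv3
  refine ⟨u, v, hv1, Set.Icc_subset_Icc hu1 hv2, ?_⟩
  apply Set.Subset.antisymm
  · rintro _ ⟨t, ⟨ht1, ht2⟩, rfl⟩
    by_contra hcon
    have : g a ∈ Set.uIcc (g t) (g v) ∨ g b ∈ Set.uIcc (g u) (g t) := by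
      rw [hu3, hv3]
      simp only [Set.mem_uIcc] at hcon ⊢
      grind
    rcases this with h | h
    · obtain ⟨t', ht', e⟩ := uIcc_image_subset_image hg _ _ h
      rw [Set.uIcc_of_le ht2] at ht'
      have h1 : t' ≤ u := hu ⟨⟨hu1.trans (ht1.trans ht'.1), ht'.2.trans hv2⟩, e⟩
      have : t = t' := le_antisymm ht'.1 (h1.trans ht1)
      exact hcon (by rw [this, e]; exact Set.left_mem_uIcc)
    · obtain ⟨t', ht', e⟩ := uIcc_image_subset_image hg _ _ h
      rw [Set.uIcc_of_le ht1] at ht'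
      have h1 : v ≤ t' := hv ⟨⟨ht'.1, ht'.2.trans (ht2.trans hv2)⟩, e⟩
      have : t = t' := le_antisymm (ht2.trans h1) ht'.2
      exact hcon (by rw [this, e]; exact Set.right_mem_uIcc)
  · rw [← hu3, ← hv3, ← Set.uIcc_of_le hv1]
    exact uIcc_image_subset_image hg _ _

theorem exists_Icc_image_eq_uIcc {g : X → X} (hg : Continuous g) {a b c d : X}
    (h : Set.uIcc c d ⊆ g '' Set.uIcc a b) :
    ∃ u v, u ≤ v ∧ Set.Icc u v ⊆ Set.uIcc a b ∧ g '' Set.Icc u v = Set.uIcc c d := by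
  obtain ⟨u, hu, rfl⟩ := h Set.left_mem_uIcc
  obtain ⟨v, hv, rfl⟩ := h Set.right_mem_uIcc
  rcases le_total u v with huv | huv
  · obtain ⟨u', v', h1, h2, h3⟩ := exists_Icc_image_eq hg huv
    exact ⟨u', v', h1, h2.trans (Set.ordConnected_uIcc.out hu hv), h3⟩
  · obtain ⟨u', v', h1, h2, h3⟩ := exists_Icc_image_eq hg huv
    exact ⟨u', v', h1, h2.trans (Set.ordConnected_uIcc.out hv hu), h3.trans (Set.uIcc_comm _ _)⟩

/-- A loop of two coverings is followed by a periodic point. -/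
theorem exists_fixed_of_covering_loop {g h : X → X} (hg : Continuous g) (hh : Continuous h)
    {a b c d : X} (h1 : Set.uIcc c d ⊆ g '' Set.uIcc a b)
    (h2 : Set.uIcc a b ⊆ h '' Set.uIcc c d) :
    ∃ x ∈ Set.uIcc a b, g x ∈ Set.uIcc c d ∧ h (g x) = x := by
  obtain ⟨u, v, huv, hsub, him⟩ := exists_Icc_image_eq_uIcc hg h1
  -- Because `[u, v]` was shrunk until its image is exactly the second interval, `h ∘ g` stretches
  -- `[u, v]` over itself, and the fixed point found there also visits the second interval.
  have hcov : Set.Icc u v ⊆ (h ∘ g) '' Set.Icc u v := by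
    rw [Set.image_comp, him]; exact hsub.trans h2
  obtain ⟨s, hs, es⟩ := hcov (Set.left_mem_Icc.2 huv)
  obtain ⟨t, ht, et⟩ := hcov (Set.right_mem_Icc.2 huv)
  obtain ⟨x, hx, ex⟩ := exists_mem_uIcc_isFixedPt (f := h ∘ g) (hh.comp hg).continuousOn
    (et.symm ▸ ht.2 : t ≤ (h ∘ g) t) (es.symm ▸ hs.1 : (h ∘ g) s ≤ s)
  have hx' : x ∈ Set.Icc u v := Set.ordConnected_Icc.uIcc_subset ht hs hx
  exact ⟨x, hsub hx', him ▸ Set.mem_image_of_mem g hx', ex⟩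

/-- The loop yields a fixed point of `f^[l]`, whose least period divides the odd number `l`. A fixed
point of `f` would lie in both intervals, which `hfix` excludes. -/
theorem exists_odd_period {f : X → X} (hf : Continuous f) {a b c d : X} {l : ℕ} (hl : Odd l)
    (h1 : Set.uIcc c d ⊆ f '' Set.uIcc a b) (h2 : Set.uIcc a b ⊆ f^[l - 1] '' Set.uIcc c d)
    (hfix : ∀ x ∈ Set.uIcc a b, x ∈ Set.uIcc c d → f x ≠ x) :
    ∃ x, Odd (Function.minimalPeriod f x) ∧ 1 < Function.minimalPeriod f x ∧
      Function.minimalPeriod f x ≤ l := by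
  obtain ⟨x, hx, hfx, e⟩ := exists_fixed_of_covering_loop hf (hf.iterate (l - 1)) h1 h2
  have hper : Function.IsPeriodicPt f l x := by
    rw [← Function.iterate_succ_apply, Nat.succ_eq_add_one, Nat.sub_add_cancel hl.pos] at e
    exact e
  have hdvd := hper.minimalPeriod_dvd
  have hodd := hl.of_dvd_nat hdvd
  refine ⟨x, hodd, ?_, Nat.le_of_dvd hl.pos hdvd⟩
  have h0 := hodd.pos
  have h3 : Function.minimalPeriod f x ≠ 1 := fun h => by
    have h' : f x = x := Function.minimalPeriod_eq_one_iff_isFixedPt.1 h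
    exact hfix x hx (h' ▸ hfx) h'
  omega

end Covering

/-! ### Periodic orbits and their cyclic permutations -/

section PeriodicOrbit

variable {X Y : Type*} [LinearOrder X] [LinearOrder Y] {m : ℕ} {f : X → X} {β : Fin m → X}

theorem IsPeriodicOrbit.minimalPeriod_eq (h : IsPeriodicOrbit f β) (i : Fin m) :
    Function.minimalPeriod f (β i) = m := by
  obtain ⟨hm, -, c, hc, hr⟩ := h
  obtain ⟨j, -, hj⟩ : β i ∈ {x | ∃ j < m, f^[j] c = x} := hr ▸ Set.mem_range_self i
  rw [← hj, Function.minimalPeriod_apply_iterate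
    (Function.minimalPeriod_pos_iff_mem_periodicPts.1 (hc ▸ hm)), hc]

theorem IsPeriodicOrbit.exists_iterate_eq (h : IsPeriodicOrbit f β) (i j : Fin m) :
    ∃ t < m, f^[t] (β i) = β j := by
  have hi := h.minimalPeriod_eq i
  obtain ⟨hm, -, c, hc, hr⟩ := h
  obtain ⟨a, ha, ea⟩ : β i ∈ {x | ∃ j < m, f^[j] c = x} := hr ▸ Set.mem_range_self i
  obtain ⟨b, hb, eb⟩ : β j ∈ {x | ∃ j < m, f^[j] c = x} := hr ▸ Set.mem_range_self j
  refine ⟨(b + (m - a)) % m, Nat.mod_lt _ hm, ?_⟩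
  have e : f^[(b + (m - a)) % m] (β i) = f^[b + (m - a)] (β i) := by
    have := Function.iterate_mod_minimalPeriod_eq (f := f) (x := β i) (n := b + (m - a))
    rwa [hi] at this
  rw [e, ← ea, ← Function.iterate_add_apply,
    show b + (m - a) + a = b + m by omega, ← eb, Function.iterate_add_apply]
  congr 1
  rw [← hc]
  exact Function.isPeriodicPt_minimalPeriod f c

/-- The first `m` iterates of a point of period `m` are distinct and stay in a set of `m` points,
hence exhaust it. -/
theorem isPeriodicOrbit_of_mem_range (hm : 0 < m) (hβ : StrictMono β)
    (hmap : ∀ i, f (β i) ∈ Set.range β) (i : Fin m) (hi : Function.minimalPeriod f (β i) = m) :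
    IsPeriodicOrbit f β := by
  refine ⟨hm, hβ, β i, hi, ?_⟩
  have hfin : (Set.range β).ncard = m := by
    rw [← Set.image_univ, Set.ncard_image_of_injective _ hβ.injective, Set.ncard_univ,
      Nat.card_eq_fintype_card, Fintype.card_fin]
  have hiter : ∀ j, f^[j] (β i) ∈ Set.range β := by
    intro j
    induction j with
    | zero => exact Set.mem_range_self i
    | succ j ih =>
      rw [Function.iterate_succ_apply']
      obtain ⟨t, ht⟩ := ih
      rw [← ht]; exact hmap t
  symm
  apply Set.eq_of_subset_of_ncard_le
  · rintro _ ⟨j, -, rfl⟩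
    exact hiter j
  · rw [hfin]
    have : {x | ∃ j < m, f^[j] (β i) = x} = (fun j => f^[j] (β i)) '' (Set.Iio m) := by
      ext x; simp
    have hinj : Set.InjOn (fun j => f^[j] (β i)) (Set.Iio m) := by
      have := Function.iterate_injOn_Iio_minimalPeriod (f := f) (x := β i)
      rwa [hi] at this
    rw [this, hinj.ncard_image]
    simp
  · exact Set.finite_range β

theorem IsPeriodicOrbit.exists_semiconj (h : IsPeriodicOrbit f β) :
    ∃ σ : Fin m → Fin m, Function.Semiconj β σ f := by
  have : ∀ i, ∃ j, β j = f (β i) := by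
    intro i
    obtain ⟨hm, -, c, hc, hr⟩ := h
    obtain ⟨j, hj, e⟩ : β i ∈ {x | ∃ j < m, f^[j] c = x} := hr ▸ Set.mem_range_self i
    have : f (β i) ∈ Set.range β := by
      rw [hr]
      refine ⟨(j + 1) % m, Nat.mod_lt _ hm, ?_⟩
      conv_lhs => rw [← hc]
      rw [Function.iterate_mod_minimalPeriod_eq, Function.iterate_succ_apply', e]
    exact this
  choose σ hσ using this
  exact ⟨σ, hσ⟩

theorem minimalPeriod_eq_of_semiconj {X Y : Type*} {f : X → X} {g : Y → Y} {φ : X → Y}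
    (hφ : Function.Injective φ) (h : Function.Semiconj φ f g) (x : X) :
    Function.minimalPeriod g (φ x) = Function.minimalPeriod f x := by
  apply Nat.dvd_antisymm
  · apply Function.IsPeriodicPt.minimalPeriod_dvd
    have := Function.isPeriodicPt_minimalPeriod f x
    unfold Function.IsPeriodicPt Function.IsFixedPt at *
    rw [← (h.iterate_right _).eq, this]
  · apply Function.IsPeriodicPt.minimalPeriod_dvd
    have := Function.isPeriodicPt_minimalPeriod g (φ x)
    unfold Function.IsPeriodicPt Function.IsFixedPt at *
    rw [← (h.iterate_right _).eq] at this
    exact hφ this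

theorem IsPeriodicOrbit.of_semiconj {g : Y → Y} {γ : Fin m → Y} (h : IsPeriodicOrbit g γ)
    {φ : X → Y} (hφ : Function.Injective φ) (hs : Function.Semiconj φ f g) (hβ : StrictMono β)
    (hr : Set.range (φ ∘ β) = Set.range γ) : IsPeriodicOrbit f β := by
  obtain ⟨σ, hσ⟩ := h.exists_semiconj
  have hm := h.1
  have hi : ∀ i, ∃ j, γ j = φ (β i) := fun i => by
    have : φ (β i) ∈ Set.range γ := hr ▸ ⟨i, rfl⟩
    exact this
  refine isPeriodicOrbit_of_mem_range hm hβ (fun i => ?_) ⟨0, hm⟩ ?_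
  · obtain ⟨j, hj⟩ := hi i
    have : g (γ j) ∈ Set.range (φ ∘ β) := hr ▸ ⟨σ j, hσ j⟩
    obtain ⟨l, hl⟩ := this
    exact ⟨l, hφ (by rw [hs.eq, ← hj, ← hl]; rfl)⟩
  · obtain ⟨j, hj⟩ := hi ⟨0, hm⟩
    rw [← minimalPeriod_eq_of_semiconj hφ hs, ← hj, h.minimalPeriod_eq]

/-- An injective semiconjugacy preserves least periods, so every period of `f` is one of `g`. This
carries minimality to other intervals and to mirror images. -/
theorem IsMinimalOrbit.of_semiconj {g : Y → Y} {γ : Fin m → Y} (h : IsMinimalOrbit g γ)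
    {φ : X → Y} (hφ : Function.Injective φ) (hs : Function.Semiconj φ f g) (hβ : StrictMono β)
    (hr : Set.range (φ ∘ β) = Set.range γ) : IsMinimalOrbit f β :=
  ⟨h.1.of_semiconj hφ hs hβ hr, fun p x hp hx =>
    h.2 p (φ x) hp (by rw [minimalPeriod_eq_of_semiconj hφ hs, hx])⟩

/-- The action on indices is regarded as an orbit of its own, enumerated by `id`; the combinatorial
arguments take place there. -/
theorem IsPeriodicOrbit.perm {σ : Fin m → Fin m} (h : IsPeriodicOrbit f β)
    (hσ : Function.Semiconj β σ f) : IsPeriodicOrbit σ id :=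
  h.of_semiconj h.2.1.injective hσ strictMono_id rfl

theorem IsPeriodicOrbit.injective {σ : Fin m → Fin m} (h : IsPeriodicOrbit σ id) :
    Function.Injective σ := by
  rw [Finite.injective_iff_surjective]
  intro j
  have hj := Function.isPeriodicPt_minimalPeriod σ j
  have e : Function.minimalPeriod σ j = m := h.minimalPeriod_eq j
  rw [e] at hj
  refine ⟨σ^[m - 1] j, ?_⟩
  rw [← Function.iterate_succ_apply' σ, Nat.succ_eq_add_one, Nat.sub_add_cancel h.1]
  exact hj

theorem IsPeriodicOrbit.iterate_eq_self_iff {σ : Fin m → Fin m} (h : IsPeriodicOrbit σ id)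
    (i : Fin m) (t : ℕ) : σ^[t] i = i ↔ m ∣ t := by
  have e : Function.minimalPeriod σ i = m := h.minimalPeriod_eq i
  conv_rhs => rw [← e]
  exact Function.isPeriodicPt_iff_minimalPeriod_dvd

end PeriodicOrbit

/-! ### The Štefan spiral -/

/-- The position, in a Štefan orbit of length `2k+1`, of the `t`-th iterate of the middle point. -/
def stefanPos (k t : ℕ) : ℕ := if t % 2 = 0 then k - t / 2 else k + (t + 1) / 2

theorem stefanPos_le {k t : ℕ} (h : t ≤ 2 * k) : stefanPos k t ≤ 2 * k := by
  unfold stefanPos; split_ifs <;> omega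

/-- The even terms strictly decrease and the odd terms strictly increase, starting from two
neighbours, and only `2k+1` positions are available. Estimating from both ends forces `a = k` and
makes every inequality tight. -/
theorem eq_stefanPos_of_spiral {s : ℕ → ℕ} {a k : ℕ} (hk : 0 < k) (h0 : s 0 = a) (h1 : s 1 = a + 1)
    (he : ∀ j < k, s (2 * j + 2) < s (2 * j)) (ho : ∀ j, j + 1 < k → s (2 * j + 1) < s (2 * j + 3))
    (hle : s (2 * k - 1) ≤ 2 * k) : ∀ t ≤ 2 * k, s t = stefanPos k t := by
  have e1 : ∀ j ≤ k, s (2 * j) + j ≤ a := by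
    intro j
    induction j with
    | zero => intro _; simp [h0]
    | succ j ih => intro hj; have := ih (by omega); have := he j (by omega); grind
  have o1 : ∀ j < k, a + 1 + j ≤ s (2 * j + 1) := by
    intro j
    induction j with
    | zero => intro _; simp [h1]
    | succ j ih => intro hj; have := ih (by omega); have := ho j (by omega); grind
  have e2 : ∀ j ≤ k, j ≤ s (2 * (k - j)) := by
    intro j
    induction j with
    | zero => intro _; simp
    | succ j ih =>
      intro hj; have := ih (by omega); have := he (k - (j + 1)) (by omega)
      rw [show 2 * (k - (j + 1)) + 2 = 2 * (k - j) by omega] at this; omega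
  have o2 : ∀ j < k, s (2 * (k - 1 - j) + 1) + j ≤ 2 * k := by
    intro j
    induction j with
    | zero => intro _; rw [show 2 * (k - 1 - 0) + 1 = 2 * k - 1 by omega]; omega
    | succ j ih =>
      intro hj; have := ih (by omega); have := ho (k - 1 - (j + 1)) (by omega)
      rw [show 2 * (k - 1 - (j + 1)) + 3 = 2 * (k - 1 - j) + 1 by omega] at this; omega
  have hak : a = k := by
    have h3 := e1 k le_rfl
    have h4 := o1 (k - 1) (by omega)
    rw [show 2 * (k - 1) + 1 = 2 * k - 1 by omega] at h4
    omega
  intro t ht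
  unfold stefanPos
  split_ifs with h
  · have h5 := e1 (t / 2) (by omega)
    have h6 := e2 (k - t / 2) (by omega)
    rw [show 2 * (t / 2) = t by omega] at h5
    rw [show 2 * (k - (k - t / 2)) = t by omega] at h6
    omega
  · have h5 := o1 (t / 2) (by omega)
    have h6 := o2 (k - 1 - t / 2) (by omega)
    rw [show 2 * (t / 2) + 1 = t by omega] at h5
    rw [show 2 * (k - 1 - (k - 1 - t / 2)) + 1 = t by omega] at h6
    omega

/-! ### The central interval of a cyclic permutation -/

section Center

variable {m : ℕ} {σ : Fin m → Fin m}

/-- A cyclic permutation moves two adjacent points towards or across each other. -/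
theorem IsPeriodicOrbit.exists_center (h : IsPeriodicOrbit σ id) (hm : 2 ≤ m) :
    ∃ a b : Fin m, b.val = a.val + 1 ∧ b ≤ σ a ∧ σ b ≤ a := by
  have hne : ∀ i, σ i ≠ i := fun i hi => by
    have := (h.iterate_eq_self_iff i 1).1 hi
    have := Nat.le_of_dvd one_pos this
    lia
  -- The centre lies just after the last point that moves to the right.
  let S : Finset (Fin m) := Finset.univ.filter fun i => i < σ i
  have hS : S.Nonempty := ⟨⟨0, by omega⟩, by
    simp only [S, Finset.mem_filter, Finset.mem_univ, true_and]
    have := hne ⟨0, by omega⟩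
    rw [Ne, Fin.ext_iff] at this
    rw [Fin.lt_def]; simp only at this ⊢; omega⟩
  obtain ⟨a, ha, hmax⟩ := S.exists_max_image id hS
  simp only [S, Finset.mem_filter, Finset.mem_univ, true_and, id] at ha hmax
  have hb : a.val + 1 < m := by have := (σ a).2; rw [Fin.lt_def] at ha; omega
  refine ⟨a, ⟨a + 1, hb⟩, rfl, ha, ?_⟩
  by_contra hcon
  rw [not_le, Fin.lt_def] at hcon
  have h1 := hne ⟨a + 1, hb⟩
  have h2 := hmax ⟨a + 1, hb⟩
  rw [Ne, Fin.ext_iff] at h1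
  rw [Fin.lt_def, Fin.le_def] at h2
  simp only at h1 h2
  omega

/-- If all points of a cyclic permutation change sides, then the halves are interchanged. -/
theorem halves_swapped_of_switch (hσ : Function.Injective σ) {a : ℕ} (ha : a < m)
    (h : ∀ i : Fin m, i.val ≤ a ↔ ¬ (σ i).val ≤ a) : m = 2 * (a + 1) := by
  have c1 : (Finset.univ.filter fun i : Fin m => i.val ≤ a).card = a + 1 := by
    rw [← Finset.card_range (a + 1)]
    apply Finset.card_bij (fun i _ => i.val)
    · intro i hi; simp at hi ⊢; omega
    · intro i _ j _ e; exact Fin.ext e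
    · intro b hb; simp at hb; exact ⟨⟨b, by omega⟩, by simpa using hb, rfl⟩
  have c2 := Finset.card_filter_add_card_filter_not (s := (Finset.univ : Finset (Fin m)))
    (fun i : Fin m => i.val ≤ a)
  rw [Finset.card_univ, Fintype.card_fin, c1] at c2
  have c3 : (Finset.univ.filter fun i : Fin m => i.val ≤ a).card ≤
      (Finset.univ.filter fun i : Fin m => ¬ i.val ≤ a).card :=
    Finset.card_le_card_of_injOn σ (fun i hi => by simpa using (h i).1 (by simpa using hi))
      hσ.injOn
  have c4 : (Finset.univ.filter fun i : Fin m => ¬ i.val ≤ a).card ≤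
      (Finset.univ.filter fun i : Fin m => i.val ≤ a).card :=
    Finset.card_le_card_of_injOn σ (fun i hi => by
      have h1 := h i
      simp only [Finset.coe_filter, Finset.mem_univ, true_and, Set.mem_ofPred_eq] at hi ⊢
      tauto) hσ.injOn
  omega

end Center

/-! ### Iterated images of the central interval -/

section Reached

variable {X : Type*} [ConditionallyCompleteLinearOrder X] {m : ℕ} {f : X → X} {β : Fin m → X}
  {σ : Fin m → Fin m} {a b : Fin m}

theorem uIcc_subset_iterate_image {c d : X}
    (h : Set.uIcc c d ⊆ f '' Set.uIcc c d) {r s : ℕ} (hrs : r ≤ s) :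
    f^[r] '' Set.uIcc c d ⊆ f^[s] '' Set.uIcc c d := by
  induction s, hrs using Nat.le_induction with
  | base => exact subset_rfl
  | succ s _ ih =>
    refine ih.trans ?_
    rw [Function.iterate_succ, Set.image_comp]
    exact Set.image_mono h

/-- The points of an orbit in the `r`-th image of its central interval. -/
noncomputable def reached (f : X → X) (β : Fin m → X) (a b : Fin m) (r : ℕ) : Finset (Fin m) :=
  open Classical in Finset.univ.filter fun i => β i ∈ f^[r] '' Set.uIcc (β a) (β b)

theorem mem_reached {r : ℕ} {i : Fin m} :
    i ∈ reached f β a b r ↔ β i ∈ f^[r] '' Set.uIcc (β a) (β b) := by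
  simp [reached]

theorem map_mem_reached (hσ : Function.Semiconj β σ f) {r : ℕ} {i : Fin m}
    (hi : i ∈ reached f β a b r) : σ i ∈ reached f β a b (r + 1) := by
  rw [mem_reached] at hi ⊢
  obtain ⟨x, hx, e⟩ := hi
  exact ⟨x, hx, by rw [Function.iterate_succ_apply', e, hσ.eq]⟩

end Reached

/-! ### Orbits without small odd periods -/

section MinimalOrbits

variable {X : Type*} [ConditionallyCompleteLinearOrder X] [DenselyOrdered X] [TopologicalSpace X]
  [OrderTopology X] {m : ℕ} {f : X → X} {β : Fin m → X} {σ : Fin m → Fin m} {a b : Fin m}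

theorem central_subset_image (hf : Continuous f) (hβ : StrictMono β)
    (hσ : Function.Semiconj β σ f) (hab : a ≤ b) (ha : b ≤ σ a) (hb : σ b ≤ a) :
    Set.uIcc (β a) (β b) ⊆ f '' Set.uIcc (β a) (β b) := by
  refine Set.Subset.trans ?_ (uIcc_image_subset_image hf _ _)
  rw [← hσ.eq, ← hσ.eq]
  refine Set.uIcc_subset_uIcc ?_ ?_ <;> rw [Set.mem_uIcc] <;> right
  · exact ⟨hβ.monotone hb, hβ.monotone (hab.trans ha)⟩
  · exact ⟨hβ.monotone (hb.trans hab), hβ.monotone ha⟩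

theorem reached_mono (hf : Continuous f) (hβ : StrictMono β)
    (hσ : Function.Semiconj β σ f) (hab : a ≤ b) (ha : b ≤ σ a) (hb : σ b ≤ a) {r s : ℕ}
    (hrs : r ≤ s) : reached f β a b r ⊆ reached f β a b s := by
  intro i hi
  rw [mem_reached] at hi ⊢
  exact uIcc_subset_iterate_image (central_subset_image hf hβ hσ hab ha hb) hrs hi

theorem left_mem_reached (hf : Continuous f) (hβ : StrictMono β)
    (hσ : Function.Semiconj β σ f) (hab : a ≤ b) (ha : b ≤ σ a) (hb : σ b ≤ a) (r : ℕ) :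
    a ∈ reached f β a b r :=
  reached_mono hf hβ hσ hab ha hb (Nat.zero_le r) (mem_reached.2 ⟨β a, Set.left_mem_uIcc, rfl⟩)

theorem right_mem_reached (hf : Continuous f) (hβ : StrictMono β)
    (hσ : Function.Semiconj β σ f) (hab : a ≤ b) (ha : b ≤ σ a) (hb : σ b ≤ a) (r : ℕ) :
    b ∈ reached f β a b r :=
  reached_mono hf hβ hσ hab ha hb (Nat.zero_le r) (mem_reached.2 ⟨β b, Set.right_mem_uIcc, rfl⟩)

theorem reached_convex (hf : Continuous f) (hβ : StrictMono β) {r : ℕ} {i j l : Fin m}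
    (hi : i ∈ reached f β a b r) (hl : l ∈ reached f β a b r) (hij : i ≤ j) (hjl : j ≤ l) :
    j ∈ reached f β a b r := by
  rw [mem_reached] at *
  exact (ordConnected_image_uIcc (hf.iterate r) _ _).out hi hl
    ⟨hβ.monotone hij, hβ.monotone hjl⟩

theorem IsPeriodicOrbit.eq_univ (h : IsPeriodicOrbit σ id) {S : Finset (Fin m)} {i : Fin m}
    (hi : i ∈ S) (hS : ∀ j ∈ S, σ j ∈ S) : S = Finset.univ := by
  rw [Finset.eq_univ_iff_forall]
  intro j
  obtain ⟨t, -, ht⟩ := h.exists_iterate_eq i j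
  simp only [id] at ht
  rw [← ht]
  clear ht
  induction t with
  | zero => exact hi
  | succ t ih => rw [Function.iterate_succ_apply']; exact hS _ ih

/-- The reached sets increase. If one stage adds nothing, the set is invariant under the cyclic
permutation and therefore is the whole orbit; otherwise at least one point is gained. -/
theorem le_card_reached (h : IsPeriodicOrbit f β) (hf : Continuous f)
    (hσ : Function.Semiconj β σ f) (hab : b.val = a.val + 1) (ha : b ≤ σ a) (hb : σ b ≤ a) (r : ℕ) :
    min m (r + 2) ≤ (reached f β a b r).card := by
  have hab' : a ≤ b := by rw [Fin.le_def]; omega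
  induction r with
  | zero =>
    have : ({a, b} : Finset (Fin m)).card = 2 := Finset.card_pair (by rw [Ne, Fin.ext_iff]; omega)
    rw [Nat.zero_add]
    refine (min_le_right _ _).trans (this.symm.le.trans (Finset.card_le_card ?_))
    intro i hi
    rw [Finset.mem_insert, Finset.mem_singleton] at hi
    rcases hi with rfl | rfl
    · exact left_mem_reached hf h.2.1 hσ hab' ha hb 0
    · exact right_mem_reached hf h.2.1 hσ hab' ha hb 0
  | succ r ih =>
    have hsub := reached_mono hf h.2.1 hσ hab' ha hb (Nat.le_succ r)
    rcases eq_or_ssubset_of_subset hsub with he | hss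
    · have : reached f β a b r = Finset.univ :=
        (h.perm hσ).eq_univ (left_mem_reached hf h.2.1 hσ hab' ha hb r)
          (fun j hj => he ▸ map_mem_reached hσ hj)
      rw [← Nat.succ_eq_add_one, ← he, this, Finset.card_univ, Fintype.card_fin]
      exact min_le_left _ _
    · have := Finset.card_lt_card hss
      simp only [Nat.succ_eq_add_one] at this
      omega

/-- A reached point that does not change sides yields an odd period. -/
theorem exists_odd_period_of_not_switch (h : IsPeriodicOrbit f β) (hm : 2 ≤ m) (hf : Continuous f)
    (hσ : Function.Semiconj β σ f) (hab : b.val = a.val + 1) (ha : b ≤ σ a) (hb : σ b ≤ a)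
    {r l : ℕ} (hl : Odd l) (hrl : r + 1 ≤ l) {i : Fin m} (hi : i ∈ reached f β a b r)
    (hns : i.val ≤ a ↔ (σ i).val ≤ a) :
    ∃ x, Odd (Function.minimalPeriod f x) ∧ 1 < Function.minimalPeriod f x ∧
      Function.minimalPeriod f x ≤ l := by
  have hab' : a ≤ b := by rw [Fin.le_def]; omega
  have hβ := h.2.1
  have hnfix : ∀ j, f (β j) ≠ β j := fun j hj => by
    have h1 := h.minimalPeriod_eq j
    rw [Function.minimalPeriod_eq_one_iff_isFixedPt.2 hj] at h1
    omega
  have hir := reached_mono hf hβ hσ hab' ha hb (show r ≤ l - 1 by omega) hi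
  -- The interval between `β i` and the central endpoint on its side covers the central interval,
  -- since its endpoints are sent to opposite sides. Conversely it is covered after `l - 1` steps
  -- because `i` is reached. The two intervals meet only in that endpoint, which is not fixed.
  by_cases hia : i.val ≤ a
  · have hsa := hns.1 hia
    refine exists_odd_period hf hl (a := β i) (b := β a) (c := β a) (d := β b)
      (Set.Subset.trans ?_ (uIcc_image_subset_image hf _ _)) ?_ ?_
    · rw [← hσ.eq, ← hσ.eq]
      refine Set.uIcc_subset_uIcc ?_ ?_ <;> rw [Set.mem_uIcc] <;> left
      · exact ⟨hβ.monotone hsa, hβ.monotone (hab'.trans ha)⟩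
      · exact ⟨hβ.monotone (le_trans (Fin.le_def.2 hsa) hab'), hβ.monotone ha⟩
    · exact (ordConnected_image_uIcc (hf.iterate (l - 1)) _ _).uIcc_subset (mem_reached.1 hir)
        (mem_reached.1 (left_mem_reached hf hβ hσ hab' ha hb _))
    · intro x hx hx'
      rw [Set.uIcc_of_le (hβ.monotone (Fin.le_def.2 hia))] at hx
      rw [Set.uIcc_of_le (hβ.monotone hab')] at hx'
      rw [le_antisymm hx.2 hx'.1]
      exact hnfix a
  · have hsa : b ≤ σ i := by rw [Fin.le_def]; have := mt hns.2 hia; omega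
    have hib : b ≤ i := by rw [Fin.le_def]; omega
    refine exists_odd_period hf hl (a := β b) (b := β i) (c := β a) (d := β b)
      (Set.Subset.trans ?_ (uIcc_image_subset_image hf _ _)) ?_ ?_
    · rw [← hσ.eq, ← hσ.eq]
      refine Set.uIcc_subset_uIcc ?_ ?_ <;> rw [Set.mem_uIcc] <;> left
      · exact ⟨hβ.monotone hb, hβ.monotone (hab'.trans hsa)⟩
      · exact ⟨hβ.monotone (hb.trans hab'), hβ.monotone hsa⟩
    · exact (ordConnected_image_uIcc (hf.iterate (l - 1)) _ _).uIcc_subset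
        (mem_reached.1 (right_mem_reached hf hβ hσ hab' ha hb _)) (mem_reached.1 hir)
    · intro x hx hx'
      rw [Set.uIcc_of_le (hβ.monotone hib)] at hx
      rw [Set.uIcc_of_le (hβ.monotone hab')] at hx'
      rw [le_antisymm hx'.2 hx.1]
      exact hnfix b

theorem reached_eq_univ (h : IsPeriodicOrbit f β) (hf : Continuous f)
    (hσ : Function.Semiconj β σ f) (hab : b.val = a.val + 1) (ha : b ≤ σ a) (hb : σ b ≤ a) {r : ℕ}
    (hr : m ≤ r + 2) : reached f β a b r = Finset.univ := by
  have := le_card_reached h hf hσ hab ha hb r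
  rw [min_eq_left hr] at this
  exact Finset.eq_univ_of_card _ (le_antisymm (Finset.card_le_univ _) (by simpa using this))

/-- Without odd periods, the halves of an orbit are interchanged. -/
theorem swapsHalves_of_no_odd_period (h : IsPeriodicOrbit f β) (hm : 2 ≤ m) (hf : Continuous f)
    (hodd : ∀ x, Odd (Function.minimalPeriod f x) → ¬ 1 < Function.minimalPeriod f x) :
    SwapsHalves f β := by
  obtain ⟨σ, hσ⟩ := h.exists_semiconj
  obtain ⟨a, b, hab, ha, hb⟩ := (h.perm hσ).exists_center hm
  have hsw : ∀ i : Fin m, i.val ≤ a ↔ ¬ (σ i).val ≤ a := by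
    intro i
    by_contra hcon
    obtain ⟨x, h1, h2, -⟩ := exists_odd_period_of_not_switch h hm hf hσ hab ha hb (r := 2 * m)
      (l := 2 * m + 1) ⟨m, rfl⟩ le_rfl
      (i := i) (by rw [reached_eq_univ h hf hσ hab ha hb (by omega)]; simp) (by tauto)
    exact hodd x h1 h2
  have hm2 := halves_swapped_of_switch (h.perm hσ).injective a.2 hsw
  refine ⟨⟨a + 1, by omega⟩, fun i => ?_, fun i => ?_⟩
  · have h1 := hsw ⟨i, by omega⟩
    refine ⟨⟨(σ ⟨i, by omega⟩).val - m / 2, by omega⟩, ?_⟩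
    unfold leftHalf rightHalf
    rw [← hσ.eq]
    congr 1
    rw [Fin.ext_iff]
    simp only at h1 ⊢
    omega
  · have h1 := hsw ⟨i + m / 2, by omega⟩
    refine ⟨⟨(σ ⟨i + m / 2, by omega⟩).val, ?_⟩, ?_⟩
    · simp only at h1; omega
    · unfold leftHalf rightHalf
      rw [← hσ.eq]

/-- Minimal orbits of odd length follow the Štefan pattern. -/
theorem stefan_of_minimal_odd {k : ℕ} (hk : 1 < k) (hmk : m = 2 * k + 1) (h : IsPeriodicOrbit f β)
    (hf : Continuous f) (hσ : Function.Semiconj β σ f)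
    (hodd : ∀ x, Odd (Function.minimalPeriod f x) → 1 < Function.minimalPeriod f x →
      m ≤ Function.minimalPeriod f x) :
    ∃ c : Fin m, (∀ t ≤ 2 * k, (σ^[t] c).val = stefanPos k t) ∨
      (∀ t ≤ 2 * k, (σ^[t] c).val = 2 * k - stefanPos k t) := by
  obtain ⟨a, b, hab, ha, hb⟩ := (h.perm hσ).exists_center (by omega)
  have hp := h.perm hσ
  have hβ := h.2.1
  have hab' : a ≤ b := by rw [Fin.le_def]; omega
  have hsw : ∀ r ≤ m - 3, ∀ i ∈ reached f β a b r, (i.val ≤ a ↔ ¬ (σ i).val ≤ a) := by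
    intro r hr i hi
    by_contra hcon
    -- Since `m` is odd, `r ≤ m - 3` leaves room for an odd number from `r + 1` up to `m - 2`.
    obtain ⟨l, hl1, hl2, hl3⟩ : ∃ l, Odd l ∧ r + 1 ≤ l ∧ l < m := by
      rcases Nat.even_or_odd r with ⟨s, hs⟩ | ⟨s, hs⟩
      · exact ⟨r + 1, ⟨s, by omega⟩, le_rfl, by omega⟩
      · exact ⟨r + 2, ⟨s + 1, by omega⟩, by omega, by omega⟩
    obtain ⟨x, h1, h2, h3⟩ := exists_odd_period_of_not_switch h (by omega) hf hσ hab ha hb hl1 hl2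
      hi (by tauto)
    have := hodd x h1 h2
    omega
  -- If all points changed sides, the halves would be interchanged and `m` would be even.
  have hnu : reached f β a b (m - 3) ≠ Finset.univ := by
    intro hu
    have := halves_swapped_of_switch hp.injective a.2
      (fun i => hsw _ le_rfl i (by rw [hu]; exact Finset.mem_univ i))
    omega
  -- Going down from stage `m - 3`, which misses a point, strict growth and the lower bound `r + 2`
  -- leave no freedom: each stage gains exactly one point.
  have hcard : ∀ s ≤ m - 3, (reached f β a b (m - 3 - s)).card = m - 1 - s := by
    intro s
    induction s with
    | zero =>
      intro _
      have h1 := le_card_reached h hf hσ hab ha hb (m - 3)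
      have h2 := Finset.card_lt_card (Finset.ssubset_univ_iff.2 hnu)
      rw [Finset.card_univ, Fintype.card_fin] at h2
      simp only [Nat.sub_zero]
      omega
    | succ s ih =>
      intro hs
      have h1 := ih (by omega)
      have h2 := le_card_reached h hf hσ hab ha hb (m - 3 - (s + 1))
      have hsub := reached_mono hf hβ hσ hab' ha hb (show m - 3 - (s + 1) ≤ m - 3 - s by omega)
      have hss : reached f β a b (m - 3 - (s + 1)) ⊂ reached f β a b (m - 3 - s) := by
        refine (eq_or_ssubset_of_subset hsub).resolve_left fun he => ?_
        have hu : reached f β a b (m - 3 - (s + 1)) = Finset.univ :=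
          hp.eq_univ (left_mem_reached hf hβ hσ hab' ha hb _) (fun j hj => by
            rw [he, show m - 3 - s = m - 3 - (s + 1) + 1 by omega]
            exact map_mem_reached hσ hj)
        rw [← he, hu, Finset.card_univ, Fintype.card_fin] at h1
        omega
      have h3 := Finset.card_lt_card hss
      omega
  have hcard' : ∀ r ≤ m - 3, (reached f β a b r).card = r + 2 := by
    intro r hr
    have := hcard (m - 3 - r) (by omega)
    rw [show m - 3 - (m - 3 - r) = r by omega] at this
    omega
  have hinj : ∀ x : Fin m, Set.InjOn (fun t => σ^[t] x) (Set.Iio m) := by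
    intro x
    have := Function.iterate_injOn_Iio_minimalPeriod (f := σ) (x := x)
    rwa [show Function.minimalPeriod σ x = m from hp.minimalPeriod_eq x] at this
  -- The first stage adds a single point, so one of the two central points is mapped to the other;
  -- the spiral starts there.
  obtain ⟨x, y, hxy, hx⟩ : ∃ x y, ((x = a ∧ y = b) ∨ (x = b ∧ y = a)) ∧ σ x = y := by
    by_cases h1 : σ a = b
    · exact ⟨a, b, Or.inl ⟨rfl, rfl⟩, h1⟩
    by_cases h2 : σ b = a
    · exact ⟨b, a, Or.inr ⟨rfl, rfl⟩, h2⟩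
    exfalso
    have h3 := hcard' 1 (by omega)
    have h4 : ({σ b, a, b, σ a} : Finset (Fin m)) ⊆ reached f β a b 1 := by
      intro i hi
      simp only [Finset.mem_insert, Finset.mem_singleton] at hi
      rcases hi with rfl | rfl | rfl | rfl
      · exact map_mem_reached hσ (right_mem_reached hf hβ hσ hab' ha hb 0)
      · exact left_mem_reached hf hβ hσ hab' ha hb 1
      · exact right_mem_reached hf hβ hσ hab' ha hb 1
      · exact map_mem_reached hσ (left_mem_reached hf hβ hσ hab' ha hb 0)
    have h5 := Finset.card_le_card h4
    rw [Finset.card_insert_of_notMem, Finset.card_insert_of_notMem,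
      Finset.card_insert_of_notMem, Finset.card_singleton] at h5
    · omega
    all_goals
      simp only [Finset.mem_insert, Finset.mem_singleton, Fin.ext_iff, Fin.le_def] at *
      omega
  have hxr : ∀ r ≤ m - 3, reached f β a b r = (Finset.range (r + 2)).image (fun t => σ^[t] x) := by
    intro r
    have hc : ∀ r ≤ m - 3, ((Finset.range (r + 2)).image (fun t => σ^[t] x)).card = r + 2 := by
      intro r hr
      rw [Finset.card_image_of_injOn, Finset.card_range]
      intro s hs t ht e
      simp only [Finset.coe_range, Set.mem_Iio] at hs ht
      exact hinj x (by rw [Set.mem_Iio]; omega) (by rw [Set.mem_Iio]; omega) e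
    induction r with
    | zero =>
      intro hr
      symm
      apply Finset.eq_of_subset_of_card_le
      · intro i hi
        simp only [Finset.mem_image, Finset.mem_range] at hi
        obtain ⟨t, ht, rfl⟩ := hi
        have la := left_mem_reached hf hβ hσ hab' ha hb 0
        have lb := right_mem_reached hf hβ hσ hab' ha hb 0
        have : t = 0 ∨ t = 1 := by omega
        have : σ^[t] x = x ∨ σ^[t] x = y := by
          rcases this with rfl | rfl
          · exact Or.inl rfl
          · exact Or.inr hx
        rcases this with e | e <;> rw [e] <;> rcases hxy with ⟨h1, h2⟩ | ⟨h1, h2⟩ <;>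
          first | (rw [h1]; assumption) | (rw [h2]; assumption)
      · rw [hcard' 0 hr, hc 0 hr]
    | succ r ih =>
      intro hr
      symm
      apply Finset.eq_of_subset_of_card_le
      · intro i hi
        simp only [Finset.mem_image, Finset.mem_range] at hi
        obtain ⟨t, ht, rfl⟩ := hi
        rcases Nat.eq_zero_or_pos t with rfl | ht0
        · rcases hxy with ⟨rfl, -⟩ | ⟨rfl, -⟩
          · exact left_mem_reached hf hβ hσ hab' ha hb _
          · exact right_mem_reached hf hβ hσ hab' ha hb _
        · rw [show t = t - 1 + 1 by omega, Function.iterate_succ_apply']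
          apply map_mem_reached hσ
          rw [ih (by omega), Finset.mem_image]
          exact ⟨t - 1, by rw [Finset.mem_range]; omega, rfl⟩
      · rw [hcard' _ hr, hc _ hr]
  have hswx : ∀ t ≤ m - 2, ((σ^[t] x).val ≤ a ↔ ¬ (σ^[t + 1] x).val ≤ a) := by
    intro t ht
    rw [Function.iterate_succ_apply']
    apply hsw (m - 3) le_rfl
    rw [hxr _ le_rfl, Finset.mem_image]
    exact ⟨t, by rw [Finset.mem_range]; omega, rfl⟩
  -- The iterates number `t` and `t + 2` lie on the same side. The later one is not yet reached at
  -- stage `t`, and reached sets are convex and contain the centre, so it lies farther out.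
  have hout : ∀ t ≤ m - 3, ((σ^[t] x).val ≤ a → (σ^[t + 2] x).val < (σ^[t] x).val) ∧
      (¬ (σ^[t] x).val ≤ a → (σ^[t] x).val < (σ^[t + 2] x).val) := by
    intro t ht
    have s1 := hswx t (by omega)
    have s2 := hswx (t + 1) (by omega)
    have hmem : σ^[t] x ∈ reached f β a b t := by
      rw [hxr _ ht, Finset.mem_image]
      exact ⟨t, by rw [Finset.mem_range]; omega, rfl⟩
    have hnmem : σ^[t + 2] x ∉ reached f β a b t := by
      rw [hxr _ ht, Finset.mem_image]
      rintro ⟨s, hs, e⟩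
      rw [Finset.mem_range] at hs
      have := hinj x (by rw [Set.mem_Iio]; omega) (by rw [Set.mem_Iio]; omega) e
      omega
    constructor
    · intro h1
      by_contra h2
      exact hnmem (reached_convex hf hβ hmem (left_mem_reached hf hβ hσ hab' ha hb t)
        (Fin.le_def.2 (by omega)) (Fin.le_def.2 (by tauto)))
    · intro h1
      by_contra h2
      refine hnmem (reached_convex hf hβ (right_mem_reached hf hβ hσ hab' ha hb t) hmem
        (Fin.le_def.2 ?_) (Fin.le_def.2 (by omega)))
      have : ¬ (σ^[t + 2] x).val ≤ a := by tauto
      omega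
  have hx1 : σ^[1] x = y := hx
  refine ⟨x, ?_⟩
  rcases hxy with ⟨rfl, rfl⟩ | ⟨rfl, rfl⟩
  · left
    have hside : ∀ j, 2 * j ≤ m - 2 → (σ^[2 * j] x).val ≤ x := by
      intro j
      induction j with
      | zero => intro _; simp
      | succ j ih =>
        intro hj
        have s1 := hswx (2 * j) (by omega)
        have s2 := hswx (2 * j + 1) (by omega)
        have := ih (by omega)
        rw [show 2 * (j + 1) = 2 * j + 1 + 1 by ring]
        tauto
    apply eq_stefanPos_of_spiral (s := fun t => (σ^[t] x).val) (a := x) (by omega) rfl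
    · simp only [hx1]; exact hab
    · intro j hj
      exact (hout (2 * j) (by omega)).1 (hside j (by omega))
    · intro j hj
      have s1 := hswx (2 * j) (by omega)
      exact (hout (2 * j + 1) (by omega)).2 (s1.1 (hside j (by omega)))
    · have := (σ^[2 * k - 1] x).2
      omega
  · right
    have hside : ∀ j, 2 * j ≤ m - 2 → ¬ (σ^[2 * j] x).val ≤ y := by
      intro j
      induction j with
      | zero => intro _; simp [hab]
      | succ j ih =>
        intro hj
        have s1 := hswx (2 * j) (by omega)
        have s2 := hswx (2 * j + 1) (by omega)
        have := ih (by omega)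
        rw [show 2 * (j + 1) = 2 * j + 1 + 1 by ring]
        tauto
    -- The spiral starting to the left is read in reflected positions `2k - i`.
    have key := eq_stefanPos_of_spiral (s := fun t => 2 * k - (σ^[t] x).val) (a := 2 * k - x)
      (k := k) (by omega) rfl ?_ ?_ ?_ ?_
    · intro t ht
      have h1 := key t ht
      have h2 := (σ^[t] x).2
      omega
    · simp only [hx1]; have := x.2; omega
    · intro j hj
      have := (hout (2 * j) (by omega)).2 (hside j (by omega))
      have h2 := (σ^[2 * j + 2] x).2
      omega
    · intro j hj
      have s1 := hswx (2 * j) (by omega)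
      have := (hout (2 * j + 1) (by omega)).1 (by have := hside j (by omega); tauto)
      have h2 := (σ^[2 * j + 1] x).2
      rw [show 2 * j + 1 + 2 = 2 * j + 3 by ring] at this
      omega
    · omega

end MinimalOrbits

/-! ### Halves of orbits and periods of the second iterate -/

section Halves

variable {X : Type*} {m : ℕ}

theorem leftHalf_strictMono [LinearOrder X] {β : Fin m → X} (h : StrictMono β) :
    StrictMono (leftHalf β) := fun _ _ hij => h hij

theorem rightHalf_strictMono [LinearOrder X] {β : Fin m → X} (h : StrictMono β) :
    StrictMono (rightHalf β) := fun i j hij => h (by rw [Fin.lt_def] at *; simpa using hij)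

theorem SwapsHalves.mapsTo_left {f : X → X} {β : Fin m → X} (h : SwapsHalves f β) (i : Fin (m / 2)) :
    f^[2] (leftHalf β i) ∈ Set.range (leftHalf β) := by
  obtain ⟨j, hj⟩ := h.2.1 i
  rw [Function.iterate_succ_apply, Function.iterate_one, ← hj]
  exact h.2.2 j

theorem SwapsHalves.mapsTo_right {f : X → X} {β : Fin m → X} (h : SwapsHalves f β) (i : Fin (m / 2)) :
    f^[2] (rightHalf β i) ∈ Set.range (rightHalf β) := by
  obtain ⟨j, hj⟩ := h.2.2 i
  rw [Function.iterate_succ_apply, Function.iterate_one, ← hj]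
  exact h.2.1 j

theorem range_leftHalf_subset {β : Fin m → X} : Set.range (leftHalf β) ⊆ Set.range β := by
  rintro _ ⟨i, rfl⟩; exact ⟨_, rfl⟩

theorem range_rightHalf_subset {β : Fin m → X} : Set.range (rightHalf β) ⊆ Set.range β := by
  rintro _ ⟨i, rfl⟩; exact ⟨_, rfl⟩

theorem minimalPeriod_iterate_two (f : X → X) (x : X) :
    (Even (Function.minimalPeriod f x) ∧
      Function.minimalPeriod f x = 2 * Function.minimalPeriod f^[2] x) ∨
    (Odd (Function.minimalPeriod f x) ∧
      Function.minimalPeriod f x = Function.minimalPeriod f^[2] x) := by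
  rw [Function.minimalPeriod_iterate_eq_div_gcd two_ne_zero]
  rcases Nat.even_or_odd (Function.minimalPeriod f x) with h | h
  · left
    rw [Nat.gcd_eq_right h.two_dvd]
    exact ⟨h, (Nat.mul_div_cancel' h.two_dvd).symm⟩
  · right
    rw [(Nat.coprime_two_right.2 h : Nat.gcd _ _ = 1), Nat.div_one]
    exact ⟨h, rfl⟩

theorem IsMinimalOrbit.two_pow_le [LinearOrder X] {f : X → X} {β : Fin m → X} {n q : ℕ}
    (h : IsMinimalOrbit f β) (hm : m = 2 ^ n * q) (hq : Odd q) (hq1 : 1 < q) {x : X} {a s : ℕ}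
    (hx : Function.minimalPeriod f x = 2 ^ a * s) (hs : Odd s) (hs1 : 1 < s) :
    n < a ∨ (a = n ∧ q ≤ s) := by
  have hpos : 0 < 2 ^ a * s := by positivity
  have h1 := h.2 _ x hpos hx
  rw [hm] at h1
  exact (eq_or_sharkovskiiLT_iff hpos hq hq1).1 h1 a s rfl hs hs1

theorem isStefanOrbit_of_iterate [LinearOrder X] {k : ℕ} {f : X → X} {β : Fin m → X}
    {σ : Fin m → Fin m} {c : Fin m} (hmk : m = 2 * k + 1) (hσ : Function.Semiconj β σ f)
    (hc : σ^[m] c = c)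
    (h : (∀ t ≤ 2 * k, (σ^[t] c).val = stefanPos k t) ∨
      (∀ t ≤ 2 * k, (σ^[t] c).val = 2 * k - stefanPos k t)) : IsStefanOrbit f β := by
  refine ⟨k, hmk, ?_⟩
  subst hmk
  have key : ∀ (t : ℕ) (x y : Fin (2 * k + 1)), σ^[t] c = x → σ^[t + 1] c = y → f (β x) = β y := by
    rintro t x y rfl rfl
    rw [Function.iterate_succ_apply', ← hσ.eq]
  rcases h with h | h
  · left
    refine ⟨key (2 * k) _ _ ?_ ?_, fun j hj => key (2 * j) _ _ ?_ ?_,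
      fun j hj => key (2 * j + 1) _ _ ?_ ?_⟩
    · rw [Fin.ext_iff, h _ le_rfl]; simp [stefanPos]
    · rw [hc, Fin.ext_iff]; have := h 0 (Nat.zero_le _); simpa [stefanPos] using this
    · rw [Fin.ext_iff, h _ (by omega)]; simp [stefanPos]
    · rw [Fin.ext_iff, h _ (by omega)]; simp [stefanPos, Nat.add_mod]; omega
    · rw [Fin.ext_iff, h _ (by omega)]; simp [stefanPos, Nat.add_mod]; omega
    · rw [Fin.ext_iff, h _ (by omega)]; simp [stefanPos, Nat.add_mod]; omega
  · right
    refine ⟨key (2 * k) _ _ ?_ ?_, fun j hj => key (2 * j) _ _ ?_ ?_,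
      fun j hj => key (2 * j + 1) _ _ ?_ ?_⟩
    · rw [Fin.ext_iff, h _ le_rfl]; simp [stefanPos]
    · rw [hc, Fin.ext_iff]; have := h 0 (Nat.zero_le _); simp [stefanPos] at this; simp; omega
    · rw [Fin.ext_iff, h _ (by omega)]; simp [stefanPos]; omega
    · rw [Fin.ext_iff, h _ (by omega)]; simp [stefanPos, Nat.add_mod]; omega
    · rw [Fin.ext_iff, h _ (by omega)]; simp [stefanPos, Nat.add_mod]; omega
    · rw [Fin.ext_iff, h _ (by omega)]; simp [stefanPos, Nat.add_mod]; omega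

end Halves

section Halving

variable {X : Type*} [LinearOrder X] {m n q : ℕ} {f : X → X} {β : Fin m → X}

/-- A point of period `2^a * s` under `f²` has period `2^(a+1) * s` under `f`, or the same odd
period. In both cases the restriction for `f` at exponent `n + 1` gives that for `f²` at exponent
`n`. -/
theorem IsMinimalOrbit.half (h : IsMinimalOrbit f β) (hm : m = 2 ^ (n + 1) * q) (hq : Odd q)
    (hq1 : 1 < q) {γ : Fin (m / 2) → X} (hγ : StrictMono γ) (hr : Set.range γ ⊆ Set.range β)
    (hmap : ∀ i, f^[2] (γ i) ∈ Set.range γ) : IsMinimalOrbit f^[2] γ := by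
  have hm2 : m / 2 = 2 ^ n * q := by
    rw [hm, pow_succ, mul_right_comm, Nat.mul_div_cancel _ two_pos]
  have hmm : m = 2 * (m / 2) := by rw [hm2, hm, pow_succ]; ring
  have hpos : 0 < m / 2 := by rw [hm2]; positivity
  constructor
  · refine isPeriodicOrbit_of_mem_range hpos hγ hmap ⟨0, hpos⟩ ?_
    obtain ⟨i, hi⟩ := hr (Set.mem_range_self (⟨0, hpos⟩ : Fin (m / 2)))
    have hp : Function.minimalPeriod f (γ ⟨0, hpos⟩) = m := by rw [← hi]; exact h.1.minimalPeriod_eq i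
    rcases minimalPeriod_iterate_two f (γ ⟨0, hpos⟩) with ⟨-, h1⟩ | ⟨h1, -⟩
    · omega
    · rw [hp, hmm] at h1
      exact absurd (even_two_mul _) (Nat.not_even_iff_odd.2 h1)
  · intro p x hp hx
    rw [hm2, eq_or_sharkovskiiLT_iff hp hq hq1]
    rintro a s rfl hs hs1
    rcases minimalPeriod_iterate_two f x with ⟨-, h1⟩ | ⟨-, h1⟩
    · rw [hx, ← mul_assoc, ← pow_succ'] at h1
      have := h.two_pow_le hm hq hq1 h1 hs hs1
      omega
    · rw [hx] at h1
      have := h.two_pow_le hm hq hq1 h1 hs hs1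
      omega

end Halving

/-! ### Minimal orbits are simple -/

section Descent

variable {X : Type*} [ConditionallyCompleteLinearOrder X] [DenselyOrdered X] [TopologicalSpace X]
  [OrderTopology X] {m n q k : ℕ} {f : X → X} {β : Fin m → X}

theorem IsMinimalOrbit.swapsHalves (h : IsMinimalOrbit f β) (hf : Continuous f)
    (hm : m = 2 ^ (n + 1) * q) (hq : Odd q) (hq1 : 1 < q) : SwapsHalves f β := by
  refine swapsHalves_of_no_odd_period h.1 ?_ hf fun x hx hx1 => ?_
  · rw [hm, pow_succ]; nlinarith [Nat.one_le_two_pow (n := n)]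
  · have := h.two_pow_le hm hq hq1 (x := x) (a := 0) (by rw [pow_zero, one_mul]) hx hx1
    omega

theorem IsMinimalOrbit.leftHalf (h : IsMinimalOrbit f β) (hf : Continuous f)
    (hm : m = 2 ^ (n + 1) * q) (hq : Odd q) (hq1 : 1 < q) : IsMinimalOrbit f^[2] (leftHalf β) :=
  h.half hm hq hq1 (leftHalf_strictMono h.1.2.1) range_leftHalf_subset
    (h.swapsHalves hf hm hq hq1).mapsTo_left

theorem IsMinimalOrbit.rightHalf (h : IsMinimalOrbit f β) (hf : Continuous f)
    (hm : m = 2 ^ (n + 1) * q) (hq : Odd q) (hq1 : 1 < q) : IsMinimalOrbit f^[2] (rightHalf β) :=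
  h.half hm hq hq1 (rightHalf_strictMono h.1.2.1) range_rightHalf_subset
    (h.swapsHalves hf hm hq hq1).mapsTo_right

/-- The `2^n`-th iterate has no small odd periods. -/
theorem IsMinimalOrbit.le_of_odd_period (h : IsMinimalOrbit f β) (hf : Continuous f)
    (hm : m = 2 ^ n * q) (hq : Odd q) (hq1 : 1 < q) (x : X)
    (hx : Odd (Function.minimalPeriod f^[2 ^ n] x))
    (hx1 : 1 < Function.minimalPeriod f^[2 ^ n] x) : q ≤ Function.minimalPeriod f^[2 ^ n] x := by
  induction n generalizing m f with
  | zero =>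
    rw [pow_zero, Function.iterate_one] at *
    have := h.two_pow_le (n := 0) (by rw [hm, pow_zero]) hq hq1 (x := x) (a := 0)
      (by rw [pow_zero, one_mul]) hx hx1
    omega
  | succ n ih =>
    rw [pow_succ', Function.iterate_mul] at *
    -- The claim concerns all periodic points of the iterate, so one half suffices for the descent.
    exact ih (h.leftHalf hf (by rw [hm, pow_succ']) hq hq1) (hf.iterate 2)
      (by rw [hm, mul_assoc, Nat.mul_div_cancel_left _ two_pos]) hx hx1

theorem IsMinimalOrbit.isSimpleOrbit (h : IsMinimalOrbit f β) (hf : Continuous f) (hk : 1 < k)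
    (hm : m = 2 ^ n * (2 * k + 1)) : IsSimpleOrbit n f β := by
  have hq : Odd (2 * k + 1) := ⟨k, rfl⟩
  induction n generalizing m f with
  | zero =>
    rw [pow_zero, one_mul] at hm
    obtain ⟨σ, hσ⟩ := h.1.exists_semiconj
    obtain ⟨c, hc⟩ := stefan_of_minimal_odd hk hm h.1 hf hσ fun x hx hx1 => by
      have := h.le_of_odd_period hf (n := 0) (by rw [hm, pow_zero, one_mul]) hq (by omega) x
        (by simpa using hx) (by simpa using hx1)
      rw [pow_zero, Function.iterate_one] at this
      omega
    exact isStefanOrbit_of_iterate hm hσ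
      (((h.1.perm hσ).iterate_eq_self_iff c m).2 dvd_rfl) hc
  | succ n ih =>
    have hm2 : m / 2 = 2 ^ n * (2 * k + 1) := by
      rw [hm, pow_succ', mul_assoc, Nat.mul_div_cancel_left _ two_pos]
    exact ⟨h.swapsHalves hf hm hq (by omega),
      ih (h.leftHalf hf hm hq (by omega)) (hf.iterate 2) hm2,
      ih (h.rightHalf hf hm hq (by omega)) (hf.iterate 2) hm2⟩

end Descent

/-! ### Simple orbits as families of Štefan blocks -/

section Simple

theorem swapsHalves_comp_iff {X Y : Type*} {m : ℕ} {f : X → X} {g : Y → Y}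
    {β : Fin m → X} {φ : X → Y} (hφ : Function.Injective φ) (hs : Function.Semiconj φ f g) :
    SwapsHalves g (φ ∘ β) ↔ SwapsHalves f β := by
  have e1 : leftHalf (φ ∘ β) = φ ∘ leftHalf β := rfl
  have e2 : rightHalf (φ ∘ β) = φ ∘ rightHalf β := rfl
  have e3 : ∀ x, g (φ x) = φ (f x) := fun x => (hs.eq x).symm
  simp only [SwapsHalves, e1, e2, Function.comp_apply, e3, Set.range_comp,
    hφ.mem_set_image]

theorem isSimpleOrbit_comp_iff {X Y : Type*} [LinearOrder X] [LinearOrder Y] {n m : ℕ}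
    {f : X → X} {g : Y → Y} {β : Fin m → X} {φ : X → Y} (hφ : Function.Injective φ)
    (hs : Function.Semiconj φ f g) : IsSimpleOrbit n g (φ ∘ β) ↔ IsSimpleOrbit n f β := by
  induction n generalizing m f g with
  | zero =>
    have e3 : ∀ x, g (φ x) = φ (f x) := fun x => (hs.eq x).symm
    simp only [IsSimpleOrbit, IsStefanOrbit, Function.comp_apply, e3, hφ.eq_iff]
  | succ n ih =>
    have e1 : leftHalf (φ ∘ β) = φ ∘ leftHalf β := rfl
    have e2 : rightHalf (φ ∘ β) = φ ∘ rightHalf β := rfl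
    simp only [IsSimpleOrbit, e1, e2, ih (hs.iterate_right 2), swapsHalves_comp_iff hφ hs]

/-- The points number `o, …, o + 2k` are a Štefan orbit of the `N`-th iterate. -/
def StefanAt {X : Type*} {m : ℕ} (k N o : ℕ) (f : X → X) (β : Fin m → X) : Prop :=
  ∃ h : o + 2 * k < m, f^[N * (2 * k + 1)] (β ⟨o + k, by omega⟩) = β ⟨o + k, by omega⟩ ∧
    ((∀ (t : ℕ) (ht : t ≤ 2 * k), f^[N * t] (β ⟨o + k, by omega⟩) =
        β ⟨o + stefanPos k t, by have := stefanPos_le ht; omega⟩) ∨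
      (∀ (t : ℕ) (_ : t ≤ 2 * k), f^[N * t] (β ⟨o + k, by omega⟩) =
        β ⟨o + (2 * k - stefanPos k t), by omega⟩))

theorem stefanPos_succ {k t : ℕ} (h : t < 2 * k) :
    (∃ j < k, t = 2 * j ∧ stefanPos k t = k - j ∧ stefanPos k (t + 1) = k + (j + 1)) ∨
    (∃ j < k, t = 2 * j + 1 ∧ stefanPos k t = k + (j + 1) ∧ stefanPos k (t + 1) = k - (j + 1)) := by
  unfold stefanPos
  rcases Nat.even_or_odd' t with ⟨j, rfl | rfl⟩
  · exact Or.inl ⟨j, by omega, rfl, by simp, by rw [if_neg (by omega)]; omega⟩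
  · exact Or.inr ⟨j, by omega, rfl, by rw [if_neg (by omega)]; omega,
      by rw [if_pos (by omega)]; omega⟩

theorem IsStefanOrbit.stefanAt {X : Type*} {m k : ℕ} {f : X → X} {β : Fin m → X}
    (h : IsStefanOrbit f β) (hm : m = 2 * k + 1) : StefanAt k 1 0 f β := by
  obtain ⟨k', hk', h⟩ := h
  obtain rfl : k = k' := by omega
  subst hm
  refine ⟨by omega, ?_⟩
  simp only [one_mul, Nat.zero_add]
  rcases h with ⟨h0, h1, h2⟩ | ⟨h0, h1, h2⟩
  · have key : ∀ (t : ℕ) (ht : t ≤ 2 * k), f^[t] (β ⟨k, by omega⟩) =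
        β ⟨stefanPos k t, by have := stefanPos_le ht; omega⟩ := by
      intro t
      induction t with
      | zero => intro _; simp [stefanPos]
      | succ t ih =>
        intro ht
        rw [Function.iterate_succ_apply', ih (by omega)]
        rcases stefanPos_succ (k := k) (t := t) (by omega) with ⟨j, hj, rfl, e1, e2⟩ | ⟨j, hj, rfl, e1, e2⟩
        · simp only [e1, e2]; exact h1 j hj
        · simp only [e1, e2]; exact h2 j hj
    refine ⟨?_, Or.inl key⟩
    rw [Function.iterate_succ_apply', key _ le_rfl, ← h0]
    simp [stefanPos]
  · have key : ∀ (t : ℕ) (ht : t ≤ 2 * k), f^[t] (β ⟨k, by omega⟩) =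
        β ⟨2 * k - stefanPos k t, by omega⟩ := by
      intro t
      induction t with
      | zero => intro _; simp [stefanPos, two_mul]
      | succ t ih =>
        intro ht
        rw [Function.iterate_succ_apply', ih (by omega)]
        rcases stefanPos_succ (k := k) (t := t) (by omega) with ⟨j, hj, rfl, e1, e2⟩ | ⟨j, hj, rfl, e1, e2⟩
        · have := h1 j hj
          simp only [e1, e2]
          convert this using 3 <;> (try simp) <;> omega
        · have := h2 j hj
          simp only [e1, e2]
          convert this using 3 <;> (try simp) <;> omega
    refine ⟨?_, Or.inr key⟩
    rw [Function.iterate_succ_apply', key _ le_rfl, ← h0]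
    simp [stefanPos]

/-- A half is the orbit read from offset `e` on, and `N` steps of `f²` are `2 * N` steps of `f`. -/
theorem StefanAt.of_half {X : Type*} {m w k N o e : ℕ} {f : X → X} {β : Fin m → X}
    {γ : Fin w → X} (h : StefanAt k N o f^[2] γ)
    (hγ : ∀ i : Fin w, ∃ h : e + i.val < m, γ i = β ⟨e + i, h⟩) :
    StefanAt k (2 * N) (e + o) f β := by
  obtain ⟨h0, h1, h2⟩ := h
  have hw : e + o + 2 * k < m := by
    obtain ⟨h, -⟩ := hγ ⟨o + 2 * k, h0⟩
    simp only at h; omega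
  have hγ' : ∀ (i : ℕ) (hi : o + i < w) (hi' : e + o + i < m),
      γ ⟨o + i, hi⟩ = β ⟨e + o + i, hi'⟩ := by
    intro i hi hi'
    obtain ⟨h, e⟩ := hγ ⟨o + i, hi⟩
    rw [e]; congr 1; rw [Fin.ext_iff]; simp only; omega
  refine ⟨hw, ?_, ?_⟩
  · rw [mul_assoc, Function.iterate_mul, ← hγ' k (by omega), h1]
  · refine h2.imp (fun h2 t ht => ?_) (fun h2 t ht => ?_)
    · have := stefanPos_le ht
      rw [mul_assoc, Function.iterate_mul, ← hγ' k (by omega), h2 t ht, hγ' _ (by omega)]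
    · rw [mul_assoc, Function.iterate_mul, ← hγ' k (by omega), h2 t ht, hγ' _ (by omega)]

theorem IsSimpleOrbit.stefanAt {X : Type*} [LinearOrder X] {m n k : ℕ} {f : X → X} {β : Fin m → X}
    (h : IsSimpleOrbit n f β) (hm : m = 2 ^ n * (2 * k + 1)) {j : ℕ} (hj : j < 2 ^ n) :
    StefanAt k (2 ^ n) (j * (2 * k + 1)) f β := by
  induction n generalizing m f j with
  | zero =>
    obtain rfl : j = 0 := by simpa using hj
    rw [pow_zero, zero_mul]
    exact IsStefanOrbit.stefanAt h (by rw [hm, pow_zero, one_mul])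
  | succ n ih =>
    have hm2 : m / 2 = 2 ^ n * (2 * k + 1) := by
      rw [hm, pow_succ', mul_assoc, Nat.mul_div_cancel_left _ two_pos]
    rw [pow_succ']
    obtain ⟨-, h1, h2⟩ := h
    by_cases hjn : j < 2 ^ n
    · rw [← Nat.zero_add (j * (2 * k + 1))]
      exact (ih h1 hm2 hjn).of_half fun i => ⟨by omega, by simp only [Nat.zero_add]; rfl⟩
    · rw [show j * (2 * k + 1) = m / 2 + (j - 2 ^ n) * (2 * k + 1) by
        rw [hm2, ← add_mul]; congr 1; omega]
      refine (ih h2 hm2 (j := j - 2 ^ n) (by rw [pow_succ] at hj; omega)).of_half fun i =>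
        ⟨by omega, ?_⟩
      simp only [rightHalf, Nat.add_comm]

end Simple

/-! ### Shifts between Štefan blocks -/

section Splitting

variable {X : Type*} [ConditionallyCompleteLinearOrder X] [DenselyOrdered X] [TopologicalSpace X]
  [OrderTopology X]

/-- If a Štefan orbit `p` of `F = h ∘ g` is carried by `g` to a shifted Štefan orbit `p'`, where the
shift is neither `0` nor `1`, then `F` has a smaller odd period. -/
theorem exists_odd_period_of_shift {k : ℕ} (hk : 1 < k) {g h F : X → X} (hg : Continuous g)
    (hh : Continuous h) (hgh : ∀ x, h (g x) = F x) (hhg : ∀ x, g (h x) = F x) {c c' : X}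
    (hc : F^[2 * k + 1] c = c) (hc' : F^[2 * k + 1] c' = c')
    (hbet : ∀ t, t + 2 ≤ 2 * k → F^[t] c ∈ Set.uIcc (F^[t + 1] c) (F^[t + 2] c))
    (hbet' : c' ∈ Set.uIcc (F^[2 * k] c') (F c')) (hfix : ∀ t, F (F^[t] c) ≠ F^[t] c)
    {j : ℕ} (hj : 2 ≤ j) (hjk : j ≤ 2 * k) (hgc : g c = F^[j] c') :
    ∃ x, Odd (Function.minimalPeriod F x) ∧ 1 < Function.minimalPeriod F x ∧
      Function.minimalPeriod F x ≤ 2 * k - 1 := by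
  have hF : Continuous F := by
    have : F = h ∘ g := funext fun x => (hgh x).symm
    exact this ▸ hh.comp hg
  have hgF : ∀ t x, g (F^[t] x) = F^[t] (g x) := fun t x =>
    (Function.Semiconj.iterate_right (f := g) (fun x => by rw [← hgh, hhg]) t).eq x
  have hhF : ∀ t x, h (F^[t] x) = F^[t] (h x) := fun t x =>
    (Function.Semiconj.iterate_right (f := h) (fun x => by rw [← hhg, hgh]) t).eq x
  have hper : ∀ t, F^[t + (2 * k + 1)] c = F^[t] c := fun t => by
    rw [Function.iterate_add_apply, hc]
  have hper' : ∀ t, F^[t + (2 * k + 1)] c' = F^[t] c' := fun t => by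
    rw [Function.iterate_add_apply, hc']
  obtain ⟨i, hij⟩ : ∃ i, i + j = 2 * k := ⟨2 * k - j, by omega⟩
  have hg' : ∀ t, g (F^[t] c) = F^[t + j] c' := fun t => by
    rw [hgF, hgc, Function.iterate_add_apply]
  -- The shifts of `g` and `h` add up to `1` modulo `2k+1`, because `h ∘ g = F`; as `g` shifts by `j
  -- = 2k - i`, `h` shifts by `i + 2`.
  have hhc' : h c' = F^[i + 2] c := by
    have e1 : h (g c) = F c := hgh c
    rw [hgc] at e1
    have e2 := hhF (i + 1) (F^[j] c')
    rw [e1, ← Function.iterate_add_apply, show i + 1 + j = 0 + (2 * k + 1) by omega, hper'] at e2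
    exact e2
  have hh' : ∀ t, h (F^[t] c') = F^[t + (i + 2)] c := fun t => by
    rw [hhF, hhc', ← Function.iterate_add_apply]
  have hstep : ∀ t t', Set.uIcc (F^[t + 1] c) (F^[t' + 1] c) ⊆ F '' Set.uIcc (F^[t] c) (F^[t'] c) := by
    intro t t'
    rw [Function.iterate_succ_apply', Function.iterate_succ_apply']
    exact uIcc_image_subset_image hF _ _
  have hnest : ∀ t, t + 2 ≤ 2 * k →
      Set.uIcc (F^[t] c) (F^[t + 1] c) ⊆ Set.uIcc (F^[t + 1] c) (F^[t + 2] c) := fun t ht =>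
    Set.uIcc_subset_uIcc (hbet t ht) Set.left_mem_uIcc
  have hcentral : ∀ t, t + 1 ≤ 2 * k →
      Set.uIcc (F^[0] c) (F^[1] c) ⊆ Set.uIcc (F^[t] c) (F^[t + 1] c) := by
    intro t
    induction t with
    | zero => intro _; exact subset_rfl
    | succ t ih => intro ht; exact (ih (by omega)).trans (hnest t (by omega))
  -- Let `K` be the hull of `F^[i] c` and `F^[i + 2] c`. Its endpoints go to points on either side
  -- of `c'`, so `g '' K` contains `c'` as well. Applying `h`, the image `F '' K` contains not only
  -- `F^[i + 1] c` and `F^[i + 3] c`, the images of the endpoints, but also `F^[i + 2] c`.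
  have hgK : Set.uIcc (F^[2 * k] c') (F c') ⊆ g '' Set.uIcc (F^[i] c) (F^[i + 2] c) := by
    have e1 : g (F^[i] c) = F^[2 * k] c' := by rw [hg', hij]
    have e2 : g (F^[i + 2] c) = F c' := by
      rw [hg', show i + 2 + j = 1 + (2 * k + 1) by omega, hper', Function.iterate_one]
    rw [← e1, ← e2]
    exact uIcc_image_subset_image hg _ _
  have hFK : ∀ x ∈ Set.uIcc (F^[2 * k] c') (F c'), ∀ y ∈ Set.uIcc (F^[2 * k] c') (F c'),
      Set.uIcc (h x) (h y) ⊆ F '' Set.uIcc (F^[i] c) (F^[i + 2] c) := by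
    intro x hx y hy
    have e : F '' Set.uIcc (F^[i] c) (F^[i + 2] c) = h '' (g '' Set.uIcc (F^[i] c) (F^[i + 2] c)) := by
      rw [← Set.image_comp]; congr 1; exact funext fun x => (hgh x).symm
    rw [e]
    refine (uIcc_image_subset_image hh x y).trans (Set.image_mono ?_)
    exact (Set.ordConnected_uIcc.uIcc_subset hx hy).trans hgK
  -- For `i + 2 < 2k`, `K` covers the hull of `F^[i + 2] c` and `F^[i + 3] c`, hence the central
  -- interval. The latter covers `K` after `i + 1` steps, and later as well because it covers
  -- itself. So the loop can be given an odd length at most `2k - 1`.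
  rcases Nat.lt_or_ge (i + 2) (2 * k) with hi | hi
  · obtain ⟨l, hl, hl1, hl2⟩ : ∃ l, Odd l ∧ i + 2 ≤ l ∧ l ≤ 2 * k - 1 := by
      rcases Nat.even_or_odd i with ⟨s, hs⟩ | ⟨s, hs⟩
      · exact ⟨i + 3, ⟨s + 1, by omega⟩, by omega, by omega⟩
      · exact ⟨i + 2, ⟨s + 1, by omega⟩, by omega, by omega⟩
    have hJJ : Set.uIcc (F^[0] c) (F^[1] c) ⊆ F '' Set.uIcc (F^[0] c) (F^[1] c) :=
      (hcentral 1 (by omega)).trans (hstep 0 1)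
    have hcov : ∀ t, Set.uIcc (F^[t] c) (F^[t + 1] c) ⊆ F^[t] '' Set.uIcc (F^[0] c) (F^[1] c) := by
      intro t
      rw [Function.iterate_add_apply]
      exact uIcc_image_subset_image (hF.iterate t) _ _
    suffices hs : ∃ x, Odd (Function.minimalPeriod F x) ∧ 1 < Function.minimalPeriod F x ∧
        Function.minimalPeriod F x ≤ l by
      obtain ⟨x, h1, h2, h3⟩ := hs
      exact ⟨x, h1, h2, h3.trans hl2⟩
    refine exists_odd_period hF hl (a := F^[i] c) (b := F^[i + 2] c)
      (c := F^[0] c) (d := F^[1] c) ?_ ?_ ?_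
    · refine (hcentral (i + 2) (by omega)).trans ?_
      have e1 : h c' = F^[i + 2] c := hhc'
      have e2 : h (F c') = F^[i + 2 + 1] c := by
        have := hh' 1
        rwa [Function.iterate_one, show 1 + (i + 2) = i + 2 + 1 by omega] at this
      have h3 := hFK _ hbet' _ Set.right_mem_uIcc
      rwa [e1, e2] at h3
    · refine Set.Subset.trans ?_ (uIcc_subset_iterate_image hJJ (show i + 1 ≤ l - 1 by omega))
      refine Set.Subset.trans ?_ (hcov (i + 1))
      exact Set.uIcc_subset_uIcc (hbet i (by omega)) Set.right_mem_uIcc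
    · intro x hx hx'
      have h1 := hcentral i (by omega) hx'
      have h2 := hbet i (by omega)
      have : x = F^[i] c := by
        rw [Set.mem_uIcc] at hx h1 h2
        grind
      rw [this]
      exact hfix i
  -- In the extreme case `j = 2` the same argument shows that `K` covers the hull of `F^[2k - 1] c`
  -- and `F^[2k] c`, which contains all intervals needed below.
  · have hik : i + 2 = 2 * k := by omega
    obtain ⟨s, rfl⟩ : ∃ s, i = s + 2 := ⟨i - 2, by omega⟩
    have hall : Set.uIcc (F^[s + 3] c) (F^[s + 4] c) ⊆
        F '' Set.uIcc (F^[s + 2] c) (F^[s + 4] c) := by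
      have e1 : h c' = F^[s + 4] c := by rw [hhc']
      have e2 : h (F^[2 * k] c') = F^[s + 3] c := by
        rw [hh', show 2 * k + (s + 2 + 2) = s + 3 + (2 * k + 1) by omega, hper]
      rw [← e2]
      have := hFK _ Set.left_mem_uIcc _ hbet'
      rwa [e1] at this
    have b0 := hbet s (by omega)
    have b1 := hbet (s + 1) (by omega)
    have b2 := hbet (s + 2) (by omega)
    simp only [Nat.add_assoc, Nat.reduceAdd] at b0 b1 b2
    have hKK : Set.uIcc (F^[s + 2] c) (F^[s + 4] c) ⊆ F '' Set.uIcc (F^[s + 2] c) (F^[s + 4] c) :=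
      (Set.uIcc_subset_uIcc b2 Set.right_mem_uIcc).trans hall
    have hM : Set.uIcc (F^[s + 1] c) (F^[s + 3] c) ⊆ Set.uIcc (F^[s + 3] c) (F^[s + 4] c) := by
      refine Set.uIcc_subset_uIcc ?_ Set.left_mem_uIcc
      exact Set.uIcc_subset_uIcc b2 Set.left_mem_uIcc b1
    suffices hs : ∃ x, Odd (Function.minimalPeriod F x) ∧ 1 < Function.minimalPeriod F x ∧
        Function.minimalPeriod F x ≤ 3 by
      obtain ⟨x, h1, h2, h3⟩ := hs
      exact ⟨x, h1, h2, by omega⟩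
    -- The loop passes from the hull of `F^[s + 1] c` and `F^[s + 3] c` to `K`, stays in `K` once,
    -- and returns. Its period `3` is small enough since `k > 1`.
    refine exists_odd_period hF (l := 3) ⟨1, rfl⟩
      (a := F^[s + 1] c) (b := F^[s + 3] c) (c := F^[s + 2] c) (d := F^[s + 4] c) ?_ ?_ ?_
    · exact hstep (s + 1) (s + 3)
    · refine (hM.trans hall).trans ?_
      have := uIcc_subset_iterate_image hKK (show 1 ≤ 2 by omega)
      rwa [Function.iterate_one] at this
    · intro x hx hx'
      have : x = F^[s + 2] c := by
        rw [Set.mem_uIcc] at hx hx' b0 b1 b2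
        grind
      rw [this]
      exact hfix _

end Splitting

/-! ### Order within a Štefan block -/

theorem stefanPos_between {k t : ℕ} (ht : t + 2 ≤ 2 * k) :
    (stefanPos k (t + 1) ≤ stefanPos k t ∧ stefanPos k t ≤ stefanPos k (t + 2)) ∨
    (stefanPos k (t + 2) ≤ stefanPos k t ∧ stefanPos k t ≤ stefanPos k (t + 1)) := by
  unfold stefanPos
  split_ifs <;> omega

theorem exists_stefanPos_eq {k r : ℕ} (hr : r ≤ 2 * k) : ∃ t ≤ 2 * k, stefanPos k t = r := by
  rcases Nat.lt_or_ge k r with h | h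
  · exact ⟨2 * (r - k) - 1, by omega, by unfold stefanPos; split_ifs <;> omega⟩
  · exact ⟨2 * (k - r), by omega, by unfold stefanPos; split_ifs <;> omega⟩

section StefanAt

variable {X : Type*} {m k N o : ℕ} {f : X → X} {β : Fin m → X}

theorem StefanAt.between [LinearOrder X] (h : StefanAt k N o f β) (hβ : StrictMono β) (ho : o + k < m) {t : ℕ}
    (ht : t + 2 ≤ 2 * k) : f^[N * t] (β ⟨o + k, ho⟩) ∈
      Set.uIcc (f^[N * (t + 1)] (β ⟨o + k, ho⟩)) (f^[N * (t + 2)] (β ⟨o + k, ho⟩)) := by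
  obtain ⟨h0, -, h1 | h1⟩ := h
  · rw [h1 t (by omega), h1 (t + 1) (by omega), h1 (t + 2) (by omega), Set.mem_uIcc]
    simp only [hβ.le_iff_le, Fin.mk_le_mk]
    have := stefanPos_between ht
    omega
  · rw [h1 t (by omega), h1 (t + 1) (by omega), h1 (t + 2) (by omega), Set.mem_uIcc]
    simp only [hβ.le_iff_le, Fin.mk_le_mk]
    have := stefanPos_between ht
    omega

theorem StefanAt.center_between [LinearOrder X] (h : StefanAt k N o f β) (hβ : StrictMono β) (hk : 0 < k)
    (ho : o + k < m) : β ⟨o + k, ho⟩ ∈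
      Set.uIcc (f^[N * (2 * k)] (β ⟨o + k, ho⟩)) (f^[N] (β ⟨o + k, ho⟩)) := by
  obtain ⟨h0, -, h1 | h1⟩ := h
  · have e := h1 1 (by omega)
    rw [mul_one] at e
    rw [h1 (2 * k) (by omega), e, Set.mem_uIcc]
    simp [hβ.le_iff_le, Fin.mk_le_mk, stefanPos]
  · have e := h1 1 (by omega)
    rw [mul_one] at e
    rw [h1 (2 * k) (by omega), e, Set.mem_uIcc]
    simp [hβ.le_iff_le, Fin.mk_le_mk, stefanPos]
    omega

theorem StefanAt.exists_iterate (h : StefanAt k N o f β) (ho : o + k < m) {r : ℕ} (hr : r ≤ 2 * k)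
    (hor : o + r < m) : ∃ t ≤ 2 * k, β ⟨o + r, hor⟩ = f^[N * t] (β ⟨o + k, ho⟩) := by
  obtain ⟨h0, -, h1 | h1⟩ := h
  · obtain ⟨t, ht, e⟩ := exists_stefanPos_eq hr
    exact ⟨t, ht, by rw [h1 t ht]; simp only [e]⟩
  · obtain ⟨t, ht, e⟩ := exists_stefanPos_eq (show 2 * k - r ≤ 2 * k by omega)
    refine ⟨t, ht, ?_⟩
    rw [h1 t ht]
    congr 1
    rw [Fin.ext_iff]; simp only; omega

end StefanAt

/-! ### Centered simple permutations and their blocks -/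

/-- Simple cyclic permutations of `2^n (2k+1)` points that map the middle points of all but one of
the `2^n` blocks to middle points. -/
structure IsCenteredSimple (k n : ℕ) {m : ℕ} (σ : Fin m → Fin m) : Prop where
  length : m = 2 ^ n * (2 * k + 1)
  periodic : IsPeriodicOrbit σ id
  simple : IsSimpleOrbit n σ id
  special : ∃ c : Fin m, c.val % (2 * k + 1) = k ∧ (σ c).val % (2 * k + 1) ≠ k ∧
    ∀ z : Fin m, z.val % (2 * k + 1) = k → z ≠ c → (σ z).val % (2 * k + 1) = k

section Blocks

variable {m n k : ℕ} {σ : Fin m → Fin m}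

theorem eq_of_block_eq {z z' : Fin m} (h : z.val % (2 * k + 1) = k) (h' : z'.val % (2 * k + 1) = k)
    (e : z.val / (2 * k + 1) = z'.val / (2 * k + 1)) : z = z' := by
  rw [Fin.ext_iff, ← Nat.div_add_mod z.val (2 * k + 1), ← Nat.div_add_mod z'.val (2 * k + 1), h, h',
    e]

theorem block_lt (hm : m = 2 ^ n * (2 * k + 1)) (x : Fin m) : x.val / (2 * k + 1) < 2 ^ n := by
  rw [Nat.div_lt_iff_lt_mul (by omega), ← hm]; exact x.2

theorem block_index_lt (hm : m = 2 ^ n * (2 * k + 1)) {j r : ℕ} (hj : j < 2 ^ n) (hr : r ≤ 2 * k) :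
    j * (2 * k + 1) + r < m := by
  have : (j + 1) * (2 * k + 1) ≤ 2 ^ n * (2 * k + 1) := Nat.mul_le_mul_right _ hj
  rw [hm]; linarith

theorem block_div {j r : ℕ} (hr : r ≤ 2 * k) : (j * (2 * k + 1) + r) / (2 * k + 1) = j := by
  rw [Nat.mul_comm, Nat.mul_add_div (by omega), Nat.div_eq_of_lt (by omega), Nat.add_zero]

theorem block_mod {j r : ℕ} (hr : r ≤ 2 * k) : (j * (2 * k + 1) + r) % (2 * k + 1) = r := by
  rw [Nat.mul_comm, Nat.mul_add_mod, Nat.mod_eq_of_lt (by omega)]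

/-- Every point is an iterate of the middle point of its block. -/
theorem exists_center (hm : m = 2 ^ n * (2 * k + 1)) (hs : IsSimpleOrbit n σ id) (x : Fin m) :
    ∃ z : Fin m, z.val % (2 * k + 1) = k ∧ z.val / (2 * k + 1) = x.val / (2 * k + 1) ∧
      ∃ t ≤ 2 * k, x = σ^[2 ^ n * t] z := by
  have hj := block_lt hm x
  have h := hs.stefanAt hm hj
  have hr : x.val % (2 * k + 1) ≤ 2 * k := by have := Nat.mod_lt x.val (show 0 < 2 * k + 1 by omega); omega
  have hc := block_index_lt hm hj (show k ≤ 2 * k by omega)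
  have hx : x.val / (2 * k + 1) * (2 * k + 1) + x.val % (2 * k + 1) = x.val := by
    rw [Nat.mul_comm]; exact Nat.div_add_mod _ _
  obtain ⟨t, ht, e⟩ := h.exists_iterate hc hr (by rw [hx]; exact x.2)
  refine ⟨⟨_, hc⟩, block_mod (by omega), block_div (by omega), t, ht, ?_⟩
  simp only [id] at e
  rw [← e]
  exact Fin.ext hx.symm

theorem center_iterate_val (hm : m = 2 ^ n * (2 * k + 1)) (hs : IsSimpleOrbit n σ id) {w : Fin m}
    (hw : w.val % (2 * k + 1) = k) :
    (∀ t ≤ 2 * k, (σ^[2 ^ n * t] w).val = w.val / (2 * k + 1) * (2 * k + 1) + stefanPos k t) ∨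
    (∀ t ≤ 2 * k, (σ^[2 ^ n * t] w).val =
      w.val / (2 * k + 1) * (2 * k + 1) + (2 * k - stefanPos k t)) := by
  obtain ⟨h0, -, h⟩ := hs.stefanAt hm (block_lt hm w)
  have hx : w.val / (2 * k + 1) * (2 * k + 1) + k = w.val := by
    conv_rhs => rw [← Nat.div_add_mod w.val (2 * k + 1), hw]
    rw [Nat.mul_comm]
  have hww : (⟨w.val / (2 * k + 1) * (2 * k + 1) + k, by rw [hx]; exact w.2⟩ : Fin m) = w :=
    Fin.ext hx
  simp only [id, hww] at h
  exact h.imp (fun h t ht => by rw [h t ht]) (fun h t ht => by rw [h t ht])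

theorem iterate_center_div (hm : m = 2 ^ n * (2 * k + 1)) (hs : IsSimpleOrbit n σ id) {z : Fin m}
    (hz : z.val % (2 * k + 1) = k) {t : ℕ} (ht : t ≤ 2 * k) :
    (σ^[2 ^ n * t] z).val / (2 * k + 1) = z.val / (2 * k + 1) := by
  have h3 := stefanPos_le ht
  rcases center_iterate_val hm hs hz with h | h <;> rw [h t ht] <;> exact block_div (by omega)

theorem block_iterate_period (hm : m = 2 ^ n * (2 * k + 1)) (hp : IsPeriodicOrbit σ id) (x : Fin m) :
    σ^[2 ^ n * (2 * k + 1)] x = x := by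
  rw [← hm]; exact (hp.iterate_eq_self_iff x m).2 dvd_rfl

/-- The `2^n`-th iterate preserves the blocks. -/
theorem block_iterate (hm : m = 2 ^ n * (2 * k + 1)) (hp : IsPeriodicOrbit σ id)
    (hs : IsSimpleOrbit n σ id) (x : Fin m) (t : ℕ) :
    (σ^[2 ^ n * t] x).val / (2 * k + 1) = x.val / (2 * k + 1) := by
  obtain ⟨z, hz, hzx, s, hs', rfl⟩ := exists_center hm hs x
  have hmod : σ^[2 ^ n * (t + s)] z = σ^[2 ^ n * ((t + s) % (2 * k + 1))] z := by
    conv_lhs => rw [← Nat.mod_add_div (t + s) (2 * k + 1), Nat.mul_add, Function.iterate_add_apply,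
      ← Nat.mul_assoc, Function.iterate_mul σ (2 ^ n * (2 * k + 1)),
      Function.iterate_fixed (block_iterate_period hm hp z)]
  rw [← hzx, ← Function.iterate_add_apply, ← Nat.mul_add, hmod]
  exact iterate_center_div hm hs hz (by have := Nat.mod_lt (t + s) (show 0 < 2 * k + 1 by omega); omega)

theorem exists_iterate_of_block_eq (hm : m = 2 ^ n * (2 * k + 1)) (hp : IsPeriodicOrbit σ id)
    (hs : IsSimpleOrbit n σ id) {x y : Fin m} (h : x.val / (2 * k + 1) = y.val / (2 * k + 1)) :
    ∃ t, y = σ^[2 ^ n * t] x := by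
  obtain ⟨z, hz, hzx, s, hs', rfl⟩ := exists_center hm hs x
  obtain ⟨z', hz', hzx', s', -, rfl⟩ := exists_center hm hs y
  obtain rfl := eq_of_block_eq hz hz' (by rw [hzx, hzx', h])
  refine ⟨s' + (2 * k + 1 - s), ?_⟩
  rw [← Function.iterate_add_apply, ← Nat.mul_add,
    show s' + (2 * k + 1 - s) + s = s' + (2 * k + 1) by omega, Nat.mul_add,
    Function.iterate_add_apply, block_iterate_period hm hp]

/-- The blocks are the orbits of `σ^[2 ^ n]`, and every power of `σ` commutes with it. -/
theorem block_map (hm : m = 2 ^ n * (2 * k + 1)) (hp : IsPeriodicOrbit σ id)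
    (hs : IsSimpleOrbit n σ id) {x y : Fin m} (h : x.val / (2 * k + 1) = y.val / (2 * k + 1)) (t : ℕ) :
    (σ^[t] x).val / (2 * k + 1) = (σ^[t] y).val / (2 * k + 1) := by
  obtain ⟨s, rfl⟩ := exists_iterate_of_block_eq hm hp hs h
  rw [← Function.iterate_add_apply, Nat.add_comm t, Function.iterate_add_apply,
    block_iterate hm hp hs]

/-- A block whose middle point is mapped to a middle point is translated or reflected. -/
theorem block_translated_or_reflected (hm : m = 2 ^ n * (2 * k + 1)) (hs : IsSimpleOrbit n σ id)
    {z : Fin m} (hz : z.val % (2 * k + 1) = k) (hσz : (σ z).val % (2 * k + 1) = k) :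
    (∀ x : Fin m, x.val / (2 * k + 1) = z.val / (2 * k + 1) →
      (σ x).val = (σ z).val / (2 * k + 1) * (2 * k + 1) + x.val % (2 * k + 1)) ∨
    (∀ x : Fin m, x.val / (2 * k + 1) = z.val / (2 * k + 1) →
      (σ x).val = (σ z).val / (2 * k + 1) * (2 * k + 1) + (2 * k - x.val % (2 * k + 1))) := by
  -- So `σ` matches the Štefan cycles of the two blocks, middle point to middle point. Cycles
  -- running in the same direction give a translation, opposite ones a reflection.
  have hcomm : ∀ t, σ (σ^[2 ^ n * t] z) = σ^[2 ^ n * t] (σ z) := fun t => by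
    rw [← Function.iterate_succ_apply' σ, Function.iterate_succ_apply]
  have hrep : ∀ x : Fin m, x.val / (2 * k + 1) = z.val / (2 * k + 1) →
      ∃ t ≤ 2 * k, x = σ^[2 ^ n * t] z := by
    intro x hx
    obtain ⟨z', hz', hzx, t, ht, e⟩ := exists_center hm hs x
    obtain rfl := eq_of_block_eq hz hz' (by rw [hzx, hx])
    exact ⟨t, ht, e⟩
  rcases center_iterate_val hm hs hz with h1 | h1 <;>
    rcases center_iterate_val hm hs hσz with h2 | h2
  · left
    intro x hx
    obtain ⟨t, ht, rfl⟩ := hrep x hx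
    rw [hcomm, h2 t ht, h1 t ht, block_mod (stefanPos_le ht)]
  · right
    intro x hx
    obtain ⟨t, ht, rfl⟩ := hrep x hx
    rw [hcomm, h2 t ht, h1 t ht, block_mod (stefanPos_le ht)]
  · right
    intro x hx
    obtain ⟨t, ht, rfl⟩ := hrep x hx
    rw [hcomm, h2 t ht, h1 t ht, block_mod (by omega)]
    have := stefanPos_le ht
    omega
  · left
    intro x hx
    obtain ⟨t, ht, rfl⟩ := hrep x hx
    rw [hcomm, h2 t ht, h1 t ht, block_mod (by omega)]

theorem monotoneOn_or_antitoneOn_orbitBlock {X : Type*} [LinearOrder X] {f : X → X}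
    {β : Fin m → X} (hβ : StrictMono β) (hσ : Function.Semiconj β σ f)
    (hm : m = 2 ^ n * (2 * k + 1)) (hs : IsSimpleOrbit n σ id)
    {z : Fin m} (hz : z.val % (2 * k + 1) = k) (hσz : (σ z).val % (2 * k + 1) = k) :
    MonotoneOn f (orbitBlock β (2 * k + 1) (z.val / (2 * k + 1))) ∨
      AntitoneOn f (orbitBlock β (2 * k + 1) (z.val / (2 * k + 1))) := by
  have hmod : ∀ x y : Fin m, x.val / (2 * k + 1) = y.val / (2 * k + 1) → x ≤ y →
      x.val % (2 * k + 1) ≤ y.val % (2 * k + 1) := by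
    intro x y e hxy
    rw [Fin.le_def, ← Nat.div_add_mod x.val (2 * k + 1), ← Nat.div_add_mod y.val (2 * k + 1),
      e] at hxy
    omega
  refine (block_translated_or_reflected hm hs hz hσz).imp (fun h => ?_) (fun h => ?_)
  · rintro _ ⟨x, hx, rfl⟩ _ ⟨y, hy, rfl⟩ hxy
    rw [← hσ.eq, ← hσ.eq]
    apply hβ.monotone
    have := hmod x y (hx.trans hy.symm) (hβ.le_iff_le.1 hxy)
    rw [Fin.le_def, h x hx, h y hy]
    omega
  · rintro _ ⟨x, hx, rfl⟩ _ ⟨y, hy, rfl⟩ hxy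
    rw [← hσ.eq, ← hσ.eq]
    apply hβ.monotone
    have := hmod x y (hx.trans hy.symm) (hβ.le_iff_le.1 hxy)
    rw [Fin.le_def, h x hx, h y hy]
    omega

theorem IsCenteredSimple.isStronglySimple {X : Type*} [LinearOrder X] {f : X → X}
    {β : Fin m → X} (h : IsCenteredSimple k n σ) (hβ : StrictMono β)
    (hσ : Function.Semiconj β σ f) : IsStronglySimple n f β := by
  refine ⟨(isSimpleOrbit_comp_iff hβ.injective hσ (β := id)).2 h.simple, ?_⟩
  obtain ⟨c, hc, -, hc'⟩ := h.special
  have hq : m / 2 ^ n = 2 * k + 1 := by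
    conv_lhs => rw [h.length]
    exact Nat.mul_div_cancel_left _ (by positivity)
  refine ⟨c.val / (2 * k + 1), block_lt h.length c, fun j hj hjc => ?_⟩
  have hz := block_index_lt h.length hj (show k ≤ 2 * k by omega)
  have hzd : (⟨j * (2 * k + 1) + k, hz⟩ : Fin m).val / (2 * k + 1) = j := block_div (by omega)
  have hzm : (⟨j * (2 * k + 1) + k, hz⟩ : Fin m).val % (2 * k + 1) = k := block_mod (by omega)
  have := monotoneOn_or_antitoneOn_orbitBlock hβ hσ h.length h.simple hzm
    (hc' _ hzm fun e => hjc (by rw [← e, hzd]))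
  rwa [hzd, ← hq] at this

end Blocks

/-! ### Minimal orbits are centered -/

section Minimal

variable {X : Type*} [ConditionallyCompleteLinearOrder X] [DenselyOrdered X] [TopologicalSpace X]
  [OrderTopology X] {m n k : ℕ} {f : X → X} {β : Fin m → X} {σ : Fin m → Fin m}

/-- In a minimal orbit, the iterates of middle points are close to middle points. -/
theorem IsMinimalOrbit.iterate_center (h : IsMinimalOrbit f β) (hf : Continuous f) (hk : 1 < k)
    (hm : m = 2 ^ n * (2 * k + 1)) (hσ : Function.Semiconj β σ f) {z : Fin m}
    (hz : z.val % (2 * k + 1) = k) {u : ℕ} (hu : u ≤ 2 ^ n) :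
    ∃ z' : Fin m, z'.val % (2 * k + 1) = k ∧ (σ^[u] z = z' ∨ σ^[u] z = σ^[2 ^ n] z') := by
  have hsX := h.isSimpleOrbit hf hk hm
  have hs : IsSimpleOrbit n σ id := (isSimpleOrbit_comp_iff h.1.2.1.injective hσ (β := id)).1 hsX
  have hp := h.1.perm hσ
  obtain ⟨z', hz', -, t, ht, e⟩ := exists_center hm hs (σ^[u] z)
  refine ⟨z', hz', ?_⟩
  rcases Nat.eq_zero_or_pos t with rfl | ht0
  · left; simpa using e
  rcases Nat.lt_or_ge t 2 with ht1 | ht2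
  · right; rw [e, show t = 1 by omega, mul_one]
  -- Here `f^[u]` and `f^[2 ^ n - u]` factor `f^[2 ^ n]`, and the first one shifts by `t ≥ 2`; the
  -- resulting odd period below `2k+1` contradicts minimality.
  exfalso
  have hcenter : ∀ w : Fin m, w.val % (2 * k + 1) = k →
      ∃ (o : ℕ) (ho : o + k < m), StefanAt k (2 ^ n) o f β ∧ β w = β ⟨o + k, ho⟩ := by
    intro w hw
    have hx : w.val / (2 * k + 1) * (2 * k + 1) + k = w.val := by
      conv_rhs => rw [← Nat.div_add_mod w.val (2 * k + 1), hw]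
      rw [Nat.mul_comm]
    exact ⟨_, by rw [hx]; exact w.2, hsX.stefanAt hm (block_lt hm w), by
      congr 1; exact Fin.ext hx.symm⟩
  obtain ⟨o, ho, hst, hβz⟩ := hcenter z hz
  obtain ⟨o', ho', hst', hβz'⟩ := hcenter z' hz'
  have hper : ∀ x : Fin m, f^[2 ^ n * (2 * k + 1)] (β x) = β x := fun x => by
    rw [← (hσ.iterate_right _).eq, block_iterate_period hm hp]
  have hodd : Odd (2 * k + 1) := ⟨k, rfl⟩
  obtain ⟨x, h1, h2, h3⟩ := exists_odd_period_of_shift hk (g := f^[u]) (h := f^[2 ^ n - u])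
    (F := f^[2 ^ n]) (c := β z) (c' := β z') (j := t) (hf.iterate _) (hf.iterate _)
    (fun x => by rw [← Function.iterate_add_apply, Nat.sub_add_cancel hu])
    (fun x => by rw [← Function.iterate_add_apply, Nat.add_sub_cancel' hu])
    (by rw [← Function.iterate_mul, hper]) (by rw [← Function.iterate_mul, hper])
    (fun t ht => by
      simp only [← Function.iterate_mul]
      rw [hβz]; exact hst.between h.1.2.1 ho ht)
    (by
      simp only [← Function.iterate_mul]
      rw [hβz']; exact hst'.center_between h.1.2.1 (by omega) ho')
    (fun t e => by
      rw [← Function.iterate_mul, ← (hσ.iterate_right _).eq, ← (hσ.iterate_right _).eq] at e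
      have := (hp.iterate_eq_self_iff _ _).1 (h.1.2.1.injective e)
      rw [hm] at this
      have := Nat.le_of_dvd (by positivity) this
      nlinarith [Nat.one_le_two_pow (n := n)])
    ht2 ht
    (by rw [← Function.iterate_mul, ← (hσ.iterate_right _).eq, ← (hσ.iterate_right _).eq, e])
  have := h.le_of_odd_period hf hm hodd (by omega) x h1 h2
  omega

/-- A lost middle point is not regained within one round of the blocks. After one step `z` has shift
`1`, and the remaining `u - 1` steps add `0` or `1`. Shift `0` would require `m` to divide `2^n` or
`2^n + 2^n`, but `m = 2^n * (2k+1)` is larger. -/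
theorem IsMinimalOrbit.no_second_special (h : IsMinimalOrbit f β) (hf : Continuous f) (hk : 1 < k)
    (hm : m = 2 ^ n * (2 * k + 1)) (hσ : Function.Semiconj β σ f) {z : Fin m}
    (hz : z.val % (2 * k + 1) = k) (hσz : (σ z).val % (2 * k + 1) ≠ k) {u : ℕ} (hu0 : 0 < u)
    (hu : u < 2 ^ n) : (σ^[u] z).val % (2 * k + 1) ≠ k := by
  intro hz2
  have hp := h.1.perm hσ
  have hs : IsSimpleOrbit n σ id :=
    (isSimpleOrbit_comp_iff h.1.2.1.injective hσ (β := id)).1 (h.isSimpleOrbit hf hk hm)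
  obtain ⟨w, hw, e⟩ := h.iterate_center hf hk hm hσ hz (u := 1) Nat.one_le_two_pow
  rw [Function.iterate_one] at e
  replace e := e.resolve_left fun e => hσz (e ▸ hw)
  have e2 : σ^[u] z = σ^[2 ^ n * 1] (σ^[u - 1] w) := by
    rw [mul_one, ← Function.iterate_add_apply, Nat.add_comm, Function.iterate_add_apply, ← e,
      ← Function.iterate_succ_apply, Nat.succ_eq_add_one, Nat.sub_add_cancel hu0]
  obtain ⟨z', hz', e3⟩ := h.iterate_center hf hk hm hσ hw (u := u - 1) (by omega)
  have hN : 0 < 2 ^ n := by positivity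
  have hzz : σ^[u] z = z' := by
    apply eq_of_block_eq hz2 hz'
    rw [e2, block_iterate hm hp hs]
    rcases e3 with e3 | e3
    · rw [e3]
    · rw [e3, ← mul_one (2 ^ n), block_iterate hm hp hs]
  rw [hzz, mul_one] at e2
  rcases e3 with e3 | e3
  · rw [e3] at e2
    have := Nat.le_of_dvd hN ((hp.iterate_eq_self_iff _ _).1 e2.symm)
    rw [hm] at this
    nlinarith
  · rw [e3, ← Function.iterate_add_apply] at e2
    have := Nat.le_of_dvd (by omega) ((hp.iterate_eq_self_iff _ _).1 e2.symm)
    rw [hm] at this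
    nlinarith

theorem IsMinimalOrbit.isCenteredSimple (h : IsMinimalOrbit f β) (hf : Continuous f) (hk : 1 < k)
    (hm : m = 2 ^ n * (2 * k + 1)) (hσ : Function.Semiconj β σ f) : IsCenteredSimple k n σ := by
  have hp := h.1.perm hσ
  have hs : IsSimpleOrbit n σ id :=
    (isSimpleOrbit_comp_iff h.1.2.1.injective hσ (β := id)).1 (h.isSimpleOrbit hf hk hm)
  refine ⟨hm, hp, hs, ?_⟩
  -- Otherwise the middle points form an invariant set, although point `0` is not one of them.
  obtain ⟨c, hc, hσc⟩ : ∃ c : Fin m, c.val % (2 * k + 1) = k ∧ (σ c).val % (2 * k + 1) ≠ k := by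
    by_contra! hcon
    have hk' : k < m := by simpa using block_index_lt hm (j := 0) (by positivity) (show k ≤ 2 * k by omega)
    have := hp.eq_univ (S := Finset.univ.filter fun z : Fin m => z.val % (2 * k + 1) = k)
      (i := ⟨k, hk'⟩) (by simp; omega) (fun j hj => by
        simp only [Finset.mem_filter, Finset.mem_univ, true_and] at hj ⊢
        exact hcon j hj)
    have h0 := Finset.mem_univ (⟨0, hp.1⟩ : Fin m)
    rw [← this] at h0
    simp at h0
    omega
  refine ⟨c, hc, hσc, fun z hz hzc => ?_⟩
  by_contra hσz
  have hN : 0 < 2 ^ n := by positivity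
  -- Suppose `z` and `c` are both special. Starting from `c`, the block of `z` is met after `U % 2 ^
  -- n` steps, either at `z` or one Štefan step later. In the first case `c`, in the second case
  -- `z`, returns to a middle point too early.
  obtain ⟨U, -, hU⟩ := hp.exists_iterate_eq c z
  simp only [id] at hU
  have hblk : (σ^[U % 2 ^ n] c).val / (2 * k + 1) = z.val / (2 * k + 1) := by
    rw [← hU]
    conv_rhs => rw [← Nat.div_add_mod U (2 ^ n), Function.iterate_add_apply, block_iterate hm hp hs]
  have hlt := Nat.mod_lt U hN
  rcases Nat.eq_zero_or_pos (U % 2 ^ n) with h0 | h0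
  · rw [h0] at hblk
    exact hzc (eq_of_block_eq hz hc hblk.symm)
  · obtain ⟨z', hz', e⟩ := h.iterate_center hf hk hm hσ hc hlt.le
    have hzz : z = z' := by
      apply eq_of_block_eq hz hz'
      rw [← hblk]
      rcases e with e | e
      · rw [e]
      · rw [e, ← mul_one (2 ^ n), block_iterate hm hp hs]
    rw [← hzz] at e
    rcases e with e | e
    · exact h.no_second_special hf hk hm hσ hc hσc h0 hlt (e ▸ hz)
    · have e4 : σ^[2 ^ n - U % 2 ^ n] z = c := by
        apply hp.injective.iterate (U % 2 ^ n)
        rw [← Function.iterate_add_apply, Nat.add_sub_cancel' hlt.le, e]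
      exact h.no_second_special hf hk hm hσ hz hσz (u := 2 ^ n - U % 2 ^ n) (by omega) (by omega)
        (e4 ▸ hc)

end Minimal

/-! ### Odd periods of the connect-the-dots map of a Štefan orbit -/

section StefanMap

/-- The action of the standard Štefan orbit on its points, counted from the middle point. -/
def stefanNode (k : ℕ) (i : ℤ) : ℤ := if i = -k then 0 else if i ≤ 0 then 1 - i else -i

variable {k : ℕ} {G : ℝ → ℝ}

theorem stefanMap_eq_of_nonpos (hG : ∀ i : ℤ, -k ≤ i → i < k → ∀ t ∈ Set.Icc (0 : ℝ) 1,
    G (i + t) = (1 - t) * stefanNode k i + t * stefanNode k (i + 1)) (hk : 0 < k) {v : ℝ}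
    (h1 : -((k : ℝ) - 1) ≤ v) (h2 : v ≤ 0) : G v = 1 - v := by
  have hf1 := Int.floor_le v
  have hf2 := Int.lt_floor_add_one v
  have hl : 1 - (k : ℤ) ≤ ⌊v⌋ := Int.le_floor.2 (by push_cast; linarith)
  have hu : ⌊v⌋ ≤ 0 := by
    have := Int.floor_mono h2; simpa using this
  have h := hG ⌊v⌋ (by omega) (by omega) (v - ⌊v⌋) ⟨by linarith, by linarith⟩
  rw [show (⌊v⌋ : ℝ) + (v - ⌊v⌋) = v by ring] at h
  rw [h]
  rcases eq_or_lt_of_le hu with h0 | h0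
  · have hv : v = 0 := le_antisymm h2 (by rw [h0] at hf1; simpa using hf1)
    simp [stefanNode, hv]
    intro h; omega
  · have e1 : stefanNode k ⌊v⌋ = 1 - ⌊v⌋ := by
      unfold stefanNode; rw [if_neg (by omega), if_pos (by omega)]
    have e2 : stefanNode k (⌊v⌋ + 1) = 1 - (⌊v⌋ + 1) := by
      unfold stefanNode; rw [if_neg (by omega), if_pos (by omega)]
    rw [e1, e2]; push_cast; ring

theorem stefanMap_eq_of_le_one (hG : ∀ i : ℤ, -k ≤ i → i < k → ∀ t ∈ Set.Icc (0 : ℝ) 1,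
    G (i + t) = (1 - t) * stefanNode k i + t * stefanNode k (i + 1)) (hk : 0 < k) {v : ℝ}
    (h1 : 0 ≤ v) (h2 : v ≤ 1) : G v = 1 - 2 * v := by
  have h := hG 0 (by omega) (by omega) v ⟨h1, h2⟩
  have e1 : stefanNode k 0 = 1 := by unfold stefanNode; rw [if_neg (by omega)]; simp
  have e2 : stefanNode k (0 + 1) = -1 := by unfold stefanNode; rw [if_neg (by omega)]; simp
  rw [e1, e2] at h
  simp only [Int.cast_zero, zero_add] at h
  rw [h]; push_cast; ring

theorem stefanMap_eq_of_one_le (hG : ∀ i : ℤ, -k ≤ i → i < k → ∀ t ∈ Set.Icc (0 : ℝ) 1,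
    G (i + t) = (1 - t) * stefanNode k i + t * stefanNode k (i + 1)) (hk : 0 < k) {v : ℝ}
    (h1 : 1 ≤ v) (h2 : v ≤ k) : G v = -v := by
  rcases eq_or_lt_of_le h2 with rfl | h2
  · have h := hG (k - 1) (by omega) (by omega) 1 ⟨zero_le_one, le_rfl⟩
    have e2 : stefanNode k ((k : ℤ) - 1 + 1) = -k := by
      unfold stefanNode; rw [if_neg (by omega), if_neg (by omega)]; omega
    rw [e2] at h
    push_cast at h
    rw [sub_add_cancel] at h
    rw [h]; ring
  · have hf1 := Int.floor_le v
    have hf2 := Int.lt_floor_add_one v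
    have hl : 1 ≤ ⌊v⌋ := Int.le_floor.2 (by push_cast; linarith)
    have hu : ⌊v⌋ < k := Int.floor_lt.2 (by push_cast; linarith)
    have h := hG ⌊v⌋ (by omega) (by omega) (v - ⌊v⌋) ⟨by linarith, by linarith⟩
    rw [show (⌊v⌋ : ℝ) + (v - ⌊v⌋) = v by ring] at h
    have e1 : stefanNode k ⌊v⌋ = -⌊v⌋ := by
      unfold stefanNode; rw [if_neg (by omega), if_neg (by omega)]
    have e2 : stefanNode k (⌊v⌋ + 1) = -(⌊v⌋ + 1) := by
      unfold stefanNode; rw [if_neg (by omega), if_neg (by omega)]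
    rw [h, e1, e2]; push_cast; ring

theorem stefanMap_eq_of_le (hG : ∀ i : ℤ, -k ≤ i → i < k → ∀ t ∈ Set.Icc (0 : ℝ) 1,
    G (i + t) = (1 - t) * stefanNode k i + t * stefanNode k (i + 1)) (hk : 0 < k) {v : ℝ}
    (h1 : -(k : ℝ) ≤ v) (h2 : v ≤ -((k : ℝ) - 1)) : G v = (v + k) * k := by
  have h := hG (-k) (by omega) (by omega) (v + k) ⟨by linarith, by linarith⟩
  have e1 : stefanNode k (-k) = 0 := by unfold stefanNode; rw [if_pos rfl]
  have e2 : stefanNode k (-k + 1) = k := by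
    unfold stefanNode; rw [if_neg (by omega), if_pos (by omega)]; omega
  rw [e1, e2] at h
  push_cast at h
  rw [show -(k : ℝ) + (v + k) = v by ring] at h
  rw [h]; ring

/-- The connect-the-dots map of a Štefan orbit of length `2k+1` has no odd period strictly between
`1` and `2k+1`. -/
theorem stefanMap_fixed (hG : ∀ i : ℤ, -k ≤ i → i < k → ∀ t ∈ Set.Icc (0 : ℝ) 1,
    G (i + t) = (1 - t) * stefanNode k i + t * stefanNode k (i + 1)) (hk : 0 < k) {v : ℝ}
    (h1 : -(k : ℝ) ≤ v) (h2 : v ≤ k) {s : ℕ} (hs : Odd s) (hsk : s < 2 * k + 1)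
    (hv : G^[s] v = v) : G v = v := by
  by_contra hne
  have hk1 : (1 : ℝ) ≤ k := by exact_mod_cast hk
  have hmaps : ∀ v : ℝ, -(k : ℝ) ≤ v → v ≤ k → -(k : ℝ) ≤ G v ∧ G v ≤ k := by
    intro v h1 h2
    rcases le_total v (-((k : ℝ) - 1)) with h3 | h3
    · rw [stefanMap_eq_of_le hG hk h1 h3]; constructor <;> nlinarith
    rcases le_total v 0 with h4 | h4
    · rw [stefanMap_eq_of_nonpos hG hk h3 h4]; constructor <;> linarith
    rcases le_total v 1 with h5 | h5
    · rw [stefanMap_eq_of_le_one hG hk h4 h5]; constructor <;> linarith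
    · rw [stefanMap_eq_of_one_le hG hk h5 h2]; constructor <;> linarith
  have hright : ∀ v : ℝ, 1 / 3 < v → v ≤ k → G v < 1 / 3 := by
    intro v h1 h2
    rcases le_total v 1 with h5 | h5
    · rw [stefanMap_eq_of_le_one hG hk (by linarith) h5]; linarith
    · rw [stefanMap_eq_of_one_le hG hk h5 h2]; linarith
  -- Outside the leftmost unit interval, points left of the fixed point `1/3` go to the right, and
  -- two steps move them left by at most `1`.
  have hleft : ∀ v : ℝ, -((k : ℝ) - 1) ≤ v → v < 1 / 3 → 1 / 3 < G v ∧ v - 1 ≤ G (G v) := by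
    intro v h1 h2
    rcases le_total v 0 with h4 | h4
    · rw [stefanMap_eq_of_nonpos hG hk h1 h4,
        stefanMap_eq_of_one_le hG hk (by linarith) (by linarith)]
      constructor <;> linarith
    · rw [stefanMap_eq_of_le_one hG hk h4 (by linarith),
        stefanMap_eq_of_le_one hG hk (by linarith) (by linarith)]
      constructor <;> linarith
  have hthird : G (1 / 3) = 1 / 3 := by
    rw [stefanMap_eq_of_le_one hG hk (by norm_num) (by norm_num)]; norm_num
  have hit : ∀ t, -(k : ℝ) ≤ G^[t] v ∧ G^[t] v ≤ k := by
    intro t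
    induction t with
    | zero => exact ⟨h1, h2⟩
    | succ t ih => rw [Function.iterate_succ_apply']; exact hmaps _ ih.1 ih.2
  have hper : ∀ t, G^[s] (G^[t] v) = G^[t] v := fun t => by
    rw [← Function.iterate_add_apply, Nat.add_comm, Function.iterate_add_apply, hv]
  have hnt : ∀ t, G^[t] v ≠ 1 / 3 := by
    intro t ht
    have e1 : G^[s * t] v = v := by rw [Function.iterate_mul]; exact Function.iterate_fixed hv t
    have e2 : s * t = (s * t - t) + t :=
      (Nat.sub_add_cancel (Nat.le_mul_of_pos_left t hs.pos)).symm
    rw [e2, Function.iterate_add_apply, ht, Function.iterate_fixed hthird] at e1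
    rw [← e1] at hne
    exact hne hthird
  -- Points right of `1/3` go left. If points on the left always went right, the sides would
  -- alternate, which is impossible on a cycle of odd length.
  obtain ⟨t, hl1, hl2⟩ : ∃ t, G^[t] v < 1 / 3 ∧ G^[t + 1] v < 1 / 3 := by
    by_contra! hcon
    have hsw : ∀ t, (G^[t] v < 1 / 3 ↔ ¬ G^[t + 1] v < 1 / 3) := by
      intro t
      refine ⟨fun h => not_lt.2 (hcon t h), fun h => ?_⟩
      by_contra h'
      apply h
      rw [Function.iterate_succ_apply']
      exact hright _ (lt_of_le_of_ne (not_lt.1 h') (hnt t).symm) (hit t).2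
    have hev : ∀ j, (G^[2 * j] v < 1 / 3 ↔ v < 1 / 3) := by
      intro j
      induction j with
      | zero => rfl
      | succ j ih =>
        have a1 := hsw (2 * j)
        have a2 := hsw (2 * j + 1)
        rw [show 2 * (j + 1) = 2 * j + 1 + 1 by ring]
        tauto
    obtain ⟨j, rfl⟩ := hs
    have a1 := hev j
    have a2 := hsw (2 * j)
    rw [hv] at a2
    tauto
  have hu := hper t
  have hu1 := (hit t).1
  rw [Function.iterate_succ_apply'] at hl2
  generalize G^[t] v = u at hl1 hl2 hu hu1
  have hu2 : u < -((k : ℝ) - 1) := by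
    by_contra hcon
    have := (hleft u (not_lt.1 hcon) hl1).1
    linarith
  -- The point `u` in the leftmost unit interval is sent to `[0, 1/3)`, and from there each double
  -- step loses at most `1`. Returning to `u < -(k - 1)` therefore takes more than the `s ≤ 2k - 1`
  -- steps available.
  have hz : ∀ j : ℕ, j + 1 ≤ k → -(j : ℝ) ≤ G^[2 * j + 1] u ∧ G^[2 * j + 1] u < 1 / 3 := by
    intro j
    induction j with
    | zero =>
      intro _
      simp only [Nat.mul_zero, Nat.zero_add, Function.iterate_one]
      refine ⟨?_, hl2⟩
      rw [stefanMap_eq_of_le hG hk hu1 hu2.le]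
      simp only [Nat.cast_zero, neg_zero]
      exact mul_nonneg (by linarith) (by linarith)
    | succ j ih =>
      intro hj
      obtain ⟨i1, i2⟩ := ih (by omega)
      have hjk : (j : ℝ) + 1 + 1 ≤ k := by exact_mod_cast hj
      have b1 := hleft _ (by linarith) i2
      have b2 := hmaps (G^[2 * j + 1] u) (by linarith) (by linarith)
      rw [show 2 * (j + 1) + 1 = 2 * j + 1 + 1 + 1 by ring, Function.iterate_succ_apply',
        Function.iterate_succ_apply']
      push_cast
      exact ⟨by linarith, hright _ b1.1 b2.2⟩
  obtain ⟨j, rfl⟩ := hs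
  have h3 := (hz j (by omega)).1
  have hjk : (j : ℝ) + 1 ≤ k := by exact_mod_cast (show j + 1 ≤ k by omega)
  rw [hu] at h3
  linarith

end StefanMap

/-! ### Piecewise affine maps -/

section ConnectTheDots

/-- The piecewise affine map with the values `s 0, …, s M` at `0, …, M`, constant outside
`[0, M]`. -/
noncomputable def plMap (s : ℕ → ℝ) (M : ℕ) (x : ℝ) : ℝ :=
  s 0 + ∑ i ∈ Finset.range M, (s (i + 1) - s i) * max 0 (min 1 (x - i))

variable {s : ℕ → ℝ} {M : ℕ} {x : ℝ}

theorem continuous_plMap (s : ℕ → ℝ) (M : ℕ) : Continuous (plMap s M) := by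
  unfold plMap
  fun_prop

theorem plMap_of_nonpos (hx : x ≤ 0) : plMap s M x = s 0 := by
  unfold plMap
  rw [Finset.sum_eq_zero, add_zero]
  intro i _
  have : (0 : ℝ) ≤ i := Nat.cast_nonneg i
  rw [max_eq_left ((min_le_right _ _).trans (by linarith)), mul_zero]

theorem plMap_sum_of_le {n : ℕ} (hx : (n : ℝ) ≤ x) :
    ∑ i ∈ Finset.range n, (s (i + 1) - s i) * max 0 (min 1 (x - i)) = s n - s 0 := by
  rw [← Finset.sum_range_sub]
  apply Finset.sum_congr rfl
  intro i hi
  have : (i : ℝ) + 1 ≤ n := by exact_mod_cast Finset.mem_range.1 hi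
  rw [min_eq_left (by linarith), max_eq_right zero_le_one, mul_one]

theorem plMap_of_le (hx : (M : ℝ) ≤ x) : plMap s M x = s M := by
  unfold plMap
  rw [plMap_sum_of_le hx]; ring

theorem plMap_affine {i : ℕ} (hi : i < M) (h1 : (i : ℝ) ≤ x) (h2 : x ≤ i + 1) :
    plMap s M x = s i + (s (i + 1) - s i) * (x - i) := by
  unfold plMap
  have key : ∀ n, i < n → ∑ j ∈ Finset.range n, (s (j + 1) - s j) * max 0 (min 1 (x - j)) =
      s i - s 0 + (s (i + 1) - s i) * (x - i) := by
    intro n hn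
    induction n, hn using Nat.le_induction with
    | base =>
      rw [Finset.sum_range_succ, plMap_sum_of_le h1, min_eq_right (by linarith),
        max_eq_right (by linarith)]
    | succ n hn ih =>
      have : (i : ℝ) + 1 ≤ n := by exact_mod_cast hn
      rw [Finset.sum_range_succ, ih, max_eq_left ((min_le_right _ _).trans (by linarith)), mul_zero,
        add_zero]
  rw [key M hi]; ring

theorem plMap_node {i : ℕ} (hi : i ≤ M) : plMap s M i = s i := by
  rcases hi.eq_or_lt with rfl | hi
  · exact plMap_of_le le_rfl
  · rw [plMap_affine hi le_rfl (by linarith)]; ring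

theorem exists_unit_interval {a b : ℕ} (hab : a < b) (h1 : (a : ℝ) ≤ x) (h2 : x ≤ b) :
    ∃ i, a ≤ i ∧ i < b ∧ (i : ℝ) ≤ x ∧ x ≤ i + 1 := by
  rcases h2.eq_or_lt with rfl | h2
  · refine ⟨b - 1, by omega, by omega, ?_, ?_⟩ <;>
      rw [Nat.cast_sub (by omega)] <;> simp
  · have hx : 0 ≤ x := (Nat.cast_nonneg a).trans h1
    exact ⟨⌊x⌋₊, Nat.le_floor h1, (Nat.floor_lt hx).2 h2, Nat.floor_le hx, (Nat.lt_floor_add_one x).le⟩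

theorem plMap_mem_Icc {a b : ℕ} (hab : a ≤ b) (hb : b ≤ M) (h1 : (a : ℝ) ≤ x) (h2 : x ≤ b)
    {lo hi : ℝ} (hs : ∀ j, a ≤ j → j ≤ b → s j ∈ Set.Icc lo hi) : plMap s M x ∈ Set.Icc lo hi := by
  rcases hab.eq_or_lt with rfl | hab
  · rw [le_antisymm h2 h1, plMap_node hb]
    exact hs a le_rfl le_rfl
  · obtain ⟨i, hi1, hi2, hi3, hi4⟩ := exists_unit_interval hab h1 h2
    rw [plMap_affine (by omega) hi3 hi4]
    obtain ⟨l1, u1⟩ := hs i hi1 hi2.le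
    obtain ⟨l2, u2⟩ := hs (i + 1) (by omega) hi2
    constructor <;> nlinarith

theorem plMap_mem_Icc_of_forall {lo hi : ℝ} (hs : ∀ j ≤ M, s j ∈ Set.Icc lo hi) (x : ℝ) :
    plMap s M x ∈ Set.Icc lo hi := by
  rcases le_total x 0 with h | h
  · rw [plMap_of_nonpos h]; exact hs 0 (Nat.zero_le _)
  rcases le_total x M with h' | h'
  · exact plMap_mem_Icc (Nat.zero_le M) le_rfl (by simpa using h) h' fun j _ hj => hs j hj
  · rw [plMap_of_le h']; exact hs M le_rfl

theorem plMap_monotone_or_antitone {i : ℕ} (hi : i < M) :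
    MonotoneOn (plMap s M) (Set.Icc (i : ℝ) (i + 1)) ∨
      AntitoneOn (plMap s M) (Set.Icc (i : ℝ) (i + 1)) := by
  rcases le_total (s i) (s (i + 1)) with h | h
  · left
    intro x hx y hy hxy
    rw [plMap_affine hi hx.1 hx.2, plMap_affine hi hy.1 hy.2]
    nlinarith
  · right
    intro x hx y hy hxy
    rw [plMap_affine hi hx.1 hx.2, plMap_affine hi hy.1 hy.2]
    nlinarith

/-- If `y ≤ G y`, all later iterates stay above `G y`, including the return to `y`; the other case
is symmetric. -/
theorem MonotoneOn.eq_of_periodic {α : Type*} [LinearOrder α] {G : α → α} {S : Set α}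
    (hG : MonotoneOn G S) (hS : Set.MapsTo G S S) {y : α} (hy : y ∈ S) {p : ℕ} (hp : 0 < p)
    (h : G^[p] y = y) : G y = y := by
  have hmem : ∀ j, G^[j] y ∈ S := fun j => hS.iterate j hy
  rcases le_total y (G y) with h1 | h1
  · have hmono : ∀ j, G y ≤ G^[j + 1] y := by
      intro j
      induction j with
      | zero => exact le_rfl
      | succ j ih =>
        rw [Function.iterate_succ_apply']
        exact hG hy (hmem _) (h1.trans ih)
    have := hmono (p - 1)
    rw [Nat.sub_add_cancel hp, h] at this
    exact le_antisymm this h1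
  · have hmono : ∀ j, G^[j + 1] y ≤ G y := by
      intro j
      induction j with
      | zero => exact le_rfl
      | succ j ih =>
        rw [Function.iterate_succ_apply']
        exact hG (hmem _) hy (ih.trans h1)
    have := hmono (p - 1)
    rw [Nat.sub_add_cancel hp, h] at this
    exact le_antisymm h1 this

end ConnectTheDots

/-! ### Pieces of a simple orbit at all levels -/

section Pieces

variable {m n k : ℕ} {σ : Fin m → Fin m}

theorem half_length (hm : m = 2 ^ (n + 1) * (2 * k + 1)) : m / 2 = 2 ^ n * (2 * k + 1) := by
  rw [hm, pow_succ', mul_assoc, Nat.mul_div_cancel_left _ two_pos]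

/-- A piece of level `i` has `2^i * (2k+1)` consecutive points: level `0` gives the blocks, level
`n` the whole orbit. It arises after `n - i` halvings, each of which doubles the return time. -/
theorem IsSimpleOrbit.exists_piece_iterate {X : Type*} [LinearOrder X] {f : X → X} {β : Fin m → X}
    (h : IsSimpleOrbit n f β) (hm : m = 2 ^ n * (2 * k + 1)) (hmap : ∀ x, f (β x) ∈ Set.range β)
    {i : ℕ} (hi : i ≤ n) (x : Fin m) : ∃ y : Fin m, f^[2 ^ (n - i)] (β x) = β y ∧
      y.val / (2 ^ i * (2 * k + 1)) = x.val / (2 ^ i * (2 * k + 1)) := by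
  induction n generalizing m f with
  | zero =>
    obtain rfl : i = 0 := by omega
    obtain ⟨y, hy⟩ := hmap x
    refine ⟨y, by simpa using hy.symm, ?_⟩
    rw [Nat.div_eq_of_lt (by omega), Nat.div_eq_of_lt (by omega)]
  | succ n ih =>
    rcases hi.eq_or_lt with rfl | hi
    · obtain ⟨y, hy⟩ := hmap x
      refine ⟨y, by simpa using hy.symm, ?_⟩
      rw [Nat.div_eq_of_lt (by omega), Nat.div_eq_of_lt (by omega)]
    · have hm2 := half_length hm
      obtain ⟨hsw, h1, h2⟩ := h
      have e : 2 ^ (n + 1 - i) = 2 * 2 ^ (n - i) := by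
        rw [← pow_succ']; congr 1; omega
      rw [e, Function.iterate_mul]
      have hmm : m = m / 2 + m / 2 := by rw [hm2, hm, pow_succ]; ring
      by_cases hx : x.val < m / 2
      · obtain ⟨y, hy, hyx⟩ := ih h1 hm2 hsw.mapsTo_left (by omega) ⟨x.val, hx⟩
        exact ⟨⟨y.val, by omega⟩, hy, hyx⟩
      · obtain ⟨y, hy, hyx⟩ := ih h2 hm2 hsw.mapsTo_right (by omega) ⟨x.val - m / 2, by omega⟩
        have hx' : rightHalf β ⟨x.val - m / 2, by omega⟩ = β x := by
          unfold rightHalf; congr 1; rw [Fin.ext_iff]; simp only; omega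
        rw [hx'] at hy
        refine ⟨⟨y.val + m / 2, by omega⟩, hy, ?_⟩
        have hw : m / 2 = 2 ^ (n - i) * (2 ^ i * (2 * k + 1)) := by
          rw [hm2, ← mul_assoc, ← pow_add]; congr 2; omega
        have hpos : 0 < 2 ^ i * (2 * k + 1) := by positivity
        have key : ∀ a, (a + m / 2) / (2 ^ i * (2 * k + 1)) =
            a / (2 ^ i * (2 * k + 1)) + 2 ^ (n - i) := fun a => by
          rw [hw, Nat.add_mul_div_right _ _ hpos]
        simp only at hyx ⊢
        rw [key, hyx, ← key, Nat.sub_add_cancel (by omega)]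

theorem piece_iterate (hm : m = 2 ^ n * (2 * k + 1)) (hs : IsSimpleOrbit n σ id) {i : ℕ}
    (hi : i ≤ n) (x : Fin m) (t : ℕ) : (σ^[2 ^ (n - i) * t] x).val / (2 ^ i * (2 * k + 1)) =
      x.val / (2 ^ i * (2 * k + 1)) := by
  induction t with
  | zero => rfl
  | succ t ih =>
    obtain ⟨y, hy, hyx⟩ := hs.exists_piece_iterate hm (fun x => ⟨σ x, rfl⟩) hi
      (σ^[2 ^ (n - i) * t] x)
    rw [Nat.mul_succ, Nat.add_comm, Function.iterate_add_apply]
    simp only [id] at hy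
    rw [hy, hyx, ih]

/-- A piece of `w` points is invariant under `σ^[2 ^ (n - i)]`, and `w` successive iterates of a
point under this power are distinct; so the piece is a single cycle. -/
theorem exists_iterate_of_piece_eq (hm : m = 2 ^ n * (2 * k + 1)) (hp : IsPeriodicOrbit σ id)
    (hs : IsSimpleOrbit n σ id) {i : ℕ} (hi : i ≤ n) {x y : Fin m}
    (h : y.val / (2 ^ i * (2 * k + 1)) = x.val / (2 ^ i * (2 * k + 1))) :
    ∃ t, y = σ^[2 ^ (n - i) * t] x := by
  set w := 2 ^ i * (2 * k + 1) with hw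
  have hpos : 0 < w := by positivity
  have hmw : m = 2 ^ (n - i) * w := by rw [hw, ← mul_assoc, ← pow_add, hm]; congr 2; omega
  let S : Finset (Fin m) := Finset.univ.filter fun y => y.val / w = x.val / w
  have hS : S.card ≤ w := by
    rw [← Finset.card_range w]
    apply Finset.card_le_card_of_injOn (fun y => y.val % w)
    · intro y _; simpa using Nat.mod_lt _ hpos
    · intro a ha b hb e
      simp only [S, Finset.coe_filter, Finset.mem_univ, true_and, Set.mem_ofPred_eq] at ha hb e
      rw [Fin.ext_iff, ← Nat.div_add_mod a.val w, ← Nat.div_add_mod b.val w, ha, hb, e]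
  have hT : ((Finset.range w).image fun t => σ^[2 ^ (n - i) * t] x) = S := by
    apply Finset.eq_of_subset_of_card_le
    · intro y hy
      rw [Finset.mem_image] at hy
      obtain ⟨t, -, rfl⟩ := hy
      simpa [S] using piece_iterate hm hs hi x t
    · rw [Finset.card_image_of_injOn, Finset.card_range]
      · exact hS
      · intro a ha b hb e
        have hinj := Function.iterate_injOn_Iio_minimalPeriod (f := σ) (x := x)
        rw [show Function.minimalPeriod σ x = m from hp.minimalPeriod_eq x] at hinj
        simp only [Finset.coe_range, Set.mem_Iio] at ha hb
        have hN : 0 < 2 ^ (n - i) := by positivity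
        have := hinj (by rw [Set.mem_Iio, hmw]; exact Nat.mul_lt_mul_of_pos_left ha hN)
          (by rw [Set.mem_Iio, hmw]; exact Nat.mul_lt_mul_of_pos_left hb hN) e
        exact Nat.eq_of_mul_eq_mul_left hN this
  have hy : y ∈ S := by simpa [S] using h
  rw [← hT, Finset.mem_image] at hy
  obtain ⟨t, -, e⟩ := hy
  exact ⟨t, e.symm⟩

/-- At every level, the pieces of a simple orbit are permuted. -/
theorem piece_map (hm : m = 2 ^ n * (2 * k + 1)) (hp : IsPeriodicOrbit σ id)
    (hs : IsSimpleOrbit n σ id) {i : ℕ} (hi : i ≤ n) {x y : Fin m}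
    (h : y.val / (2 ^ i * (2 * k + 1)) = x.val / (2 ^ i * (2 * k + 1))) :
    (σ y).val / (2 ^ i * (2 * k + 1)) = (σ x).val / (2 ^ i * (2 * k + 1)) := by
  obtain ⟨t, rfl⟩ := exists_iterate_of_piece_eq hm hp hs hi h
  rw [← Function.iterate_succ_apply' σ, Function.iterate_succ_apply, piece_iterate hm hs hi]

end Pieces

/-! ### The connect-the-dots map of a permutation -/

section DotMap

variable {m n k : ℕ} {σ : Fin m → Fin m}

/-- The connect-the-dots map of a map `σ` of `{0, …, m - 1}`. -/
noncomputable def dotMap (σ : Fin m → Fin m) : ℝ → ℝ :=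
  -- For `m > 0` the default `0` is never used: the nodes are `0, …, m - 1`.
  plMap (fun i => if h : i < m then ((σ ⟨i, h⟩).val : ℝ) else 0) (m - 1)

theorem continuous_dotMap : Continuous (dotMap σ) := continuous_plMap _ _

theorem dotMap_coe (x : Fin m) : dotMap σ (x.val : ℝ) = ((σ x).val : ℝ) := by
  unfold dotMap
  rw [plMap_node (by omega), dif_pos x.2]

theorem semiconj_dotMap : Function.Semiconj (fun x : Fin m => (x.val : ℝ)) σ (dotMap σ) :=
  fun x => (dotMap_coe x).symm

theorem dotMap_mem_Icc (hm : 0 < m) (y : ℝ) : dotMap σ y ∈ Set.Icc (0 : ℝ) ((m - 1 : ℕ) : ℝ) := by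
  apply plMap_mem_Icc_of_forall
  intro j hj
  rw [dif_pos (by omega)]
  exact ⟨Nat.cast_nonneg _, by exact_mod_cast (by omega)⟩

theorem dotMap_affine {x x' : Fin m} (h : x'.val = x.val + 1) {y : ℝ} (h1 : (x.val : ℝ) ≤ y)
    (h2 : y ≤ x.val + 1) :
    dotMap σ y = (σ x).val + (((σ x').val : ℝ) - (σ x).val) * (y - x.val) := by
  have e := plMap_affine (s := fun i => if h : i < m then ((σ ⟨i, h⟩).val : ℝ) else 0)
    (show x.val < m - 1 by omega) h1 h2
  simp only [← h, Fin.is_lt, Fin.eta, dif_pos] at e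
  exact e

/-- The hull of the piece of `w` consecutive points that contains the point number `x`. -/
def pieceHull (w x : ℕ) : Set ℝ := Set.Icc ((x / w * w : ℕ) : ℝ) ((x / w * w + (w - 1) : ℕ) : ℝ)

theorem pieceHull_congr {w x x' : ℕ} (h : x / w = x' / w) : pieceHull w x = pieceHull w x' := by
  unfold pieceHull; rw [h]

theorem coe_mem_pieceHull {w x x' : ℕ} (hw : 0 < w) (h : x' / w = x / w) :
    (x' : ℝ) ∈ pieceHull w x := by
  rw [pieceHull_congr h.symm]
  have h1 := Nat.div_add_mod' x' w
  have h2 := Nat.mod_lt x' hw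
  exact ⟨by exact_mod_cast (by omega), by exact_mod_cast (by omega)⟩

theorem piece_eq_of_mem_pieceHull {w x x' : ℕ} (hw : 0 < w) {y : ℝ} (h : y ∈ pieceHull w x)
    (h' : y ∈ pieceHull w x') : x / w = x' / w := by
  obtain ⟨h1, h2⟩ := h
  obtain ⟨h1', h2'⟩ := h'
  have a1 : x / w * w ≤ x' / w * w + (w - 1) := by exact_mod_cast h1.trans h2'
  have a2 : x' / w * w ≤ x / w * w + (w - 1) := by exact_mod_cast h1'.trans h2
  by_contra hne
  rcases Nat.lt_or_gt_of_ne hne with h | h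
  · have := Nat.mul_le_mul_right w (show x / w + 1 ≤ x' / w from h)
    rw [Nat.add_mul] at this; omega
  · have := Nat.mul_le_mul_right w (show x' / w + 1 ≤ x / w from h)
    rw [Nat.add_mul] at this; omega

theorem piece_end_lt {i : ℕ} (hm : m = 2 ^ n * (2 * k + 1)) (hi : i ≤ n) (x : Fin m) :
    x.val / (2 ^ i * (2 * k + 1)) * (2 ^ i * (2 * k + 1)) + (2 ^ i * (2 * k + 1) - 1) < m := by
  set w := 2 ^ i * (2 * k + 1) with hw
  have hpos : 0 < w := by positivity
  have hmw : m = 2 ^ (n - i) * w := by rw [hw, ← mul_assoc, ← pow_add, hm]; congr 2; omega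
  have h1 : x.val / w < 2 ^ (n - i) := by
    rw [Nat.div_lt_iff_lt_mul hpos, ← hmw]; exact x.2
  have := Nat.mul_le_mul_right w (show x.val / w + 1 ≤ 2 ^ (n - i) from h1)
  rw [Nat.add_mul] at this; omega

theorem dotMap_mem_pieceHull (hm : m = 2 ^ n * (2 * k + 1)) (hp : IsPeriodicOrbit σ id)
    (hs : IsSimpleOrbit n σ id) {i : ℕ} (hi : i ≤ n) {x : Fin m} {y : ℝ}
    (hy : y ∈ pieceHull (2 ^ i * (2 * k + 1)) x) :
    dotMap σ y ∈ pieceHull (2 ^ i * (2 * k + 1)) (σ x) := by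
  have hend := piece_end_lt hm hi x
  refine plMap_mem_Icc (Nat.le_add_right _ _) (by omega) hy.1 hy.2 fun j hj1 hj2 => ?_
  have hjm : j < m := by omega
  rw [dif_pos hjm]
  have hpos : 0 < 2 ^ i * (2 * k + 1) := by positivity
  refine coe_mem_pieceHull hpos (piece_map hm hp hs hi ?_)
  simp only
  refine Nat.div_eq_of_lt_le hj1 ?_
  rw [Nat.add_mul]; omega

theorem iterate_dotMap_mem_pieceHull (hm : m = 2 ^ n * (2 * k + 1)) (hp : IsPeriodicOrbit σ id)
    (hs : IsSimpleOrbit n σ id) {i : ℕ} (hi : i ≤ n) {x : Fin m} {y : ℝ}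
    (hy : y ∈ pieceHull (2 ^ i * (2 * k + 1)) x) (t : ℕ) :
    (dotMap σ)^[t] y ∈ pieceHull (2 ^ i * (2 * k + 1)) (σ^[t] x).val := by
  induction t with
  | zero => exact hy
  | succ t ih =>
    rw [Function.iterate_succ_apply', Function.iterate_succ_apply']
    exact dotMap_mem_pieceHull hm hp hs hi ih

/-- Periodic points that stay in the gaps between the pieces of some level have a power of two as
a period. -/
theorem dotMap_gap_period (hm : m = 2 ^ n * (2 * k + 1)) (hs : IsSimpleOrbit n σ id) {i : ℕ}
    (hi : i + 1 ≤ n) {x : Fin m} {y : ℝ}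
    (hmem : ∀ t, (dotMap σ)^[t] y ∈ pieceHull (2 ^ (i + 1) * (2 * k + 1)) (σ^[t] x).val)
    (hnot : ∀ t, ∀ x : Fin m, (dotMap σ)^[t] y ∉ pieceHull (2 ^ i * (2 * k + 1)) x.val) {p : ℕ}
    (hp : 0 < p) (hy : (dotMap σ)^[p] y = y) : (dotMap σ)^[2 ^ (n - i)] y = y := by
  set w := 2 ^ i * (2 * k + 1) with hw
  have hpos : 0 < w := by positivity
  have hw2 : 2 ^ (i + 1) * (2 * k + 1) = 2 * w := by rw [hw, pow_succ]; ring
  -- `e x` is the last point in the left half of the piece of level `i + 1` containing `x`. The gap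
  -- between the two halves is the unit interval from `e x` to `e x + 1`, on which the map is
  -- affine. `S` collects the points that follow the gaps along the itinerary of `x`.
  let e : Fin m → ℕ := fun x => x.val / (2 * w) * (2 * w) + (w - 1)
  have he : ∀ x, e x < m - 1 := fun x => by
    have := piece_end_lt hm hi x
    rw [hw2] at this
    simp only [e]; omega
  let S : Set ℝ := {u | ∀ t, (dotMap σ)^[t] u ∈ Set.Icc (e (σ^[t] x) : ℝ) (e (σ^[t] x) + 1)}
  have hyS : y ∈ S := by
    intro t
    obtain ⟨h1, h2⟩ := hmem t
    rw [hw2] at h1 h2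
    set z := σ^[t] x
    have hend := piece_end_lt hm hi z
    rw [hw2] at hend
    have d1 : z.val / (2 * w) * (2 * w) / w = z.val / (2 * w) * 2 := by
      rw [← mul_assoc, Nat.mul_div_cancel _ hpos]
    constructor
    · by_contra hcon
      rw [not_le] at hcon
      apply hnot t ⟨z.val / (2 * w) * (2 * w), by omega⟩
      refine ⟨?_, ?_⟩
      · simp only [d1]; rw [mul_assoc]; exact h1
      · simp only [d1]; rw [mul_assoc]; exact hcon.le
    · by_contra hcon
      rw [not_le] at hcon
      apply hnot t ⟨z.val / (2 * w) * (2 * w) + w, by omega⟩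
      have d2 : (z.val / (2 * w) * (2 * w) + w) / w = z.val / (2 * w) * 2 + 1 := by
        rw [Nat.add_div_right _ hpos, d1]
      have hc : (e z : ℝ) + 1 = ((z.val / (2 * w) * (2 * w) + w : ℕ) : ℝ) := by
        have : e z + 1 = z.val / (2 * w) * (2 * w) + w := by simp only [e]; omega
        exact_mod_cast this
      refine ⟨?_, ?_⟩
      · simp only [d2]; rw [Nat.add_mul, mul_assoc, one_mul, ← hc]; exact hcon.le
      · simp only [d2]; rw [Nat.add_mul, mul_assoc, one_mul, add_assoc,
          show w + (w - 1) = 2 * w - 1 by omega]; exact h2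
  have hmono : ∀ t, MonotoneOn (dotMap σ)^[t] S ∨ AntitoneOn (dotMap σ)^[t] S := by
    intro t
    induction t with
    | zero => exact Or.inl fun a _ b _ h => h
    | succ t ih =>
      have hmaps : Set.MapsTo (dotMap σ)^[t] S (Set.Icc (e (σ^[t] x) : ℝ) (e (σ^[t] x) + 1)) :=
        fun u hu => hu t
      rw [Function.iterate_succ']
      rcases plMap_monotone_or_antitone
          (s := fun i => if h : i < m then ((σ ⟨i, h⟩).val : ℝ) else 0) (he (σ^[t] x)) with h1 | h1
        <;> rcases ih with h2 | h2
      · exact Or.inl (h1.comp h2 hmaps)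
      · exact Or.inr (fun a ha b hb hab => h1 (hmaps hb) (hmaps ha) (h2 ha hb hab))
      · exact Or.inr (fun a ha b hb hab => h1 (hmaps ha) (hmaps hb) (h2 ha hb hab))
      · exact Or.inl (h1.comp h2 hmaps)
  -- This power returns every piece of level `i + 1`, hence every gap, to itself. It may reverse the
  -- order on `S`, but its square is monotone, which accounts for the exponent `n - i`.
  have hSS : Set.MapsTo (dotMap σ)^[2 ^ (n - (i + 1))] S S := by
    intro u hu t
    have h1 := hu (t + 2 ^ (n - (i + 1)))
    have h2 : e (σ^[t + 2 ^ (n - (i + 1))] x) = e (σ^[t] x) := by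
      have := piece_iterate hm hs hi (σ^[t] x) 1
      rw [mul_one, hw2] at this
      simp only [e]
      rw [Nat.add_comm t, Function.iterate_add_apply, this]
    rw [h2, Function.iterate_add_apply] at h1
    exact h1
  have h2 : 2 ^ (n - i) = 2 ^ (n - (i + 1)) * 2 := by rw [← pow_succ]; congr 1; omega
  have hG : MonotoneOn (dotMap σ)^[2 ^ (n - i)] S := by
    rw [h2, Function.iterate_mul, Function.iterate_succ, Function.iterate_one]
    rcases hmono (2 ^ (n - (i + 1))) with h | h
    · exact h.comp h hSS
    · exact h.comp h hSS
  have hGS : Set.MapsTo (dotMap σ)^[2 ^ (n - i)] S S := by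
    rw [h2, Function.iterate_mul]
    exact hSS.iterate 2
  refine hG.eq_of_periodic hGS hyS hp ?_
  rw [← Function.iterate_mul, Nat.mul_comm, Function.iterate_mul]
  exact Function.iterate_fixed hy _

/-- The connect-the-dots map is an isometry on the blocks with middle points mapped to middle
points. -/
theorem dotMap_block (hk : 0 < k) (hm : m = 2 ^ n * (2 * k + 1)) (hs : IsSimpleOrbit n σ id)
    {z : Fin m} (hz : z.val % (2 * k + 1) = k) (hσz : (σ z).val % (2 * k + 1) = k) :
    ∃ a b : ℝ, ∀ y ∈ pieceHull (2 * k + 1) z.val, dotMap σ y = a * y + b := by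
  have hend := piece_end_lt hm (Nat.zero_le n) z
  simp only [pow_zero, one_mul] at hend
  have hunit : ∀ y ∈ pieceHull (2 * k + 1) z.val, ∃ r < 2 * k,
      ((z.val / (2 * k + 1) * (2 * k + 1) + r : ℕ) : ℝ) ≤ y ∧
      y ≤ ((z.val / (2 * k + 1) * (2 * k + 1) + r : ℕ) : ℝ) + 1 := by
    intro y hy
    obtain ⟨i, h1, h2, h3, h4⟩ := exists_unit_interval (by omega) hy.1 hy.2
    refine ⟨i - z.val / (2 * k + 1) * (2 * k + 1), by omega, ?_⟩
    rw [Nat.add_sub_cancel' h1]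
    exact ⟨h3, h4⟩
  rcases block_translated_or_reflected hm hs hz hσz with h | h
  · refine ⟨1, ((σ z).val / (2 * k + 1) * (2 * k + 1) : ℕ) -
      (z.val / (2 * k + 1) * (2 * k + 1) : ℕ), fun y hy => ?_⟩
    obtain ⟨r, hr, h1, h2⟩ := hunit y hy
    rw [dotMap_affine (x := ⟨z.val / (2 * k + 1) * (2 * k + 1) + r, by omega⟩)
      (x' := ⟨z.val / (2 * k + 1) * (2 * k + 1) + (r + 1), by omega⟩) rfl h1 h2,
      h ⟨z.val / (2 * k + 1) * (2 * k + 1) + r, by omega⟩ (block_div hr.le),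
      h ⟨z.val / (2 * k + 1) * (2 * k + 1) + (r + 1), by omega⟩ (block_div hr),
      block_mod hr.le, block_mod hr]
    push_cast; ring
  · refine ⟨-1, ((σ z).val / (2 * k + 1) * (2 * k + 1) : ℕ) + 2 * k +
      (z.val / (2 * k + 1) * (2 * k + 1) : ℕ), fun y hy => ?_⟩
    obtain ⟨r, hr, h1, h2⟩ := hunit y hy
    rw [dotMap_affine (x := ⟨z.val / (2 * k + 1) * (2 * k + 1) + r, by omega⟩)
      (x' := ⟨z.val / (2 * k + 1) * (2 * k + 1) + (r + 1), by omega⟩) rfl h1 h2,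
      h ⟨z.val / (2 * k + 1) * (2 * k + 1) + r, by omega⟩ (block_div hr.le),
      h ⟨z.val / (2 * k + 1) * (2 * k + 1) + (r + 1), by omega⟩ (block_div hr),
      block_mod hr.le, block_mod hr]
    rw [Nat.cast_add, Nat.cast_add, Nat.cast_sub (show r + 1 ≤ 2 * k by omega),
      Nat.cast_sub (show r ≤ 2 * k by omega)]
    push_cast; ring

end DotMap

/-! ### Minimality of the connect-the-dots map -/

section Realization

variable {m n k : ℕ} {σ : Fin m → Fin m}

theorem two_pow_dvd_of_block_eq (hm : m = 2 ^ n * (2 * k + 1)) (hp : IsPeriodicOrbit σ id)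
    (hs : IsSimpleOrbit n σ id) {x : Fin m} {t : ℕ}
    (h : (σ^[t] x).val / (2 * k + 1) = x.val / (2 * k + 1)) : 2 ^ n ∣ t := by
  obtain ⟨s, e⟩ := exists_iterate_of_block_eq hm hp hs h
  rw [← Function.iterate_add_apply] at e
  have h1 := (hp.iterate_eq_self_iff x _).1 e.symm
  exact (Nat.dvd_add_right (Nat.dvd_mul_right _ _)).1 ((Dvd.intro _ hm.symm).trans h1)

theorem stefanNode_stefanPos {t : ℕ} (ht : t < 2 * k) :
    stefanNode k ((stefanPos k t : ℤ) - k) = (stefanPos k (t + 1) : ℤ) - k := by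
  unfold stefanNode
  rcases stefanPos_succ ht with ⟨j, hj, rfl, e1, e2⟩ | ⟨j, hj, rfl, e1, e2⟩ <;> rw [e1, e2] <;>
    split_ifs <;> omega

theorem stefanNode_stefanPos_last : stefanNode k ((stefanPos k (2 * k) : ℤ) - k) = 0 := by
  simp [stefanNode, stefanPos]

/-- In the block of a middle point, counted from the middle point in a suitable direction, the
`2^n`-th iterate is the standard Štefan orbit. -/
theorem exists_stefan_direction (hm : m = 2 ^ n * (2 * k + 1)) (hp : IsPeriodicOrbit σ id)
    (hs : IsSimpleOrbit n σ id) {c : Fin m} (hc : c.val % (2 * k + 1) = k) :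
    ∃ ε : ℤ, (ε = 1 ∨ ε = -1) ∧ ∀ i : ℤ, -k ≤ i → i ≤ k → ∃ x : Fin m,
      x.val / (2 * k + 1) = c.val / (2 * k + 1) ∧ (x.val : ℤ) = c.val + ε * i ∧
      ((σ^[2 ^ n] x).val : ℤ) = c.val + ε * stefanNode k i := by
  have hck : c.val / (2 * k + 1) * (2 * k + 1) + k = c.val := by
    conv_rhs => rw [← Nat.div_add_mod c.val (2 * k + 1), hc]
    rw [Nat.mul_comm]
  have hstep : ∀ t, σ^[2 ^ n] (σ^[2 ^ n * t] c) = σ^[2 ^ n * (t + 1)] c := fun t => by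
    rw [← Function.iterate_add_apply]; congr 1; ring
  have hi : ∀ i : ℤ, -k ≤ i → i ≤ k → ∃ t ≤ 2 * k, (stefanPos k t : ℤ) - k = i := by
    intro i h1 h2
    obtain ⟨t, ht, e⟩ := exists_stefanPos_eq (k := k) (r := (i + k).toNat) (by omega)
    exact ⟨t, ht, by omega⟩
  rcases center_iterate_val hm hs hc with h | h
  · refine ⟨1, Or.inl rfl, fun i h1 h2 => ?_⟩
    obtain ⟨t, ht, rfl⟩ := hi i h1 h2
    refine ⟨_, iterate_center_div hm hs hc ht, by rw [h t ht]; omega, ?_⟩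
    rw [hstep]
    rcases ht.eq_or_lt with rfl | ht
    · rw [block_iterate_period hm hp, stefanNode_stefanPos_last]; ring
    · rw [h _ (show t + 1 ≤ 2 * k from ht), stefanNode_stefanPos ht]; omega
  · refine ⟨-1, Or.inr rfl, fun i h1 h2 => ?_⟩
    obtain ⟨t, ht, rfl⟩ := hi i h1 h2
    have := stefanPos_le ht
    refine ⟨_, iterate_center_div hm hs hc ht, by rw [h t ht]; omega, ?_⟩
    rw [hstep]
    rcases ht.eq_or_lt with rfl | ht
    · rw [block_iterate_period hm hp, stefanNode_stefanPos_last]; ring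
    · have := stefanPos_le (show t + 1 ≤ 2 * k from ht)
      rw [h _ (show t + 1 ≤ 2 * k from ht), stefanNode_stefanPos ht]; omega

/-- If all middle points but `c` are mapped to middle points, the first `2^n` iterates of the
connect-the-dots map are affine between adjacent points of the block of `c`. -/
theorem iterate_dotMap_affine (hk : 0 < k) (hm : m = 2 ^ n * (2 * k + 1))
    (hp : IsPeriodicOrbit σ id) (hs : IsSimpleOrbit n σ id) {c : Fin m}
    (hc : c.val % (2 * k + 1) = k)
    (hσ : ∀ z : Fin m, z.val % (2 * k + 1) = k → z ≠ c → (σ z).val % (2 * k + 1) = k)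
    {x x' : Fin m} (hx : x.val / (2 * k + 1) = c.val / (2 * k + 1))
    (hx' : x'.val / (2 * k + 1) = c.val / (2 * k + 1)) (hxx : x'.val = x.val + 1) {t : ℝ}
    (ht0 : 0 ≤ t) (ht1 : t ≤ 1) {v : ℕ} (hv : v < 2 ^ n) :
    (dotMap σ)^[v + 1] (x.val + t) =
      (1 - t) * (σ^[v + 1] x).val + t * (σ^[v + 1] x').val := by
  induction v with
  | zero =>
    rw [Nat.zero_add, Function.iterate_one, Function.iterate_one,
      dotMap_affine hxx (by linarith) (by linarith)]
    ring
  | succ v ih =>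
    have hq : 0 < 2 * k + 1 := by omega
    obtain ⟨z, hz, hzx, -⟩ := exists_center hm hs (σ^[v + 1] x)
    -- Within fewer than `2 ^ n` further steps the block of `c` is not met again, so only blocks
    -- with an affine map are passed.
    have hzc : z ≠ c := by
      rintro rfl
      have := two_pow_dvd_of_block_eq hm hp hs (hzx.symm.trans hx.symm)
      exact absurd (Nat.le_of_dvd (by omega) this) (by omega)
    obtain ⟨a, b, hab⟩ := dotMap_block hk hm hs hz (hσ z hz hzc)
    have h1 := hab (σ^[v + 1] x).val (coe_mem_pieceHull hq hzx.symm)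
    have h2 := hab (σ^[v + 1] x').val (coe_mem_pieceHull hq
      (by rw [hzx]; exact block_map hm hp hs (hx'.trans hx.symm) _))
    have h3 := hab ((dotMap σ)^[v + 1] (x.val + t)) (by
      rw [pieceHull_congr hzx]
      have h0 : (x.val : ℝ) + t ∈ pieceHull (2 ^ 0 * (2 * k + 1)) x.val := by
        rw [pow_zero, one_mul]
        have m1 := coe_mem_pieceHull hq (rfl : x.val / (2 * k + 1) = x.val / (2 * k + 1))
        have m2 := coe_mem_pieceHull hq (hx'.trans hx.symm)
        rw [hxx] at m2
        push_cast at m2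
        exact Set.ordConnected_Icc.out m1 m2 ⟨by linarith, by linarith⟩
      have := iterate_dotMap_mem_pieceHull hm hp hs (Nat.zero_le n) h0 (v + 1)
      rwa [pow_zero, one_mul] at this)
    rw [Function.iterate_succ_apply' _ (v + 1), h3, ih (by omega),
      Function.iterate_succ_apply' _ (v + 1), Function.iterate_succ_apply' _ (v + 1),
      ← dotMap_coe (σ^[v + 1] x), ← dotMap_coe (σ^[v + 1] x'), h1, h2]
    ring

theorem dotMap_special_block (hk : 0 < k) (hm : m = 2 ^ n * (2 * k + 1))
    (hp : IsPeriodicOrbit σ id) (hs : IsSimpleOrbit n σ id) {c : Fin m}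
    (hc : c.val % (2 * k + 1) = k)
    (hσ : ∀ z : Fin m, z.val % (2 * k + 1) = k → z ≠ c → (σ z).val % (2 * k + 1) = k)
    {y : ℝ} (hy : y ∈ pieceHull (2 * k + 1) c.val) {s : ℕ} (hso : Odd s) (hsk : s < 2 * k + 1)
    (hsy : ((dotMap σ)^[2 ^ n])^[s] y = y) : (dotMap σ)^[2 ^ n] y = y := by
  obtain ⟨ε, hε, hnode⟩ := exists_stefan_direction hm hp hs hc
  set F := (dotMap σ)^[2 ^ n] with hF
  have hN : 0 < 2 ^ n := by positivity
  have haff : ∀ x x' : Fin m, x.val / (2 * k + 1) = c.val / (2 * k + 1) →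
      x'.val / (2 * k + 1) = c.val / (2 * k + 1) → x'.val = x.val + 1 → ∀ t : ℝ, 0 ≤ t → t ≤ 1 →
      F (x.val + t) = (1 - t) * (σ^[2 ^ n] x).val + t * (σ^[2 ^ n] x').val := by
    intro x x' hx hx' hxx t ht0 ht1
    have := iterate_dotMap_affine hk hm hp hs hc hσ hx hx' hxx ht0 ht1 (v := 2 ^ n - 1) (by omega)
    rwa [Nat.sub_add_cancel hN] at this
  have hε2 : (ε : ℝ) * ε = 1 := by rcases hε with rfl | rfl <;> norm_num
  -- Centered at `c` and oriented by `ε = ±1`, the return map to the special block becomes the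
  -- standard Štefan map.
  let G : ℝ → ℝ := fun u => ε * (F (c.val + ε * u) - c.val)
  have hGF : ∀ u, (c.val : ℝ) + ε * G u = F (c.val + ε * u) := fun u => by
    simp only [G]; rw [← mul_assoc, hε2]; ring
  have hGs : ∀ s u, (c.val : ℝ) + ε * G^[s] u = F^[s] (c.val + ε * u) := by
    intro s u
    induction s with
    | zero => rfl
    | succ s ih => rw [Function.iterate_succ_apply', Function.iterate_succ_apply', hGF, ih]
  have hG : ∀ i : ℤ, -k ≤ i → i < k → ∀ t ∈ Set.Icc (0 : ℝ) 1,
      G (i + t) = (1 - t) * stefanNode k i + t * stefanNode k (i + 1) := by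
    intro i h1 h2 t ht
    obtain ⟨x, hx, ex, ex'⟩ := hnode i h1 h2.le
    obtain ⟨w, hw, ew, ew'⟩ := hnode (i + 1) (by omega) (by omega)
    have ex2 : (x.val : ℝ) = c.val + ε * i := by exact_mod_cast ex
    have ew2 : (w.val : ℝ) = c.val + ε * (i + 1) := by exact_mod_cast ew
    have ex3 : ((σ^[2 ^ n] x).val : ℝ) = c.val + ε * stefanNode k i := by exact_mod_cast ex'
    have ew3 : ((σ^[2 ^ n] w).val : ℝ) = c.val + ε * stefanNode k (i + 1) := by exact_mod_cast ew'
    simp only [G]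
    rcases hε with rfl | rfl
    · have := haff x w hx hw (by omega) t ht.1 ht.2
      rw [ex2, ex3, ew3] at this
      push_cast at this ⊢
      rw [show (c.val : ℝ) + 1 * (i + t) = c.val + 1 * i + t by ring, this]
      ring
    · have := haff w x hw hx (by omega) (1 - t) (by linarith [ht.2]) (by linarith [ht.1])
      rw [ew2, ex3, ew3] at this
      push_cast at this ⊢
      rw [show (c.val : ℝ) + -1 * (i + t) = c.val + -1 * (i + 1) + (1 - t) by ring, this]
      ring
  have hck : ((c.val / (2 * k + 1) * (2 * k + 1) : ℕ) : ℝ) + k = c.val := by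
    have : c.val / (2 * k + 1) * (2 * k + 1) + k = c.val := by
      conv_rhs => rw [← Nat.div_add_mod c.val (2 * k + 1), hc]
      rw [Nat.mul_comm]
    exact_mod_cast this
  obtain ⟨y1, y2⟩ := hy
  rw [Nat.add_sub_cancel] at y2
  push_cast at y1 y2 hck
  have hyu : (c.val : ℝ) + ε * (ε * (y - c.val)) = y := by rw [← mul_assoc, hε2]; ring
  have hu : -(k : ℝ) ≤ ε * (y - c.val) ∧ ε * (y - c.val) ≤ k := by
    rcases hε with rfl | rfl <;> push_cast <;> constructor <;> linarith
  have hcancel : ∀ a b : ℝ, (c.val : ℝ) + ε * a = c.val + ε * b → a = b := by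
    intro a b h
    have h' : (ε : ℝ) * a = ε * b := by linarith
    calc a = ε * (ε * a) := by rw [← mul_assoc, hε2, one_mul]
      _ = ε * (ε * b) := by rw [h']
      _ = b := by rw [← mul_assoc, hε2, one_mul]
  have := stefanMap_fixed hG hk hu.1 hu.2 hso hsk (hcancel _ _ (by rw [hGs, hyu, hsy]))
  rw [← hyu, ← hGF, this]

/-- The connect-the-dots map of a centered simple permutation has no larger period. -/
theorem IsCenteredSimple.isMinimalOrbit_dotMap (h : IsCenteredSimple k n σ) (hk : 0 < k) :
    IsMinimalOrbit (dotMap σ) (fun x : Fin m => (x.val : ℝ)) := by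
  obtain ⟨hm, hp, hs, c, hc, -, hσ⟩ := h
  have hinj : Function.Injective (fun x : Fin m => (x.val : ℝ)) := fun x y e =>
    Fin.ext (Nat.cast_injective (R := ℝ) e)
  constructor
  · refine isPeriodicOrbit_of_mem_range hp.1 (fun x y hxy => by exact_mod_cast hxy)
      (fun x => ⟨σ x, (dotMap_coe x).symm⟩) ⟨0, hp.1⟩ ?_
    have := minimalPeriod_eq_of_semiconj hinj semiconj_dotMap (⟨0, hp.1⟩ : Fin m) (f := σ)
    exact this.trans (hp.minimalPeriod_eq ⟨0, hp.1⟩)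
  · intro p y hp0 hyp
    have hy : (dotMap σ)^[p] y = y := by rw [← hyp]; exact Function.isPeriodicPt_minimalPeriod _ _
    have hq1 : 1 < 2 * k + 1 := by omega
    have hyp' : ∀ t, (dotMap σ)^[p * t] y = y := fun t => by
      rw [Function.iterate_mul]; exact Function.iterate_fixed hy t
    have hback : ∀ i ≤ n, ∀ t (x : Fin m), (dotMap σ)^[t] y ∈ pieceHull (2 ^ i * (2 * k + 1)) x.val →
        ∃ x : Fin m, y ∈ pieceHull (2 ^ i * (2 * k + 1)) x.val := by
      intro i hi t x hx
      have := iterate_dotMap_mem_pieceHull hm hp hs hi hx (p * t - t)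
      rw [← Function.iterate_add_apply, Nat.sub_add_cancel (Nat.le_mul_of_pos_left t hp0), hyp'] at this
      exact ⟨_, this⟩
    have htop : ∃ i, i ≤ n ∧ ∃ x : Fin m, y ∈ pieceHull (2 ^ i * (2 * k + 1)) x.val := by
      refine ⟨n, le_rfl, ⟨0, hp.1⟩, ?_⟩
      have : y ∈ Set.Icc (0 : ℝ) ((m - 1 : ℕ) : ℝ) := by
        rw [← hy, ← Nat.sub_add_cancel hp0, Function.iterate_succ_apply']
        exact dotMap_mem_Icc hp.1 _
      rw [← hm]
      simpa [pieceHull] using this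
    classical
    -- Take the finest level at which `y` lies in the hull of a piece. If it is not level `0`, the
    -- whole orbit of `y` avoids the hulls one level below, and the gap argument excludes an odd
    -- factor `r > 1` of the period.
    obtain ⟨hin, x, hx⟩ := Nat.find_spec htop
    have hmin := fun j => Nat.find_min htop (m := j)
    generalize Nat.find htop = i at hin hx hmin
    rw [hm, eq_or_sharkovskiiLT_iff hp0 ⟨k, rfl⟩ hq1]
    intro a r hpa hr hr1
    cases i with
    | succ i =>
      exfalso
      have hgap := dotMap_gap_period hm hs hin
        (fun t => iterate_dotMap_mem_pieceHull hm hp hs hin hx t)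
        (fun t x' hx' => hmin i (by omega) ⟨by omega, hback i (by omega) t x' hx'⟩) hp0 hy
      have hdvd : p ∣ 2 ^ (n - i) := by
        rw [← hyp]
        exact Function.IsPeriodicPt.minimalPeriod_dvd hgap
      have h2 : r ∣ 2 ^ (n - i) := (Dvd.intro_left _ hpa.symm).trans hdvd
      have := ((Nat.coprime_two_right.2 hr).pow_right (n - i)).eq_one_of_dvd h2
      omega
    | zero =>
      obtain ⟨u, -, hu⟩ := hp.exists_iterate_eq x c
      simp only [id] at hu
      have hyc := iterate_dotMap_mem_pieceHull hm hp hs (Nat.zero_le n) hx u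
      rw [hu] at hyc
      set w := (dotMap σ)^[u] y with hw
      have hwp : Function.minimalPeriod (dotMap σ) w = p := by
        rw [hw, Function.minimalPeriod_apply_iterate
          (Function.minimalPeriod_pos_iff_mem_periodicPts.1 (hyp ▸ hp0)), hyp]
      have hwp' : (dotMap σ)^[p] w = w := by
        rw [← hwp]; exact Function.isPeriodicPt_minimalPeriod _ _
      -- The point moves through the disjoint block hulls as the blocks themselves do, so it can
      -- return only after a multiple of `2 ^ n` steps.
      have hdvd : 2 ^ n ∣ p := by
        have := iterate_dotMap_mem_pieceHull hm hp hs (Nat.zero_le n) hyc p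
        rw [hwp'] at this
        rw [pow_zero, one_mul] at this hyc
        exact two_pow_dvd_of_block_eq hm hp hs
          (piece_eq_of_mem_pieceHull (by omega) this hyc)
      obtain ⟨s, hps⟩ := hdvd
      have hna : n ≤ a := by
        rw [hpa] at hps
        have h2 : 2 ^ n ∣ 2 ^ a * r := ⟨s, hps⟩
        have := ((Nat.coprime_two_left.2 hr).pow_left n).dvd_of_dvd_mul_right h2
        exact (Nat.pow_dvd_pow_iff_le_right (by norm_num)).1 this
      rcases hna.eq_or_lt with rfl | hna
      · right
        refine ⟨rfl, ?_⟩
        by_contra hlt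
        have hsr : s = r := by
          rw [hpa] at hps
          exact (Nat.eq_of_mul_eq_mul_left (by positivity) hps).symm
        have := dotMap_special_block hk hm hp hs hc hσ (by simpa using hyc) (s := r) hr
          (by omega) (by rw [← Function.iterate_mul, ← hpa, hwp'])
        have h3 := Nat.le_of_dvd (by positivity) (Function.IsPeriodicPt.minimalPeriod_dvd this)
        rw [hwp, hpa] at h3
        nlinarith [Nat.one_le_two_pow (n := n)]
      · exact Or.inl hna

end Realization

/-! ### Conjugations of cyclic permutations -/

section Rotation

variable {m : ℕ} {ρ ρ' : Fin m → Fin m}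

theorem IsPeriodicOrbit.iterate_eq_iff (h : IsPeriodicOrbit ρ id) (x : Fin m) (s t : ℕ) :
    ρ^[s] x = ρ^[t] x ↔ s ≡ t [MOD m] := by
  have e : Function.minimalPeriod ρ x = m := h.minimalPeriod_eq x
  rw [← Function.iterate_mod_minimalPeriod_eq (n := s),
    ← Function.iterate_mod_minimalPeriod_eq (n := t), e,
    Function.iterate_eq_iterate_iff_of_lt_minimalPeriod (by rw [e]; exact Nat.mod_lt _ h.1)
      (by rw [e]; exact Nat.mod_lt _ h.1)]
  rfl

/-- If all elements of a set but `c` are mapped into the set by a cyclic permutation, the set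
consists of the last points before `c`. -/
theorem mem_iff_exists_iterate_eq (hp : IsPeriodicOrbit ρ id) {Z : Finset (Fin m)} {c : Fin m}
    (hZ : ∀ z ∈ Z, z ≠ c → ρ z ∈ Z) (z : Fin m) : z ∈ Z ↔ ∃ v < Z.card, ρ^[v] z = c := by
  classical
  have key : ∀ z ∈ Z, ∃ v < Z.card, ρ^[v] z = c := by
    intro z hz
    have hex : ∃ v, ρ^[v] z = c := by
      obtain ⟨v, -, hv⟩ := hp.exists_iterate_eq z c; exact ⟨v, hv⟩
    refine ⟨Nat.find hex, ?_, Nat.find_spec hex⟩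
    have hmem : ∀ j ≤ Nat.find hex, ρ^[j] z ∈ Z := by
      intro j
      induction j with
      | zero => intro _; exact hz
      | succ j ih =>
        intro hj
        rw [Function.iterate_succ_apply']
        exact hZ _ (ih (by omega)) (Nat.find_min hex (by omega))
    have hinj : Set.InjOn (fun j => ρ^[j] z) (Finset.range (Nat.find hex + 1)) := by
      have aux : ∀ i j, i ≤ Nat.find hex → j < i → ρ^[i] z ≠ ρ^[j] z := by
        intro i j hi hji e
        have h1 : ρ^[Nat.find hex - i + j] z = c := by
          rw [Function.iterate_add_apply, ← e, ← Function.iterate_add_apply, Nat.sub_add_cancel hi]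
          exact Nat.find_spec hex
        exact Nat.find_min hex (by omega) h1
      intro i hi j hj e
      simp only [Finset.coe_range, Set.mem_Iio] at hi hj
      rcases lt_trichotomy i j with h | h | h
      · exact absurd e.symm (aux j i (by omega) h)
      · exact h
      · exact absurd e (aux i j (by omega) h)
    have := Finset.card_le_card_of_injOn _ (s := Finset.range (Nat.find hex + 1)) (t := Z)
      (fun j hj => hmem j (by simpa [Nat.lt_succ_iff] using hj)) hinj
    rw [Finset.card_range] at this
    omega
  refine ⟨key z, fun ⟨v, hv, hvz⟩ => ?_⟩
  choose! w hw1 hw2 using key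
  -- The times needed to reach `c` are distinct for distinct points and below `Z.card`, so every
  -- such time occurs.
  have himg : Z.image w = Finset.range Z.card := by
    apply Finset.eq_of_subset_of_card_le
    · intro i hi
      rw [Finset.mem_image] at hi
      obtain ⟨y, hy, rfl⟩ := hi
      exact Finset.mem_range.2 (hw1 y hy)
    · rw [Finset.card_range, Finset.card_image_of_injOn]
      intro x hx y hy e
      have h1 := hw2 x hx
      rw [e, ← hw2 y hy] at h1
      exact hp.injective.iterate _ h1
  have hv' : v ∈ Z.image w := by rw [himg]; exact Finset.mem_range.2 hv
  rw [Finset.mem_image] at hv'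
  obtain ⟨y, hy, rfl⟩ := hv'
  have : z = y := hp.injective.iterate (w y) (hvz.trans (hw2 y hy).symm)
  exact this ▸ hy

theorem surjective_of_semiconj {A : Fin m → Fin m} (hp' : IsPeriodicOrbit ρ' id)
    (hA : Function.Semiconj A ρ ρ') : Function.Surjective A := by
  classical
  have h0 : 0 < m := hp'.1
  have := hp'.eq_univ (S := Finset.univ.image A) (i := A ⟨0, h0⟩) (by simp) (fun j hj => by
    rw [Finset.mem_image] at hj ⊢
    obtain ⟨i, -, rfl⟩ := hj
    exact ⟨ρ i, Finset.mem_univ _, hA i⟩)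
  intro y
  have hy := Finset.mem_univ y
  rw [← this, Finset.mem_image] at hy
  obtain ⟨x, -, hx⟩ := hy
  exact ⟨x, hx⟩

/-- Two cyclic permutations are conjugate by exactly one map that preserves a given set of which
each of them maps all elements but one into the set. -/
theorem existsUnique_conjugation (hp : IsPeriodicOrbit ρ id) (hp' : IsPeriodicOrbit ρ' id)
    {Z : Finset (Fin m)} {c c' : Fin m} (hc : c ∈ Z) (hρc : ρ c ∉ Z)
    (hZ : ∀ z ∈ Z, z ≠ c → ρ z ∈ Z) (hZ' : ∀ z ∈ Z, z ≠ c' → ρ' z ∈ Z) :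
    ∃! A : Fin m → Fin m, Function.Semiconj A ρ ρ' ∧ ∀ z ∈ Z, A z ∈ Z := by
  have hex := fun x => hp.exists_iterate_eq c x
  choose t _ ht using hex
  simp only [id] at ht
  -- A conjugation is determined by the image of one point. Since `Z` consists of the last points
  -- before `c` for `ρ`, and before `c'` for `ρ'`, it is preserved if `c` goes to `c'`.
  refine ⟨fun x => ρ'^[t x] c', ⟨?_, ?_⟩, ?_⟩
  · intro x
    simp only
    rw [← Function.iterate_succ_apply' ρ', hp'.iterate_eq_iff,
      ← hp.iterate_eq_iff c, ht, Function.iterate_succ_apply', ht]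
  · intro z hz
    obtain ⟨v, hv, hvz⟩ := (mem_iff_exists_iterate_eq hp hZ z).1 hz
    refine (mem_iff_exists_iterate_eq hp' hZ' _).2 ⟨v, hv, ?_⟩
    rw [← Function.iterate_add_apply]
    have : ρ^[v + t z] c = ρ^[0] c := by rw [Function.iterate_add_apply, ht, hvz]; rfl
    exact (hp'.iterate_eq_iff c' _ 0).2 ((hp.iterate_eq_iff c _ _).1 this)
  · rintro A ⟨hA, hAZ⟩
    have hinj : Function.Injective A :=
      Finite.injective_iff_surjective.2 (surjective_of_semiconj hp' hA)
    -- Otherwise `A (ρ c) = ρ' (A c)` lies in `Z`; as `A` permutes `Z`, this puts `ρ c` into `Z`.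
    have hAc : A c = c' := by
      by_contra hne
      have h1 : A (ρ c) ∈ Z := by rw [hA.eq]; exact hZ' _ (hAZ c hc) hne
      have himg : Z.image A = Z := Finset.eq_of_subset_of_card_le
        (fun y hy => by
          rw [Finset.mem_image] at hy; obtain ⟨x, hx, rfl⟩ := hy; exact hAZ x hx)
        (by rw [Finset.card_image_of_injective _ hinj])
      rw [← himg, Finset.mem_image] at h1
      obtain ⟨z, hz, e⟩ := h1
      exact hρc (hinj e ▸ hz)
    funext x
    rw [← hAc, ← (hA.iterate_right _).eq, ht]

end Rotation

/-! ### Gluing two permutations -/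

section Gluing

variable {m n k : ℕ}

/-- The middle points of the blocks. -/
def middlePoints (k m : ℕ) : Finset (Fin m) := Finset.univ.filter fun z => z.val % (2 * k + 1) = k

theorem mem_middlePoints {z : Fin m} : z ∈ middlePoints k m ↔ z.val % (2 * k + 1) = k := by
  simp [middlePoints]

theorem IsCenteredSimple.existsUnique_conjugation {ρ ρ' : Fin m → Fin m}
    (h : IsCenteredSimple k n ρ) (h' : IsCenteredSimple k n ρ') :
    ∃! A : Fin m → Fin m, Function.Semiconj A ρ ρ' ∧
      ∀ z ∈ middlePoints k m, A z ∈ middlePoints k m := by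
  obtain ⟨c, hc, hρc, hZ⟩ := h.special
  obtain ⟨c', -, -, hZ'⟩ := h'.special
  refine _root_.existsUnique_conjugation h.periodic h'.periodic (c := c) (c' := c')
    ?_ ?_ ?_ ?_ <;> simpa only [mem_middlePoints]

/-- The map that interchanges the halves of `{0, …, m - 1}` by `A` and `B`. -/
def glueHalves (A B : Fin (m / 2) → Fin (m / 2)) (x : Fin m) : Fin m :=
  if h : x.val < m / 2 then rightHalf id (A ⟨x, h⟩)
  else if h' : x.val - m / 2 < m / 2 then leftHalf id (B ⟨x.val - m / 2, h'⟩) else x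

variable {A B ρ ρ' : Fin (m / 2) → Fin (m / 2)} {σ : Fin m → Fin m}

theorem glueHalves_left (i : Fin (m / 2)) :
    glueHalves A B (leftHalf id i) = rightHalf id (A i) := by
  unfold glueHalves
  rw [dif_pos (show (leftHalf id i : Fin m).val < m / 2 from i.2)]
  rfl

theorem glueHalves_right (i : Fin (m / 2)) :
    glueHalves A B (rightHalf id i) = leftHalf id (B i) := by
  have hi : (rightHalf id i : Fin m).val = i.val + m / 2 := rfl
  unfold glueHalves
  rw [dif_neg (by omega), dif_pos (by omega)]
  congr 2
  rw [Fin.ext_iff]; simp only [hi]; omega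

theorem left_or_right (hm : Even m) (x : Fin m) :
    (∃ i, x = leftHalf id i) ∨ ∃ i, x = rightHalf id i := by
  obtain ⟨r, hr⟩ := hm
  by_cases h : x.val < m / 2
  · exact Or.inl ⟨⟨x, h⟩, rfl⟩
  · refine Or.inr ⟨⟨x.val - m / 2, by omega⟩, Fin.ext ?_⟩
    simp only [rightHalf, id]; omega

theorem leftHalf_id_injective : Function.Injective (leftHalf (id : Fin m → Fin m)) :=
  (leftHalf_strictMono strictMono_id).injective

theorem rightHalf_id_injective : Function.Injective (rightHalf (id : Fin m → Fin m)) :=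
  (rightHalf_strictMono strictMono_id).injective

theorem leftHalf_ne_rightHalf (i j : Fin (m / 2)) :
    leftHalf (id : Fin m → Fin m) i ≠ rightHalf id j := by
  rw [Ne, Fin.ext_iff]; simp only [leftHalf, rightHalf, id]; omega

theorem leftHalf_mem_middlePoints {i : Fin (m / 2)} :
    leftHalf id i ∈ middlePoints k m ↔ i ∈ middlePoints k (m / 2) := by
  rw [mem_middlePoints, mem_middlePoints]; rfl

theorem rightHalf_mem_middlePoints (hm : m = 2 ^ (n + 1) * (2 * k + 1)) {i : Fin (m / 2)} :
    rightHalf id i ∈ middlePoints k m ↔ i ∈ middlePoints k (m / 2) := by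
  rw [mem_middlePoints, mem_middlePoints]
  have : (rightHalf id i : Fin m).val = i.val + 2 ^ n * (2 * k + 1) := by
    rw [← half_length hm]; rfl
  rw [this, Nat.add_mul_mod_self_right]

theorem semiconj_leftHalf_glueHalves (hBA : ∀ i, B (A i) = ρ i) :
    Function.Semiconj (leftHalf id) ρ (glueHalves A B)^[2] := fun i => by
  rw [Function.iterate_succ_apply, Function.iterate_one, glueHalves_left, glueHalves_right, hBA]

theorem semiconj_rightHalf_glueHalves (hAB : ∀ i, A (B i) = ρ' i) :
    Function.Semiconj (rightHalf id) ρ' (glueHalves A B)^[2] := fun i => by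
  rw [Function.iterate_succ_apply, Function.iterate_one, glueHalves_right, glueHalves_left, hAB]

theorem isPeriodicOrbit_glueHalves (hm : Even m) (hBA : ∀ i, B (A i) = ρ i)
    (hρ : IsPeriodicOrbit ρ id) : IsPeriodicOrbit (glueHalves A B : Fin m → Fin m) id := by
  have h0 := hρ.1
  obtain ⟨r, hr⟩ := hm
  refine isPeriodicOrbit_of_mem_range (by omega) strictMono_id (fun i => ⟨_, rfl⟩)
    (leftHalf id ⟨0, h0⟩) ?_
  have hs := semiconj_leftHalf_glueHalves (m := m) hBA
  have h2 : Function.minimalPeriod (glueHalves A B)^[2] (leftHalf id ⟨0, h0⟩ : Fin m) = m / 2 :=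
    (minimalPeriod_eq_of_semiconj leftHalf_id_injective hs _).trans (hρ.minimalPeriod_eq ⟨0, h0⟩)
  rw [id]
  rcases minimalPeriod_iterate_two (glueHalves A B) (leftHalf id ⟨0, h0⟩ : Fin m) with
    ⟨-, h⟩ | ⟨⟨j, hj⟩, -⟩
  · rw [h, h2]; omega
  · exfalso
    have e := Function.isPeriodicPt_minimalPeriod (glueHalves A B) (leftHalf id ⟨0, h0⟩ : Fin m)
    rw [hj] at e
    replace e := (Function.iterate_succ_apply' _ _ _).symm.trans e.eq
    rw [Function.iterate_mul, ← (hs.iterate_right j).eq,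
      glueHalves_left] at e
    exact leftHalf_ne_rightHalf _ _ e.symm

theorem isSimpleOrbit_glueHalves (hm : Even m) (hBA : ∀ i, B (A i) = ρ i)
    (hAB : ∀ i, A (B i) = ρ' i) (hρ : IsSimpleOrbit n ρ id) (hρ' : IsSimpleOrbit n ρ' id) :
    IsSimpleOrbit (n + 1) (glueHalves A B : Fin m → Fin m) id :=
  ⟨⟨hm, fun i => ⟨_, (glueHalves_left i).symm⟩, fun i => ⟨_, (glueHalves_right i).symm⟩⟩,
    (isSimpleOrbit_comp_iff leftHalf_id_injective (semiconj_leftHalf_glueHalves hBA)).2 hρ,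
    (isSimpleOrbit_comp_iff rightHalf_id_injective (semiconj_rightHalf_glueHalves hAB)).2 hρ'⟩

theorem even_of_length (hm : m = 2 ^ (n + 1) * (2 * k + 1)) : Even m :=
  ⟨2 ^ n * (2 * k + 1), by rw [hm, pow_succ]; ring⟩

/-- If `A` preserves middle points, it permutes them, and `B (A z) = ρ z` shows that `A c` is the
only special one, where `c` is special for `ρ`. -/
theorem isCenteredSimple_glueHalves_left (hm : m = 2 ^ (n + 1) * (2 * k + 1))
    (hρ : IsCenteredSimple k n ρ) (hρ' : IsCenteredSimple k n ρ') (hBA : ∀ i, B (A i) = ρ i)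
    (hAB : ∀ i, A (B i) = ρ' i) (hA : ∀ z ∈ middlePoints k (m / 2), A z ∈ middlePoints k (m / 2)) :
    IsCenteredSimple k (n + 1) (glueHalves A B : Fin m → Fin m) := by
  have hme := even_of_length hm
  refine ⟨hm, isPeriodicOrbit_glueHalves hme hBA hρ.periodic,
    isSimpleOrbit_glueHalves hme hBA hAB hρ.simple hρ'.simple, ?_⟩
  obtain ⟨c, hc, hρc, hZ⟩ := hρ.special
  simp only [Ne, ← mem_middlePoints] at hc hρc hZ ⊢
  refine ⟨rightHalf id (A c), (rightHalf_mem_middlePoints hm).2 (hA c hc), ?_, fun z hz hzc => ?_⟩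
  · rw [glueHalves_right, hBA, leftHalf_mem_middlePoints]; exact hρc
  rcases left_or_right hme z with ⟨i, rfl⟩ | ⟨i, rfl⟩
  · rw [leftHalf_mem_middlePoints] at hz
    rw [glueHalves_left, rightHalf_mem_middlePoints hm]
    exact hA i hz
  · rw [rightHalf_mem_middlePoints hm] at hz
    have hsurj : Function.Surjective A := fun y => by
      obtain ⟨x, rfl⟩ := (Finite.injective_iff_surjective.1 hρ'.periodic.injective) y
      exact ⟨B x, hAB x⟩
    have himg : (middlePoints k (m / 2)).image A = middlePoints k (m / 2) :=
      Finset.eq_of_subset_of_card_le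
        (fun y hy => by
          rw [Finset.mem_image] at hy; obtain ⟨x, hx, rfl⟩ := hy; exact hA x hx)
        (by rw [Finset.card_image_of_injective _ (Finite.injective_iff_surjective.2 hsurj)])
    rw [← himg, Finset.mem_image] at hz
    obtain ⟨y, hy, rfl⟩ := hz
    rw [glueHalves_right, hBA, leftHalf_mem_middlePoints]
    exact hZ y hy fun e => hzc (by rw [e])

theorem isCenteredSimple_glueHalves_right (hm : m = 2 ^ (n + 1) * (2 * k + 1))
    (hρ : IsCenteredSimple k n ρ) (hρ' : IsCenteredSimple k n ρ') (hBA : ∀ i, B (A i) = ρ i)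
    (hAB : ∀ i, A (B i) = ρ' i) (hB : ∀ z ∈ middlePoints k (m / 2), B z ∈ middlePoints k (m / 2)) :
    IsCenteredSimple k (n + 1) (glueHalves A B : Fin m → Fin m) := by
  have hme := even_of_length hm
  refine ⟨hm, isPeriodicOrbit_glueHalves hme hBA hρ.periodic,
    isSimpleOrbit_glueHalves hme hBA hAB hρ.simple hρ'.simple, ?_⟩
  obtain ⟨c, hc, hρc, hZ⟩ := hρ'.special
  simp only [Ne, ← mem_middlePoints] at hc hρc hZ ⊢
  refine ⟨leftHalf id (B c), leftHalf_mem_middlePoints.2 (hB c hc), ?_, fun z hz hzc => ?_⟩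
  · rw [glueHalves_left, hAB, rightHalf_mem_middlePoints hm]; exact hρc
  rcases left_or_right hme z with ⟨i, rfl⟩ | ⟨i, rfl⟩
  · rw [leftHalf_mem_middlePoints] at hz
    have hsurj : Function.Surjective B := fun y => by
      obtain ⟨x, rfl⟩ := (Finite.injective_iff_surjective.1 hρ.periodic.injective) y
      exact ⟨A x, hBA x⟩
    have himg : (middlePoints k (m / 2)).image B = middlePoints k (m / 2) :=
      Finset.eq_of_subset_of_card_le
        (fun y hy => by
          rw [Finset.mem_image] at hy; obtain ⟨x, hx, rfl⟩ := hy; exact hB x hx)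
        (by rw [Finset.card_image_of_injective _ (Finite.injective_iff_surjective.2 hsurj)])
    rw [← himg, Finset.mem_image] at hz
    obtain ⟨y, hy, rfl⟩ := hz
    rw [glueHalves_left, hAB, rightHalf_mem_middlePoints hm]
    exact hZ y hy fun e => hzc (by rw [e])
  · rw [rightHalf_mem_middlePoints hm] at hz
    rw [glueHalves_right, leftHalf_mem_middlePoints]
    exact hB i hz

/-- The centered simple permutations with given squares on the two halves. -/
def centeredSimpleFrom (k n : ℕ) {m : ℕ} (ρ ρ' : Fin (m / 2) → Fin (m / 2)) :
    Set (Fin m → Fin m) :=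
  {σ | IsCenteredSimple k (n + 1) σ ∧ Function.Semiconj (leftHalf id) ρ σ^[2] ∧
    Function.Semiconj (rightHalf id) ρ' σ^[2]}

theorem exists_eq_glueHalves (h : σ ∈ centeredSimpleFrom k n ρ ρ') :
    ∃ A B, σ = glueHalves A B ∧ (∀ i, B (A i) = ρ i) ∧ ∀ i, A (B i) = ρ' i := by
  obtain ⟨hσ, hl, hr⟩ := h
  obtain ⟨⟨hme, h1, h2⟩, -, -⟩ := hσ.simple
  choose A hA using h1
  choose B hB using h2
  have e : σ = glueHalves A B := by
    funext x
    rcases left_or_right hme x with ⟨i, rfl⟩ | ⟨i, rfl⟩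
    · rw [glueHalves_left, hA]
    · rw [glueHalves_right, hB]
  refine ⟨A, B, e, fun i => ?_, fun i => ?_⟩
  · apply leftHalf_id_injective (m := m)
    rw [hl i, e]
    exact semiconj_leftHalf_glueHalves (m := m) (fun _ => rfl) i
  · apply rightHalf_id_injective (m := m)
    rw [hr i, e]
    exact semiconj_rightHalf_glueHalves (m := m) (fun _ => rfl) i

/-- `A` is the conjugation preserving middle points, and `B = ρ ∘ A⁻¹` is then forced. -/
theorem IsCenteredSimple.exists_conjugate_pair {h : ℕ} {ρ ρ' : Fin h → Fin h}
    (hρ : IsCenteredSimple k n ρ) (hρ' : IsCenteredSimple k n ρ') :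
    ∃ A B : Fin h → Fin h, (∀ i, B (A i) = ρ i) ∧ (∀ i, A (B i) = ρ' i) ∧
      ∀ z ∈ middlePoints k h, A z ∈ middlePoints k h := by
  obtain ⟨A, ⟨hA, hAZ⟩, -⟩ := hρ.existsUnique_conjugation hρ'
  have hs := surjective_of_semiconj hρ'.periodic hA
  have hi : Function.Injective A := Finite.injective_iff_surjective.2 hs
  refine ⟨A, fun i => ρ (Function.surjInv hs i), fun i => ?_, fun i => ?_, hAZ⟩
  · exact congrArg ρ (hi (Function.surjInv_eq hs (A i)))
  · simp only
    rw [hA.eq, Function.surjInv_eq hs]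

/-- There are exactly two centered simple permutations with given squares on the two halves. -/
theorem ncard_centeredSimpleFrom (hm : m = 2 ^ (n + 1) * (2 * k + 1))
    (hρ : IsCenteredSimple k n ρ) (hρ' : IsCenteredSimple k n ρ') :
    (centeredSimpleFrom k n ρ ρ' : Set (Fin m → Fin m)).ncard = 2 := by
  obtain ⟨A₁, B₁, hBA₁, hAB₁, hA₁⟩ := hρ.exists_conjugate_pair hρ'
  obtain ⟨B₂, A₂, hAB₂, hBA₂, hB₂⟩ := hρ'.exists_conjugate_pair hρ
  have hsemi : ∀ {A B ρ ρ' : Fin (m / 2) → Fin (m / 2)}, (∀ i, B (A i) = ρ i) →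
      (∀ i, A (B i) = ρ' i) → Function.Semiconj A ρ ρ' := fun h h' i => by rw [← h, ← h']
  -- If both maps between the halves preserved middle points, so would their composite `ρ`.
  have hne : (glueHalves A₁ B₁ : Fin m → Fin m) ≠ glueHalves A₂ B₂ := by
    intro e
    have hAA : ∀ i, A₁ i = A₂ i := fun i => by
      have := congrFun e (leftHalf id i)
      rw [glueHalves_left, glueHalves_left] at this
      exact rightHalf_id_injective this
    obtain ⟨c, hc, hρc, -⟩ := hρ.special
    rw [← mem_middlePoints] at hc
    rw [Ne, ← mem_middlePoints, ← hBA₂, ← hAA] at hρc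
    exact hρc (hB₂ _ (hA₁ _ hc))
  have hset : (centeredSimpleFrom k n ρ ρ' : Set (Fin m → Fin m)) =
      {glueHalves A₁ B₁, glueHalves A₂ B₂} := by
    ext σ
    rw [Set.mem_insert_iff, Set.mem_singleton_iff]
    constructor
    · intro h
      obtain ⟨A, B, rfl, hBA, hAB⟩ := exists_eq_glueHalves h
      obtain ⟨c, hc, -, hZ⟩ := h.1.special
      simp only [← mem_middlePoints] at hc hZ
      -- The half without the special point is mapped middle points to middle points, which
      -- determines the map on it and hence also the map back.
      rcases left_or_right (even_of_length hm) c with ⟨i, rfl⟩ | ⟨i, rfl⟩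
      · right
        have hB : ∀ z ∈ middlePoints k (m / 2), B z ∈ middlePoints k (m / 2) := fun z hz => by
          have := hZ (rightHalf id z) ((rightHalf_mem_middlePoints hm).2 hz)
            (leftHalf_ne_rightHalf _ _).symm
          rwa [glueHalves_right, leftHalf_mem_middlePoints] at this
        obtain rfl : B = B₂ := (hρ'.existsUnique_conjugation hρ).unique ⟨hsemi hAB hBA, hB⟩
          ⟨hsemi hAB₂ hBA₂, hB₂⟩
        have hs := surjective_of_semiconj hρ.periodic (hsemi hAB hBA)
        obtain rfl : A = A₂ := funext fun i => by
          obtain ⟨j, rfl⟩ := hs i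
          rw [hAB, hAB₂]
        rfl
      · left
        have hA : ∀ z ∈ middlePoints k (m / 2), A z ∈ middlePoints k (m / 2) := fun z hz => by
          have := hZ (leftHalf id z) (leftHalf_mem_middlePoints.2 hz) (leftHalf_ne_rightHalf _ _)
          rwa [glueHalves_left, rightHalf_mem_middlePoints hm] at this
        obtain rfl : A = A₁ := (hρ.existsUnique_conjugation hρ').unique ⟨hsemi hBA hAB, hA⟩
          ⟨hsemi hBA₁ hAB₁, hA₁⟩
        have hs := surjective_of_semiconj hρ'.periodic (hsemi hBA hAB)
        obtain rfl : B = B₁ := funext fun i => by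
          obtain ⟨j, rfl⟩ := hs i
          rw [hBA, hBA₁]
        rfl
    · rintro (rfl | rfl)
      · exact ⟨isCenteredSimple_glueHalves_left hm hρ hρ' hBA₁ hAB₁ hA₁,
          semiconj_leftHalf_glueHalves hBA₁, semiconj_rightHalf_glueHalves hAB₁⟩
      · exact ⟨isCenteredSimple_glueHalves_right hm hρ hρ' hBA₂ hAB₂ hB₂,
          semiconj_leftHalf_glueHalves hBA₂, semiconj_rightHalf_glueHalves hAB₂⟩
  rw [hset, Set.ncard_pair hne]

end Gluing

/-! ### Transfer to an arbitrary interval -/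

section Interval

variable {m n k : ℕ} {σ : Fin m → Fin m}

theorem IsCenteredSimple.pos (h : IsCenteredSimple k n σ) : 0 < m := h.periodic.1

theorem IsCenteredSimple.three_le (h : IsCenteredSimple k n σ) (hk : 0 < k) : 3 ≤ m := by
  rw [h.length]; nlinarith [Nat.one_le_two_pow (n := n)]

/-- Every centered simple permutation is realized by a minimal orbit in every interval. -/
theorem IsCenteredSimple.exists_isMinimalOrbit (h : IsCenteredSimple k n σ) (hk : 0 < k)
    {I : Set ℝ} (hI : I.OrdConnected) (hI' : I.Nontrivial) :
    ∃ (f : I → I) (β : Fin m → I), Continuous f ∧ IsMinimalOrbit f β ∧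
      Function.Semiconj β σ f := by
  obtain ⟨a, ha, b, hb, hab⟩ := hI'.exists_lt
  have hm3 := h.three_le hk
  have hM : (0 : ℝ) < ((m - 1 : ℕ) : ℝ) := by exact_mod_cast (by omega : 0 < m - 1)
  set M : ℝ := ((m - 1 : ℕ) : ℝ) with hMdef
  have hba : 0 < b - a := sub_pos.2 hab
  have hmem : ∀ t ∈ Set.Icc (0 : ℝ) M, a + (b - a) / M * t ∈ I := by
    intro t ht
    refine hI.out ha hb ⟨?_, ?_⟩
    · have : 0 ≤ (b - a) / M * t := mul_nonneg (div_pos hba hM).le ht.1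
      linarith
    · have : (b - a) / M * t ≤ (b - a) / M * M :=
        mul_le_mul_of_nonneg_left ht.2 (div_pos hba hM).le
      rw [div_mul_cancel₀ _ hM.ne'] at this
      linarith
  have hval : ∀ i : Fin m, (i.val : ℝ) ∈ Set.Icc (0 : ℝ) M := fun i =>
    ⟨Nat.cast_nonneg _, by rw [hMdef]; exact_mod_cast (by omega : i.val ≤ m - 1)⟩
  -- The affine coordinate is used on all of `I`. Since the connect-the-dots map has values in `[0,
  -- M]`, the transported map sends `I` into `[a, b]`, and the injective semiconjugacy holds
  -- everywhere.
  let ψ : I → ℝ := fun x => (x - a) * M / (b - a)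
  have hψ : ∀ t (ht : t ∈ Set.Icc (0 : ℝ) M), ψ ⟨a + (b - a) / M * t, hmem t ht⟩ = t := by
    intro t ht
    simp only [ψ]
    field_simp
    ring
  have hψi : Function.Injective ψ := by
    intro x y e
    simp only [ψ] at e
    rw [div_left_inj' hba.ne', mul_left_inj' hM.ne'] at e
    exact Subtype.ext (by linarith)
  let f : I → I := fun x =>
    ⟨a + (b - a) / M * dotMap σ (ψ x), hmem _ (dotMap_mem_Icc h.pos _)⟩
  let β : Fin m → I := fun i => ⟨a + (b - a) / M * i.val, hmem _ (hval i)⟩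
  have hs : Function.Semiconj ψ f (dotMap σ) := fun x =>
    hψ _ (dotMap_mem_Icc h.pos _)
  have hψβ : ∀ i, ψ (β i) = i.val := fun i => hψ _ (hval i)
  refine ⟨f, β, ?_, (h.isMinimalOrbit_dotMap hk).of_semiconj hψi hs ?_ ?_, ?_⟩
  · refine Continuous.subtype_mk ?_ _
    have : Continuous ψ := by simp only [ψ]; fun_prop
    exact continuous_const.add (continuous_const.mul ((continuous_dotMap).comp this))
  · intro i j hij
    have : (i.val : ℝ) < j.val := by exact_mod_cast hij
    have := mul_lt_mul_of_pos_left this (div_pos hba hM)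
    exact Subtype.mk_lt_mk.2 (by linarith)
  · congr 1
    funext i
    exact hψβ i
  · intro i
    apply hψi
    rw [hψβ, hs.eq, hψβ]
    exact semiconj_dotMap i

/-- A nonempty order connected set of reals is itself a conditionally complete order, so the
covering arguments apply inside `I`. -/
theorem IsMinimalOrbit.exists_isCenteredSimple {I : Set ℝ} (hI : I.OrdConnected)
    {f : I → I} {β : Fin m → I} (h : IsMinimalOrbit f β) (hf : Continuous f) (hk : 1 < k)
    (hm : m = 2 ^ n * (2 * k + 1)) : ∃ σ, Function.Semiconj β σ f ∧ IsCenteredSimple k n σ := by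
  obtain ⟨σ, hσ⟩ := h.1.exists_semiconj
  have := hI
  let _ : Inhabited I := ⟨β ⟨0, h.1.1⟩⟩
  let _ := ordConnectedSubsetConditionallyCompleteLinearOrder I
  exact ⟨σ, hσ, h.isCenteredSimple hf hk hm hσ⟩

theorem IsMinimalOrbit.halves_of_ordConnected {I : Set ℝ} (hI : I.OrdConnected)
    {f : I → I} {β : Fin m → I} (h : IsMinimalOrbit f β) (hf : Continuous f) (hk : 1 < k)
    (hm : m = 2 ^ (n + 1) * (2 * k + 1)) :
    SwapsHalves f β ∧ IsMinimalOrbit f^[2] (_root_.leftHalf β) ∧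
      IsMinimalOrbit f^[2] (_root_.rightHalf β) := by
  have := hI
  let _ : Inhabited I := ⟨β ⟨0, h.1.1⟩⟩
  let _ := ordConnectedSubsetConditionallyCompleteLinearOrder I
  have hq : Odd (2 * k + 1) := odd_two_mul_add_one k
  exact ⟨h.swapsHalves hf hm hq (by omega), h.leftHalf hf hm hq (by omega),
    h.rightHalf hf hm hq (by omega)⟩

end Interval

/-! ### Counting centered simple permutations -/

section Permutations

variable {m n k : ℕ} {σ : Fin m → Fin m}

theorem semiconj_leftHalf_iff {X : Type*} {f : X → X} {β : Fin m → X} {ρ : Fin (m / 2) → Fin (m / 2)}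
    (hβ : Function.Injective β) (hσ : Function.Semiconj β σ f) :
    Function.Semiconj (leftHalf β) ρ f^[2] ↔ Function.Semiconj (leftHalf id) ρ σ^[2] :=
  forall_congr' fun i => by
    rw [← hβ.eq_iff, (hσ.iterate_right 2).eq]; rfl

theorem semiconj_rightHalf_iff {X : Type*} {f : X → X} {β : Fin m → X}
    {ρ : Fin (m / 2) → Fin (m / 2)} (hβ : Function.Injective β) (hσ : Function.Semiconj β σ f) :
    Function.Semiconj (rightHalf β) ρ f^[2] ↔ Function.Semiconj (rightHalf id) ρ σ^[2] :=
  forall_congr' fun i => by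
    rw [← hβ.eq_iff, (hσ.iterate_right 2).eq]; rfl

/-- The argument goes through dynamics: the connect-the-dots map realizes `σ` by a minimal orbit,
the halves of that orbit are minimal for the second iterate, and minimal orbits are centered. -/
theorem IsCenteredSimple.exists_halves (h : IsCenteredSimple k (n + 1) σ) (hk : 1 < k) :
    ∃ ρ ρ', IsCenteredSimple k n ρ ∧ IsCenteredSimple k n ρ' ∧
      σ ∈ centeredSimpleFrom k n ρ ρ' := by
  have hmin := h.isMinimalOrbit_dotMap (by omega)
  have hf : Continuous (dotMap σ) := continuous_dotMap
  have hq : Odd (2 * k + 1) := odd_two_mul_add_one k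
  have hl := hmin.leftHalf hf h.length hq (by omega)
  have hr := hmin.rightHalf hf h.length hq (by omega)
  obtain ⟨ρ, hρ⟩ := hl.1.exists_semiconj
  obtain ⟨ρ', hρ'⟩ := hr.1.exists_semiconj
  exact ⟨ρ, ρ', hl.isCenteredSimple (hf.iterate 2) hk (half_length h.length) hρ,
    hr.isCenteredSimple (hf.iterate 2) hk (half_length h.length) hρ', h,
    (semiconj_leftHalf_iff hmin.1.2.1.injective semiconj_dotMap).1 hρ,
    (semiconj_rightHalf_iff hmin.1.2.1.injective semiconj_dotMap).1 hρ'⟩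

/-- The mirror image of a self-map of `{0, …, m - 1}`. -/
def mirror (σ : Fin m → Fin m) : Fin m → Fin m := fun x => (σ x.rev).rev

theorem mirror_mirror : mirror (mirror σ) = σ := by
  funext x; simp [mirror]

theorem cast_rev (i : Fin m) : (i.rev.val : ℝ) = ((m - 1 : ℕ) : ℝ) - i.val := by
  rw [Fin.val_rev, ← Nat.cast_sub (by omega)]
  congr 1
  omega

/-- Reflecting the connect-the-dots map in the real line gives a minimal orbit with the mirrored
permutation. -/
theorem IsCenteredSimple.mirror (h : IsCenteredSimple k n σ) (hk : 1 < k) :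
    IsCenteredSimple k n (mirror σ) := by
  set M : ℝ := ((m - 1 : ℕ) : ℝ) with hM
  let g : ℝ → ℝ := fun x => M - dotMap σ (M - x)
  have hg : Continuous g :=
    continuous_const.sub (continuous_dotMap.comp (continuous_const.sub continuous_id))
  have hmin : IsMinimalOrbit g (fun x : Fin m => (x.val : ℝ)) := by
    refine (h.isMinimalOrbit_dotMap (by omega)).of_semiconj (φ := fun x => M - x)
      sub_right_injective (fun x => sub_sub_cancel _ _) (fun i j hij => ?_) ?_
    · exact Nat.cast_lt.2 hij
    · have : (fun x => M - x) ∘ (fun x : Fin m => (x.val : ℝ)) =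
          (fun x : Fin m => (x.val : ℝ)) ∘ Fin.rev := by
        funext i; exact (cast_rev i).symm
      rw [this, Fin.rev_surjective.range_comp]
  refine hmin.isCenteredSimple hg hk h.length fun i => ?_
  change ((σ i.rev).rev.val : ℝ) = M - dotMap σ (M - i.val)
  rw [cast_rev, hM, ← cast_rev i]
  exact congrArg _ (semiconj_dotMap i.rev)

theorem rev_mod {x : Fin m} (hm : m = 2 ^ n * (2 * k + 1)) (hx : x.val % (2 * k + 1) = k) :
    x.rev.val % (2 * k + 1) = k := by
  have h1 := Nat.div_add_mod x.val (2 * k + 1)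
  rw [hx] at h1
  have h2 : x.val / (2 * k + 1) < 2 ^ n :=
    Nat.div_lt_of_lt_mul (by rw [mul_comm, ← hm]; exact x.2)
  obtain ⟨e, he⟩ := Nat.exists_eq_add_of_lt h2
  have h3 : x.rev.val = k + (2 * k + 1) * e := by
    rw [Fin.val_rev]
    rw [he] at hm
    have : m = (2 * k + 1) * (x.val / (2 * k + 1)) + (2 * k + 1) * e + (2 * k + 1) :=
      hm.trans (by ring)
    omega
  rw [h3, Nat.add_mul_mod_self_left, Nat.mod_eq_of_lt (by omega)]

/-- A symmetric `σ` commutes with the reflection, so its unique special point `c` is fixed by the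
reflection. Then `σ c` is fixed as well and equals `c`, which is absurd for a special point. -/
theorem IsCenteredSimple.mirror_ne (h : IsCenteredSimple k n σ) : _root_.mirror σ ≠ σ := by
  intro e
  obtain ⟨c, hc, hσc, hZ⟩ := h.special
  have h1 : σ c.rev = (σ c).rev := by
    have := congrFun e c.rev
    simp only [_root_.mirror, Fin.rev_rev] at this
    exact this.symm
  by_cases hcc : c.rev = c
  · rw [hcc] at h1
    have h2 : σ c = c := by
      rw [Fin.ext_iff, Fin.val_rev] at h1 hcc
      rw [Fin.ext_iff]
      omega
    rw [h2] at hσc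
    exact hσc hc
  · have h2 := hZ _ (rev_mod h.length hc) hcc
    rw [h1] at h2
    have h3 := rev_mod h.length h2
    rw [Fin.rev_rev] at h3
    exact hσc h3

/-- The Štefan permutation of `{0, …, 2k}` that maps the middle point to the right. -/
def stefanPerm (k : ℕ) (hm : m = 2 * k + 1) (x : Fin m) : Fin m :=
  if h0 : x.val = 0 then ⟨k, by omega⟩
  else if h : x.val ≤ k then ⟨2 * k + 1 - x.val, by omega⟩ else ⟨2 * k - x.val, by omega⟩

theorem isStefanOrbit_stefanPerm (hm : m = 2 * k + 1) : IsStefanOrbit (stefanPerm k hm) id := by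
  refine ⟨k, hm, Or.inl ⟨?_, fun j hj => ?_, fun j hj => ?_⟩⟩ <;>
  · simp only [id, stefanPerm, Fin.ext_iff]
    split_ifs <;> simp only <;> first | contradiction | omega

theorem isCenteredSimple_stefanPerm (hk : 0 < k) (hm : m = 2 * k + 1) :
    IsCenteredSimple k 0 (stefanPerm k hm) := by
  have hs := isStefanOrbit_stefanPerm hm
  have hkm : k < m := by omega
  refine ⟨by omega, ?_, hs, ⟨k, hkm⟩, Nat.mod_eq_of_lt (by omega), ?_, fun z hz hzk => ?_⟩
  · obtain ⟨h0, hper, hpos⟩ := hs.stefanAt hm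
    simp only [id, one_mul, Nat.zero_add] at hper hpos
    refine isPeriodicOrbit_of_mem_range (by omega) strictMono_id (fun i => ⟨_, rfl⟩) ⟨k, hkm⟩ ?_
    rw [id]
    have hp : Function.IsPeriodicPt (stefanPerm k hm) (2 * k + 1) ⟨k, hkm⟩ := hper
    refine (le_antisymm (hp.minimalPeriod_le (by omega)) ?_).trans hm.symm
    by_contra! hlt
    have h1 : 0 < Function.minimalPeriod (stefanPerm k hm) ⟨k, hkm⟩ :=
      hp.minimalPeriod_pos (by omega)
    have h2 := (Function.isPeriodicPt_minimalPeriod (stefanPerm k hm) ⟨k, hkm⟩).eq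
    generalize Function.minimalPeriod (stefanPerm k hm) ⟨k, hkm⟩ = p at *
    rcases hpos with hpos | hpos
    · rw [hpos p (by omega), Fin.ext_iff] at h2
      simp only [stefanPos] at h2
      split_ifs at h2 <;> omega
    · rw [hpos p (by omega), Fin.ext_iff] at h2
      simp only [stefanPos] at h2
      split_ifs at h2 <;> omega
  · have : (stefanPerm k hm ⟨k, hkm⟩).val = k + 1 := by
      simp only [stefanPerm]
      split_ifs <;> simp only at * <;> omega
    rw [this, Nat.mod_eq_of_lt (by omega)]
    omega
  · rw [Nat.mod_eq_of_lt (by omega)] at hz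
    exact absurd (Fin.ext hz) hzk

theorem eq_stefanPerm_or_mirror (hm : m = 2 * k + 1) (h : IsStefanOrbit σ id) :
    σ = stefanPerm k hm ∨ σ = mirror (stefanPerm k hm) := by
  obtain ⟨k', hk', h⟩ := h
  obtain rfl : k = k' := by omega
  simp only [id, Fin.ext_iff] at h
  refine h.imp (fun ⟨h0, h1, h2⟩ => funext fun x => Fin.ext ?_)
    fun ⟨h0, h1, h2⟩ => funext fun x => Fin.ext ?_
  · simp only [stefanPerm]
    split_ifs with hx hxk
    · have e : x = ⟨0, by omega⟩ := Fin.ext hx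
      rw [e, h0]
    · have := h1 (k - x.val) (by omega)
      have e : (⟨k - (k - x.val), by omega⟩ : Fin m) = x := Fin.ext (by simp only; omega)
      rw [e] at this
      rw [this]; simp only; omega
    · have := h2 (x.val - k - 1) (by omega)
      have e : (⟨k + (x.val - k - 1 + 1), by omega⟩ : Fin m) = x := Fin.ext (by simp only; omega)
      rw [e] at this
      rw [this]; simp only; omega
  · simp only [mirror, stefanPerm, Fin.val_rev]
    split_ifs with hx hxk
    · have e : x = ⟨2 * k, by omega⟩ := Fin.ext (by simp only; omega)
      rw [e, h0]; simp only; omega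
    · have := h1 (x.val - k) (by omega)
      have e : (⟨k + (x.val - k), by omega⟩ : Fin m) = x := Fin.ext (by simp only; omega)
      rw [e] at this
      rw [this]; simp only; omega
    · have := h2 (k - x.val - 1) (by omega)
      have e : (⟨k - (k - x.val - 1 + 1), by omega⟩ : Fin m) = x := Fin.ext (by simp only; omega)
      rw [e] at this
      rw [this]; simp only; omega

theorem ncard_isCenteredSimple_zero (hk : 1 < k) (hm : m = 2 * k + 1) :
    {σ : Fin m → Fin m | IsCenteredSimple k 0 σ}.ncard = 2 := by
  have h := isCenteredSimple_stefanPerm (by omega) hm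
  have hset : {σ : Fin m → Fin m | IsCenteredSimple k 0 σ} =
      {stefanPerm k hm, mirror (stefanPerm k hm)} := by
    ext σ
    refine ⟨fun hσ => eq_stefanPerm_or_mirror hm hσ.simple, ?_⟩
    rintro (rfl | rfl)
    exacts [h, h.mirror hk]
  rw [hset, Set.ncard_pair h.mirror_ne.symm]

theorem eq_of_mem_centeredSimpleFrom {ρ₁ ρ₁' ρ₂ ρ₂' : Fin (m / 2) → Fin (m / 2)}
    (h₁ : σ ∈ centeredSimpleFrom k n ρ₁ ρ₁') (h₂ : σ ∈ centeredSimpleFrom k n ρ₂ ρ₂') :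
    ρ₁ = ρ₂ ∧ ρ₁' = ρ₂' :=
  ⟨funext fun i => leftHalf_id_injective ((h₁.2.1 i).trans (h₂.2.1 i).symm),
    funext fun i => rightHalf_id_injective ((h₁.2.2 i).trans (h₂.2.2 i).symm)⟩

/-- Each ordered pair of permutations of the halves contributes exactly two, and different pairs
contribute different ones. Starting from the two Štefan orbits, the exponent `e` of `2` becomes `2e
+ 1` at each level. -/
theorem ncard_isCenteredSimple (hk : 1 < k) : ∀ (n : ℕ) {m : ℕ}, m = 2 ^ n * (2 * k + 1) →
    {σ : Fin m → Fin m | IsCenteredSimple k n σ}.ncard = 2 ^ (2 ^ (n + 1) - 1) := by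
  classical
  intro n
  induction n with
  | zero => intro m hm; exact ncard_isCenteredSimple_zero hk (by omega)
  | succ n ih =>
    intro m hm
    have ih := ih (half_length hm)
    set S : Finset (Fin (m / 2) → Fin (m / 2)) := Finset.univ.filter (IsCenteredSimple k n ·)
    have hS : (S : Set (Fin (m / 2) → Fin (m / 2))) = {σ | IsCenteredSimple k n σ} := by
      ext; simp [S]
    rw [← hS, Set.ncard_coe_finset] at ih
    have hset : {σ : Fin m → Fin m | IsCenteredSimple k (n + 1) σ} =
        ((S ×ˢ S).biUnion fun p => (centeredSimpleFrom k n p.1 p.2 : Set (Fin m → Fin m)).toFinset :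
          Finset (Fin m → Fin m)) := by
      ext σ
      simp only [Set.mem_ofPred_eq, Finset.coe_biUnion, Set.mem_iUnion, Set.coe_toFinset]
      constructor
      · intro h
        obtain ⟨ρ, ρ', hρ, hρ', hσ⟩ := h.exists_halves hk
        exact ⟨(ρ, ρ'), by simp [S, hρ, hρ'], hσ⟩
      · rintro ⟨p, -, hσ⟩
        exact hσ.1
    rw [hset, Set.ncard_coe_finset, Finset.card_biUnion]
    · rw [Finset.sum_const_nat (m := 2), Finset.card_product, ih, ← pow_add, ← pow_succ]
      · congr 1
        have := Nat.one_le_two_pow (n := n + 1)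
        rw [pow_succ 2 (n + 1)]
        omega
      · intro p hp
        rw [← Set.ncard_eq_toFinset_card']
        simp only [S, Finset.mem_product, Finset.mem_filter, Finset.mem_univ, true_and] at hp
        exact ncard_centeredSimpleFrom hm hp.1 hp.2
    · intro p _ p' _ hne
      refine Finset.disjoint_left.2 fun σ h h' => ?_
      rw [Set.mem_toFinset] at h h'
      obtain ⟨e, e'⟩ := eq_of_mem_centeredSimpleFrom h h'
      exact hne (Prod.ext e e')

end Permutations

/-! ### From permutations to digraphs and types -/

section Digraphs

variable {m n k : ℕ} {σ τ : Fin m → Fin m}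

theorem orbitDigraph_eq {X : Type*} [LinearOrder X] {f : X → X} {β : Fin m → X} (hβ : StrictMono β)
    (hσ : Function.Semiconj β σ f) : orbitDigraph f β = orbitDigraph σ id := by
  ext i s
  have h : ∀ a b c d : Fin m, a ≤ b →
      (Set.Icc (β a) (β b) ⊆ Set.uIcc (β c) (β d) ↔ Set.Icc a b ⊆ Set.uIcc c d) := by
    intro a b c d hab
    rw [Set.uIcc, Set.uIcc, Set.Icc_subset_Icc_iff hab, Set.Icc_subset_Icc_iff (hβ.monotone hab),
      ← hβ.monotone.map_inf, ← hβ.monotone.map_sup, hβ.le_iff_le, hβ.le_iff_le]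
  simp only [orbitDigraph, id, ← hσ.eq]
  exact h _ _ _ _ (Fin.mk_le_mk.2 (by omega))

theorem orbitDigraph_id_adj {i s : Fin (m - 1)} : (orbitDigraph σ id).Adj i s ↔
    min (σ ⟨i, by omega⟩).val (σ ⟨i + 1, by omega⟩).val ≤ s ∧
      s + 1 ≤ max (σ ⟨i, by omega⟩).val (σ ⟨i + 1, by omega⟩).val := by
  simp only [orbitDigraph, id]
  rw [Set.uIcc, Set.Icc_subset_Icc_iff (Fin.mk_le_mk.2 (by omega))]
  simp only [inf_le_iff, le_sup_iff, Fin.le_def]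

/-- The edges leaving the vertex `i` determine the unordered pair of images of `i` and `i + 1`. Two
overlapping pairs single out the image of the common point, so three points suffice to fix the
order. -/
theorem orbitDigraph_id_injective (hm : 3 ≤ m) (hσ : Function.Injective σ)
    (hτ : Function.Injective τ) (h : orbitDigraph σ id = orbitDigraph τ id) : σ = τ := by
  have hne : ∀ {ρ : Fin m → Fin m}, Function.Injective ρ → ∀ i j (hi : i < m) (hj : j < m), i ≠ j →
      (ρ ⟨i, hi⟩).val ≠ (ρ ⟨j, hj⟩).val := fun hρ i j hi hj hij e =>
    hij (Fin.mk.inj_iff.1 (hρ (Fin.ext e)))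
  have hpair : ∀ i (hi : i + 1 < m),
      ((σ ⟨i, by omega⟩).val = (τ ⟨i, by omega⟩).val ∧
        (σ ⟨i + 1, hi⟩).val = (τ ⟨i + 1, hi⟩).val) ∨
      ((σ ⟨i, by omega⟩).val = (τ ⟨i + 1, hi⟩).val ∧
        (σ ⟨i + 1, hi⟩).val = (τ ⟨i, by omega⟩).val) := by
    intro i hi
    have hadj : ∀ s, s + 1 < m →
        (min (σ ⟨i, by omega⟩).val (σ ⟨i + 1, hi⟩).val ≤ s ∧
          s + 1 ≤ max (σ ⟨i, by omega⟩).val (σ ⟨i + 1, hi⟩).val ↔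
        min (τ ⟨i, by omega⟩).val (τ ⟨i + 1, hi⟩).val ≤ s ∧
          s + 1 ≤ max (τ ⟨i, by omega⟩).val (τ ⟨i + 1, hi⟩).val) := fun s hs => by
      have e : (orbitDigraph σ id).Adj ⟨i, by omega⟩ ⟨s, by omega⟩ ↔
        (orbitDigraph τ id).Adj ⟨i, by omega⟩ ⟨s, by omega⟩ := by rw [h]
      rw [orbitDigraph_id_adj, orbitDigraph_id_adj] at e
      exact e
    have h1 := hne hσ i (i + 1) (by omega) hi (by omega)
    have h2 := hne hτ i (i + 1) (by omega) hi (by omega)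
    have b1 := (σ ⟨i, by omega⟩).2
    have b2 := (σ ⟨i + 1, hi⟩).2
    have b3 := (τ ⟨i, by omega⟩).2
    have b4 := (τ ⟨i + 1, hi⟩).2
    generalize (σ ⟨i, by omega⟩).val = a at *
    generalize (σ ⟨i + 1, hi⟩).val = b at *
    generalize (τ ⟨i, by omega⟩).val = c at *
    generalize (τ ⟨i + 1, hi⟩).val = d at *
    have e1 := hadj (min a b) (by omega)
    have e2 := hadj (max a b - 1) (by omega)
    have e3 := hadj (min c d) (by omega)
    have e4 := hadj (max c d - 1) (by omega)
    omega
  have hfirst : ∀ i (hi : i + 1 < m), (σ ⟨i, by omega⟩).val = (τ ⟨i, by omega⟩).val ∧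
      (σ ⟨i + 1, hi⟩).val = (τ ⟨i + 1, hi⟩).val := by
    intro i hi
    rcases hpair i hi with h | ⟨h1, h2⟩
    · exact h
    exfalso
    by_cases hi2 : i + 2 < m
    · rcases hpair (i + 1) hi2 with h | h
      · exact hne hτ i (i + 1) (by omega) hi (by omega) (h2.symm.trans h.1)
      · exact hne hτ i (i + 2) (by omega) hi2 (by omega) (h2.symm.trans h.1)
    · obtain ⟨j, rfl⟩ : ∃ j, i = j + 1 := ⟨i - 1, by omega⟩
      rcases hpair j (by omega) with h | h
      · exact hne hτ (j + 1 + 1) (j + 1) hi (by omega) (by omega) (h1.symm.trans h.2)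
      · exact hne hτ (j + 1 + 1) j hi (by omega) (by omega) (h1.symm.trans h.2)
  funext x
  apply Fin.ext
  by_cases hx : x.val + 1 < m
  · exact (hfirst x.val hx).1
  · obtain ⟨j, hj⟩ : ∃ j, x.val = j + 1 := ⟨x.val - 1, by omega⟩
    have e : x = ⟨j + 1, by omega⟩ := Fin.ext hj
    rw [e]
    exact (hfirst j (by omega)).2

theorem inverseDigraph_orbitDigraph :
    inverseDigraph (orbitDigraph σ id) = orbitDigraph (mirror σ) id := by
  ext i s
  change (orbitDigraph σ id).Adj i.rev s.rev ↔ _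
  rw [orbitDigraph_id_adj, orbitDigraph_id_adj]
  have e1 : (⟨i.rev.val, by omega⟩ : Fin m) = Fin.rev ⟨i + 1, by omega⟩ := by
    rw [Fin.ext_iff]; simp only [Fin.val_rev]; omega
  have e2 : (⟨i.rev.val + 1, by omega⟩ : Fin m) = Fin.rev ⟨i, by omega⟩ := by
    rw [Fin.ext_iff]; simp only [Fin.val_rev]; omega
  rw [e1, e2]
  simp only [mirror, Fin.val_rev]
  have b1 := (σ (Fin.rev ⟨i, by omega⟩)).2
  have b2 := (σ (Fin.rev ⟨i + 1, by omega⟩)).2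
  omega

theorem minimalDigraphs_eq {I : Set ℝ} (hI : I.OrdConnected) (hI' : I.Nontrivial) (hk : 1 < k)
    (hm : m = 2 ^ n * (2 * k + 1)) :
    minimalDigraphs I m = (fun σ => orbitDigraph σ id) '' {σ | IsCenteredSimple k n σ} := by
  ext D
  constructor
  · rintro ⟨f, β, hf, h, rfl⟩
    obtain ⟨σ, hσ, hc⟩ := h.exists_isCenteredSimple hI hf hk hm
    exact ⟨σ, hc, (orbitDigraph_eq h.1.2.1 hσ).symm⟩
  · rintro ⟨σ, hc, rfl⟩
    obtain ⟨f, β, hf, h, hσ⟩ := IsCenteredSimple.exists_isMinimalOrbit hc (by omega) hI hI'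
    exact ⟨f, β, hf, h, (orbitDigraph_eq h.1.2.1 hσ).symm⟩

theorem IsCenteredSimple.injOn_orbitDigraph (hk : 0 < k) :
    Set.InjOn (fun σ : Fin m → Fin m => orbitDigraph σ id) {σ | IsCenteredSimple k n σ} :=
  fun _ hσ _ hτ e => orbitDigraph_id_injective (three_le hσ hk) hσ.periodic.injective
    hτ.periodic.injective e

theorem minimalDigraphsFrom_eq {I : Set ℝ} (hI : I.OrdConnected) (hI' : I.Nontrivial) (hk : 1 < k)
    (hm : m = 2 ^ (n + 1) * (2 * k + 1)) {ρ ρ' : Fin (m / 2) → Fin (m / 2)}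
    (hρ : IsCenteredSimple k n ρ) (hρ' : IsCenteredSimple k n ρ') :
    minimalDigraphsFrom I m (orbitDigraph ρ id) (orbitDigraph ρ' id) =
      (fun σ => orbitDigraph σ id) '' centeredSimpleFrom k n ρ ρ' := by
  ext D
  constructor
  · rintro ⟨f, β, hf, h, rfl, hl, hr⟩
    obtain ⟨σ, hσ, hc⟩ := h.exists_isCenteredSimple hI hf hk hm
    refine ⟨σ, ?_, (orbitDigraph_eq h.1.2.1 hσ).symm⟩
    obtain ⟨ρ₁, ρ₁', hρ₁, hρ₁', hmem⟩ := hc.exists_halves hk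
    have hβi := h.1.2.1.injective
    rw [orbitDigraph_eq (leftHalf_strictMono h.1.2.1)
      ((semiconj_leftHalf_iff hβi hσ).2 hmem.2.1)] at hl
    rw [orbitDigraph_eq (rightHalf_strictMono h.1.2.1)
      ((semiconj_rightHalf_iff hβi hσ).2 hmem.2.2)] at hr
    obtain rfl := IsCenteredSimple.injOn_orbitDigraph (by omega) hρ₁ hρ hl
    obtain rfl := IsCenteredSimple.injOn_orbitDigraph (by omega) hρ₁' hρ' hr
    exact hmem
  · rintro ⟨σ, hmem, rfl⟩
    obtain ⟨f, β, hf, h, hσ⟩ := hmem.1.exists_isMinimalOrbit (by omega) hI hI'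
    have hβi := h.1.2.1.injective
    exact ⟨f, β, hf, h, (orbitDigraph_eq h.1.2.1 hσ).symm,
      orbitDigraph_eq (leftHalf_strictMono h.1.2.1) ((semiconj_leftHalf_iff hβi hσ).2 hmem.2.1),
      orbitDigraph_eq (rightHalf_strictMono h.1.2.1) ((semiconj_rightHalf_iff hβi hσ).2 hmem.2.2)⟩

theorem digraphType_orbitDigraph_eq_iff (hk : 1 < k) (hσ : IsCenteredSimple k n σ)
    (hτ : IsCenteredSimple k n τ) :
    digraphType (orbitDigraph τ id) = digraphType (orbitDigraph σ id) ↔ τ = σ ∨ τ = mirror σ := by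
  have hinj := IsCenteredSimple.injOn_orbitDigraph (m := m) (n := n) (k := k) (by omega)
  unfold digraphType
  rw [inverseDigraph_orbitDigraph, inverseDigraph_orbitDigraph]
  constructor
  · intro h
    have : orbitDigraph τ id ∈ ({orbitDigraph σ id, orbitDigraph (mirror σ) id} : Set _) :=
      h ▸ Set.mem_insert _ _
    exact this.imp (fun e => hinj hτ hσ e) fun e => hinj hτ (hσ.mirror hk) e
  · rintro (rfl | rfl)
    · rfl
    · rw [mirror_mirror, Set.pair_comm]

/-- Every fibre is a pair of a permutation and its mirror image, which are different; this halves
the count. -/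
theorem ncard_digraphType_image (hk : 1 < k) (hm : m = 2 ^ n * (2 * k + 1)) :
    ((fun σ : Fin m → Fin m => digraphType (orbitDigraph σ id)) ''
      {σ | IsCenteredSimple k n σ}).ncard = 2 ^ (2 ^ (n + 1) - 2) := by
  classical
  set S : Finset (Fin m → Fin m) := Finset.univ.filter (IsCenteredSimple k n ·)
  have hS : (S : Set (Fin m → Fin m)) = {σ | IsCenteredSimple k n σ} := by
    ext; simp [S]
  have hcard := ncard_isCenteredSimple hk n hm
  rw [← hS, Set.ncard_coe_finset] at hcard
  rw [← hS, ← Finset.coe_image, Set.ncard_coe_finset]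
  have hsum := Finset.card_eq_sum_card_image
    (fun σ : Fin m → Fin m => digraphType (orbitDigraph σ id)) S
  rw [Finset.sum_const_nat (m := 2), hcard] at hsum
  · have h1 : 2 ^ (n + 1) - 1 = 2 ^ (n + 1) - 2 + 1 := by
      have := Nat.one_le_two_pow (n := n)
      rw [pow_succ]
      omega
    rw [h1, pow_succ] at hsum
    omega
  · intro b hb
    rw [Finset.mem_image] at hb
    obtain ⟨σ, hσ, rfl⟩ := hb
    replace hσ : IsCenteredSimple k n σ := by simpa [S] using hσ
    rw [← Finset.card_pair hσ.mirror_ne.symm]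
    congr 1
    ext τ
    simp only [S, Finset.mem_filter, Finset.mem_univ, true_and, Finset.mem_insert,
      Finset.mem_singleton]
    constructor
    · rintro ⟨hτ, e⟩
      exact (digraphType_orbitDigraph_eq_iff hk hσ hτ).1 e
    · intro h
      have hτ : IsCenteredSimple k n τ := by
        rcases h with rfl | rfl
        exacts [hσ, hσ.mirror hk]
      exact ⟨hτ, (digraphType_orbitDigraph_eq_iff hk hσ hτ).2 h⟩

end Digraphs

/-! ### Assembly of the theorem -/

theorem IsMinimalOrbit.isStronglySimple {m n k : ℕ} {I : Set ℝ} (hI : I.OrdConnected)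
    {f : I → I} {β : Fin m → I} (h : IsMinimalOrbit f β) (hf : Continuous f) (hk : 1 < k)
    (hm : m = 2 ^ n * (2 * k + 1)) : IsStronglySimple n f β := by
  obtain ⟨σ, hσ, hc⟩ := h.exists_isCenteredSimple hI hf hk hm
  exact hc.isStronglySimple h.1.2.1 hσ

theorem theorem1p3 (n k : ℕ) (hk : 1 < k) :
    -- exactly `2 ^ (2 ^ (n + 1) - 2)` types up to inverses, the same for all maps and intervals
    (∃ T : Set (Set (Digraph (Fin (2 ^ n * (2 * k + 1) - 1)))),
      T.ncard = 2 ^ (2 ^ (n + 1) - 2) ∧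
      ∀ I : Set ℝ, I.OrdConnected → I.Nontrivial →
        digraphType '' minimalDigraphs I (2 ^ n * (2 * k + 1)) = T) ∧
    -- every minimal orbit is strongly simple
    (∀ I : Set ℝ, I.OrdConnected → I.Nontrivial →
      ∀ (f : I → I) (β : Fin (2 ^ n * (2 * k + 1)) → I), Continuous f → IsMinimalOrbit f β →
        IsStronglySimple n f β) ∧
    -- for `n ≥ 1`, the halves of a minimal orbit are interchanged by `f`, and they are minimal
    -- and strongly simple orbits of `f²` of half the length
    (1 ≤ n → ∀ I : Set ℝ, I.OrdConnected → I.Nontrivial →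
      ∀ (f : I → I) (β : Fin (2 ^ n * (2 * k + 1)) → I), Continuous f → IsMinimalOrbit f β →
        SwapsHalves f β ∧
        IsMinimalOrbit f^[2] (leftHalf β) ∧ IsStronglySimple (n - 1) f^[2] (leftHalf β) ∧
        IsMinimalOrbit f^[2] (rightHalf β) ∧ IsStronglySimple (n - 1) f^[2] (rightHalf β)) ∧
    -- for `n ≥ 1`, the digraph is constructed from the digraphs of the two halves: any two digraphs
    -- of minimal orbits of half the length occur, and they leave exactly two possibilities
    (1 ≤ n → ∀ I : Set ℝ, I.OrdConnected → I.Nontrivial →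
      ∀ G ∈ minimalDigraphs I (2 ^ n * (2 * k + 1) / 2),
      ∀ G' ∈ minimalDigraphs I (2 ^ n * (2 * k + 1) / 2),
        (minimalDigraphsFrom I (2 ^ n * (2 * k + 1)) G G').ncard = 2) := by
  refine ⟨⟨_, ncard_digraphType_image hk rfl, fun I hI hI' => ?_⟩, ?_, ?_, ?_⟩
  · rw [minimalDigraphs_eq hI hI' hk rfl, Set.image_image]
  · intro I hI _ f β hf h
    exact h.isStronglySimple hI hf hk rfl
  · intro hn I hI _ f β hf h
    obtain ⟨n, rfl⟩ := Nat.exists_eq_add_of_le' hn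
    obtain ⟨hs, hl, hr⟩ := h.halves_of_ordConnected hI hf hk rfl
    exact ⟨hs, hl, hl.isStronglySimple hI (hf.iterate 2) hk (half_length rfl), hr,
      hr.isStronglySimple hI (hf.iterate 2) hk (half_length rfl)⟩
  · intro hn I hI hI' G hG G' hG'
    obtain ⟨n, rfl⟩ := Nat.exists_eq_add_of_le' hn
    rw [minimalDigraphs_eq hI hI' hk (half_length rfl)] at hG hG'
    obtain ⟨ρ, hρ, rfl⟩ := hG
    obtain ⟨ρ', hρ', rfl⟩ := hG'
    rw [minimalDigraphsFrom_eq hI hI' hk rfl hρ hρ', Set.InjOn.ncard_image,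
      ncard_centeredSimpleFrom rfl hρ hρ']
    exact (IsCenteredSimple.injOn_orbitDigraph (by omega)).mono fun σ hσ => hσ.1
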